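/- **Theorem 4.3.** Conventions. A *formal parameterization* at $O=(0,0)$ of a plane curve $f=0$ is a pair $(p,q)$ of series in $\mathbb C[[T]]$ with $f(p,q)=0$, $p(0)=q(0)=0$. Two of them are equivalent if $(p_1,q_1)=(p_2\circ s,q_2\circ s)$ with $\operatorname{ord} s=1$; $(p,q)$ is reduced if it is not equivalent to a pair $(p'(T^m),q'(T^m))$ with $m>1$. A *branch* is a class of equivalent reduced formal parameterizations; it is a $\mu$-branch if $\mu=\min(\operatorname{ord}p,\operatorname{ord}q)$. For a polynomial $h$ in $y$ whose coefficients are finite sums of terms $cx^{i}$, $i\in\mathbb Q_{\ge0}$, not divisible by a positive power of $x$, let $y^e$ be the highest power of $y$ dividing $h$ and $\hat h=h/y^e$. The list $\Gamma(h)$ consists of the edges of the Newton polygon of $\hat h$ from left to right (the points $(i,j)$ stand for $x^iy^j$; they are written below after adding $e$ to the ordinates), followed, if $e>0$, by one virtual edge of height $e$. The height of an actual edge is the difference of the ordinates of its endpoints. An actual edge $\mathbf a$ of slope $-1/r$ gives $g^{\mathbf a}=h^{\mathbf a}/(x^uy^v)$, where $h^{\mathbf a}$ is the sum of the terms of $h$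 on the edge and $u,v$ are maximal; as a polynomial in $y$ it has roots $cx^r$ with $c\in\mathbb C\setminus\{0\}$, and the step of the Newton–Puiseux algorithm for such a root leads from $h$ to $\hat h(x,x^r(c+z))/x^m$, $m$ maximal. The virtual edge has the only root $0$ ($c=0$, $r=0$), of multiplicity $e$, and leads to the polynomial $0$. A path of the algorithm stops at a polynomial which is $0$, or which vanishes at $O$ and contains the monomial $z$ with non-zero coefficient. The algorithm *can stop* at $h$ if all the polynomials to which the steps from $h$ lead satisfy this stop criterion. The cases for $\Gamma(h)$ are the following ($i_1,i_2\in\mathbb N$; an edge described only by its height 1 may be virtual): * one edge, from $(0,2)$ to $(i_1,0)$. Case 2.1: $i_1$ odd. Case 2.2.1 (2.2.2): $i_1$ even and two simple roots (one double root). * Case 3: two edges, from $(0,2)$ to $(i_1,1)$, and of height 1. * one edge, from $(0,3)$ to $(i_1,0)$. Case 4.1: $3\nmid i_1$. Case 4.2.1 (4.2.2, 4.2.3): $3\mid i_1$ and three simple roots (one simple and one double root; one triple root). * two edges, from $(0,3)$ to $(i_1,1)$, and of height 1. Case 5.1: $i_1$ odd. Case 5.2.1 (5.2.2): $i_1$ even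 and the first edge has two simple roots (one double root). * two edges, from $(0,3)$ to $(i_1,2)$ and from $(i_1,2)$ to $(i_2,0)$. Case 6.1: $i_1+i_2$ odd. Case 6.2.1 (6.2.2): $i_1+i_2$ even and the second edge has two simple roots (one double root). * Case 7: three edges, from $(0,3)$ to $(i_1,2)$, from $(i_1,2)$ to $(i_2,1)$, and of height 1. Statement. Let $f\in\mathbb C[x,y]$ be squarefree with $$f=y^3+\sum_{i+j\ge4}a_{ij}x^iy^j .$$ Then the Newton–Puiseux algorithm for $f$ starts with a finite number $n\ge0$ of steps of case 4.2.3, leading from $f_0=f$ to $f_1,\dots,f_n$, each being the only possible step and none of $f_0,\dots,f_n$ satisfying the stop criterion. Let $b_1x^{k_1},\dots,b_nx^{k_n}$ be the triple roots ($b_i\ne0$, $k_i\ge1$ integers), $h_i=k_1+\dots+k_i$, $h_0=0$, and $B(T)=b_1T^{h_1}+\dots+b_nT^{h_n}$. Then one of the following holds, where "$+\cdots$" stands for terms of higher degree. For a simple root $cx^{r}$ the coefficient $c$ vanishes if and only if the root comes from a virtual edge; then $r=0$ and there are no further terms in the corresponding 1-branch. (i) $f_n$ is a case 4.1, the algorithm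 can stop at $f_n$, and the curve has exactly one branch at $O$, a 3-branch, with a parameterization $$\bigl(T^3,\;B(T^3)+c\,T^{s}+\cdots\bigr),\qquad s\not\equiv0\pmod 3,\quad c\neq0,$$ with $s=3h_n+i_1$, $i_1>0$, and $c\,x^{i_1/3}$ a simple root for $f_n$. (ii) $f_n$ is a case 4.2.1, 5.2.1, 6.2.1 or 7, the algorithm can stop at $f_n$, and the curve has exactly three branches at $O$, all of them 1-branches, with parameterizations $$\bigl(T,\;B(T)+c_jT^{h_n+q_j}+\cdots\bigr),\qquad j=1,2,3,$$ with $c_jx^{q_j}$ three distinct simple roots for $f_n$; $q_1=q_2=q_3$ in case 4.2.1, and $q_1=q_2$ in cases 5.2.1 and 6.2.1. (iii) $f_n$ is a case 5.1 or 6.1, the algorithm can stop at $f_n$, and the curve has exactly two branches at $O$, a 1-branch and a 2-branch, with parameterizations $$\bigl(T,\;B(T)+c\,T^{h_n+q}+\cdots\bigr),\qquad \bigl(T^2,\;B(T^2)+d\,T^{2h+1}+\cdots\bigr),\qquad d\ne0,$$ with $2h+1=2h_n+i_1$, $i_1>0$, and $cx^q$, $d\,x^{i_1/2}$ simple roots for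 $f_n$. (iv) $f_n$ is a case 4.2.2, 5.2.2 or 6.2.2, with a simple root $c_1x^{p_1}$ and a double root $c_2x^{p_2}$, where $c_2\ne0$, $p_2\geq 1$; $p_1=p_2$ and $c_1\ne c_2$ in case 4.2.2, $p_1>p_2$ (or the simple root comes from a virtual edge) in case 5.2.2, and $p_1<p_2$ in case 6.2.2. Every step from $f_n$ other than the one for the double root leads to a polynomial that satisfies the stop criterion. The step for the double root leads to a polynomial $\phi_0$ from which there follow a finite number $m\ge0$ of steps of case 2.2.2, each being the only possible one, to $\phi_1,\dots,\phi_m$; none of $\phi_0,\dots,\phi_m$ satisfies the stop criterion, and the algorithm can stop at $\phi_m$. Let $d_1x^{l_1},\dots,d_mx^{l_m}$ be the corresponding double roots ($d_i\neq0$, $l_i\ge1$ integers), $\kappa_i=h_n+p_2+l_1+\dots+l_i$, $\kappa_0=h_n+p_2$, and $D(T)=B(T)+c_2T^{\kappa_0}+d_1T^{\kappa_1}+\dots+d_mT^{\kappa_m}$. Then * either $\phi_m$ is a case 2.1, and the curve has exactly two branches at $O$, a 1-branch and a 2-branch, with parameterizations $$\bigl(T,\;B(T)+c_1T^{h_n+p_1}+\cdots\bigr),\qquad\bigl(T^2,\;D(T^2)+a\,T^{2h+1}+\cdots\bigr),\qquad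 a\ne0,$$ with $2h+1=2\kappa_m+i_1$, $i_1>0$, and $a\,x^{i_1/2}$ a simple root for $\phi_m$; * or $\phi_m$ is a case 2.2.1 or 3, and the curve has exactly three branches at $O$, all of them 1-branches, with parameterizations $$\bigl(T,\;B(T)+c_1T^{h_n+p_1}+\cdots\bigr),\quad\bigl(T,\;D(T)+e_1T^{\kappa_m+q_1}+\cdots\bigr),\quad\bigl(T,\;D(T)+g_1T^{\kappa_m+q_2}+\cdots\bigr),$$ with $e_1x^{q_1}$, $g_1x^{q_2}$ two distinct simple roots for $\phi_m$, and $q_1=q_2$ in case 2.2.1. -/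

import Mathlib

open Polynomial

noncomputable section

namespace NewtonPuiseux

/-! ### Branches of a plane curve at the origin -/

/-- A pair `(p(T), q(T))` of formal power series. -/
abbrev Param : Type := PowerSeries ℂ × PowerSeries ℂ

/-- `(p, q)` is a formal parameterization at the origin of the curve `f = 0`
(the variable `0` is `x`, the variable `1` is `y`). -/
def IsParam (f : MvPolynomial (Fin 2) ℂ) (R : Param) : Prop :=
  MvPolynomial.aeval ![R.1, R.2] f = 0 ∧
    PowerSeries.constantCoeff R.1 = 0 ∧ PowerSeries.constantCoeff R.2 = 0

/-- `R₁ = R₂ ∘ s` for a series `s` that is invertible for composition. -/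
def Equivalent (R₁ R₂ : Param) : Prop :=
  ∃ s : PowerSeries ℂ, PowerSeries.constantCoeff s = 0 ∧ PowerSeries.coeff 1 s ≠ 0 ∧
    R₁.1 = R₂.1.subst s ∧ R₁.2 = R₂.2.subst s

/-- `R` is not equivalent to a pair of the form `(p(T^m), q(T^m))` with `m > 1`. -/
def IsReducedParam (R : Param) : Prop :=
  ¬ ∃ m : ℕ, 1 < m ∧ ∃ S : Param,
    Equivalent R (S.1.subst (PowerSeries.X ^ m : PowerSeries ℂ),
      S.2.subst (PowerSeries.X ^ m : PowerSeries ℂ))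

/-- The multiplicity `min (ord p) (ord q)` at the origin. -/
def mult (R : Param) : ℕ∞ := min R.1.order R.2.order

/-- The curve `f = 0` has exactly `s` branches at the origin (a branch is an equivalence class of
reduced formal parameterizations); they are the classes of `R 0, …, R (s - 1)`, and the `j`-th one
is a `μ j`-branch. -/
def BranchesAt (f : MvPolynomial (Fin 2) ℂ) {s : ℕ} (R : Fin s → Param) (μ : Fin s → ℕ) : Prop :=
  (∀ j, IsParam f (R j) ∧ IsReducedParam (R j) ∧ mult (R j) = μ j) ∧
  (∀ i j, Equivalent (R i) (R j) → i = j) ∧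
  (∀ S : Param, IsParam f S → IsReducedParam S → ∃ j, Equivalent S (R j))

/-! ### Puiseux `y`-polynomials and Newton polygons -/

/-- Puiseux series with finitely many terms: the union of the rings `ℂ[x^(1/r)]`, `r ≥ 1`. -/
abbrev PuiseuxPoly : Type := AddMonoidAlgebra ℂ ℚ≥0

/-- Puiseux `y`-polynomials. -/
abbrev PYPoly : Type := Polynomial PuiseuxPoly

/-- The monomial `c x^r`. -/
abbrev xMon (c : ℂ) (r : ℚ≥0) : PuiseuxPoly := AddMonoidAlgebra.single r c

/-- A polynomial in `x, y` as a Puiseux `y`-polynomial. -/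
def toPuiseux (f : MvPolynomial (Fin 2) ℂ) : PYPoly :=
  MvPolynomial.aeval ![(C (xMon 1 1) : PYPoly), (X : PYPoly)] f

/-- The coefficient of `x^i y^j` in `h`. -/
def coeffXY (h : PYPoly) (i : ℚ≥0) (j : ℕ) : ℂ := (h.coeff j).coeff i

/-- The support of `h`: points (exponent of `x`, exponent of `y`). -/
def supp (h : PYPoly) : Set (ℚ≥0 × ℕ) := {P | coeffXY h P.1 P.2 ≠ 0}

/-- The slope of the segment `PQ`. -/
def slope (P Q : ℚ≥0 × ℕ) : ℚ := ((Q.2 : ℚ) - (P.2 : ℚ)) / ((Q.1 : ℚ) - (P.1 : ℚ))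

/-- `P` is the point `P₁` of the Newton polygon: the lowest point of the support on the
`y`-axis. -/
def IsFirstVertex (h : PYPoly) (P : ℚ≥0 × ℕ) : Prop :=
  P ∈ supp h ∧ P.1 = 0 ∧ ∀ j : ℕ, ((0 : ℚ≥0), j) ∈ supp h → P.2 ≤ j

/-- `Q` is the vertex following `P`: a vertical downward ray from `P`, rotated counterclockwise,
first meets the support in the direction of `Q`, and `Q` is the rightmost point so met. -/
def IsNextVertex (h : PYPoly) (P Q : ℚ≥0 × ℕ) : Prop :=
  Q ∈ supp h ∧ P.1 < Q.1 ∧ Q.2 < P.2 ∧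
    ∀ R ∈ supp h, P.1 < R.1 → slope P Q ≤ slope P R ∧ (slope P R = slope P Q → R.1 ≤ Q.1)

/-- Edges of a Newton polygon: the segment from a vertex `P` to the next vertex `Q`, or the virtual
edge that accounts for the root `y = 0` of a polynomial exactly divisible by `y^e`, `e > 0`. -/
inductive Edge : Type
  | actual (P Q : ℚ≥0 × ℕ) : Edge
  | virtual (e : ℕ) : Edge

/-- The height of an edge; the virtual edge has the height `e`. -/
def Edge.height : Edge → ℕ
  | .actual P Q => P.2 - Q.2
  | .virtual e => e

/-- The part of the Newton polygon of `h` to the right of the vertex `P` has the edges in the list,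
from left to right. It stops on the `x`-axis if `y` does not divide `h`; otherwise it stops at the
exact power of `y` that divides `h` (this is the polygon of `h / y^e`, moved up by `e`) and the
virtual edge is added. -/
inductive PolygonFrom (h : PYPoly) : ℚ≥0 × ℕ → List Edge → Prop
  | done (P : ℚ≥0 × ℕ) : P.2 = 0 → PolygonFrom h P []
  | virtual (P : ℚ≥0 × ℕ) : 0 < P.2 → (∀ Q ∈ supp h, P.2 ≤ Q.2) →
      PolygonFrom h P [Edge.virtual P.2]
  | edge (P Q : ℚ≥0 × ℕ) (E : List Edge) : IsNextVertex h P Q → PolygonFrom h Q E →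
      PolygonFrom h P (Edge.actual P Q :: E)

/-- The Newton polygon `Γ(h)` consists of the edges in the list `E`, from left to right. -/
def IsNewtonPolygon (h : PYPoly) (E : List Edge) : Prop :=
  ∃ P, IsFirstVertex h P ∧ PolygonFrom h P E

/-- For an edge `PQ` of slope `-1/r`, the number `r`. -/
def edgeExponent (P Q : ℚ≥0 × ℕ) : ℚ≥0 := (Q.1 - P.1) / ((P.2 - Q.2 : ℕ) : ℚ≥0)

/-- The polynomial `g = h^a / (x^u y^v)` of the edge `a = PQ`: here `u = P.1`, `v = Q.2`, and the
point of ordinate `j` on the edge has abscissa `P.1 + r (P.2 - j)`. -/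
def edgePoly (h : PYPoly) (P Q : ℚ≥0 × ℕ) : PYPoly :=
  ∑ j ∈ Finset.Icc Q.2 P.2,
    C (xMon (coeffXY h (P.1 + edgeExponent P Q * ((P.2 - j : ℕ) : ℚ≥0)) j)
      (edgeExponent P Q * ((P.2 - j : ℕ) : ℚ≥0))) * X ^ (j - Q.2)

/-- `c x^r`, with `-1/r` the slope of the edge, is a root of multiplicity `m ≥ 1` of the polynomial
`g` of the edge. A virtual edge `y^e` has only the root `0`, with `c = 0`, `r = 0`, `m = e`. -/
def Edge.IsRoot (h : PYPoly) : Edge → ℂ → ℚ≥0 → ℕ → Prop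
  | .actual P Q, c, r, m =>
      r = edgeExponent P Q ∧ 0 < m ∧ (edgePoly h P Q).rootMultiplicity (xMon c r) = m
  | .virtual e, c, r, m => c = 0 ∧ r = 0 ∧ m = e

/-- `c x^r` is one of the roots, of multiplicity `m`, that the edges of `Γ(h)` give. -/
def IsRootOf (h : PYPoly) (c : ℂ) (r : ℚ≥0) (m : ℕ) : Prop :=
  ∃ E, IsNewtonPolygon h E ∧ ∃ a ∈ E, a.IsRoot h c r m

/-! ### The `∗`-procedure -/

/-- One step of the Newton-Puiseux algorithm: from `h`, for an edge of `Γ(h)` and a root `c x^r` of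
its polynomial, one gets `g(x, z) = ĥ(x, x^r (c + z)) / x^m`, where `ĥ` is `h` divided by the highest
possible power of `y` and `x^m` is the highest possible power of `x`. The virtual edge gives
`g = 0`. -/
def StarStep (h : PYPoly) (c : ℂ) (r : ℚ≥0) (g : PYPoly) : Prop :=
  ∃ E, IsNewtonPolygon h E ∧
    ((∃ P Q, Edge.actual P Q ∈ E ∧ (∃ m, (Edge.actual P Q).IsRoot h c r m) ∧
        ∃ (e : ℕ) (hhat : PYPoly), h = X ^ e * hhat ∧ ¬ X ∣ hhat ∧
          ∃ m : ℚ≥0, hhat.comp (C (xMon 1 r) * (C (xMon c 0) + X)) = C (xMon 1 m) * g ∧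
            ∃ j, coeffXY g 0 j ≠ 0) ∨
      (∃ e, Edge.virtual e ∈ E ∧ c = 0 ∧ r = 0 ∧ g = 0))

/-- The stop criterion: `g = 0`, or `g` satisfies the assumptions of the implicit function theorem
for Puiseux series, i.e. `g` vanishes at the origin and contains the monomial `z`. -/
def StopCriterion (g : PYPoly) : Prop :=
  g = 0 ∨ (coeffXY g 0 0 = 0 ∧ coeffXY g 0 1 ≠ 0)

/-- The algorithm can stop at `h`: whatever the choice of an edge and of a root, the next polynomial
satisfies the stop criterion. -/
def CanStop (h : PYPoly) : Prop := ∀ c r g, StarStep h c r g → StopCriterion g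

/-! ### The possible Newton polygons of height two and three

A last edge of height one may be the virtual one. -/

/-- One edge, of height 2, from `(0, 2)` to `(i₁, 0)` with `i₁` odd. -/
def Case21 (h : PYPoly) : Prop :=
  ∃ i₁ : ℕ, ¬ 2 ∣ i₁ ∧ IsNewtonPolygon h [.actual (0, 2) (i₁, 0)]

/-- One edge, of height 2, with `i₁` even; its polynomial has two simple roots. -/
def Case221 (h : PYPoly) : Prop :=
  ∃ i₁ : ℕ, 2 ∣ i₁ ∧ IsNewtonPolygon h [.actual (0, 2) (i₁, 0)] ∧
    ∃ c₁ c₂ r, c₁ ≠ c₂ ∧ (Edge.actual (0, 2) (i₁, 0)).IsRoot h c₁ r 1 ∧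
      (Edge.actual (0, 2) (i₁, 0)).IsRoot h c₂ r 1

/-- One edge, of height 2, with `i₁` even; its polynomial has a double root. -/
def Case222 (h : PYPoly) : Prop :=
  ∃ i₁ : ℕ, 2 ∣ i₁ ∧ IsNewtonPolygon h [.actual (0, 2) (i₁, 0)] ∧
    ∃ c r, (Edge.actual (0, 2) (i₁, 0)).IsRoot h c r 2

/-- Two edges, of height 1 and 1. -/
def Case3 (h : PYPoly) : Prop :=
  ∃ (i₁ : ℕ) (b : Edge), b.height = 1 ∧ IsNewtonPolygon h [.actual (0, 2) (i₁, 1), b]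

/-- One edge, of height 3, from `(0, 3)` to `(i₁, 0)` with `3 ∤ i₁`. -/
def Case41 (h : PYPoly) : Prop :=
  ∃ i₁ : ℕ, ¬ 3 ∣ i₁ ∧ IsNewtonPolygon h [.actual (0, 3) (i₁, 0)]

/-- One edge, of height 3, with `3 ∣ i₁`; its polynomial has three simple roots. -/
def Case421 (h : PYPoly) : Prop :=
  ∃ i₁ : ℕ, 3 ∣ i₁ ∧ IsNewtonPolygon h [.actual (0, 3) (i₁, 0)] ∧
    ∃ c₁ c₂ c₃ r, c₁ ≠ c₂ ∧ c₂ ≠ c₃ ∧ c₃ ≠ c₁ ∧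
      (Edge.actual (0, 3) (i₁, 0)).IsRoot h c₁ r 1 ∧
      (Edge.actual (0, 3) (i₁, 0)).IsRoot h c₂ r 1 ∧
      (Edge.actual (0, 3) (i₁, 0)).IsRoot h c₃ r 1

/-- One edge, of height 3, with `3 ∣ i₁`; its polynomial has a simple and a double root. -/
def Case422 (h : PYPoly) : Prop :=
  ∃ i₁ : ℕ, 3 ∣ i₁ ∧ IsNewtonPolygon h [.actual (0, 3) (i₁, 0)] ∧
    ∃ c₁ c₂ r, (Edge.actual (0, 3) (i₁, 0)).IsRoot h c₁ r 1 ∧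
      (Edge.actual (0, 3) (i₁, 0)).IsRoot h c₂ r 2

/-- One edge, of height 3, with `3 ∣ i₁`; its polynomial has a triple root. -/
def Case423 (h : PYPoly) : Prop :=
  ∃ i₁ : ℕ, 3 ∣ i₁ ∧ IsNewtonPolygon h [.actual (0, 3) (i₁, 0)] ∧
    ∃ c r, (Edge.actual (0, 3) (i₁, 0)).IsRoot h c r 3

/-- Two edges, of heights 2 and 1, with `i₁` odd. -/
def Case51 (h : PYPoly) : Prop :=
  ∃ (i₁ : ℕ) (b : Edge), ¬ 2 ∣ i₁ ∧ b.height = 1 ∧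
    IsNewtonPolygon h [.actual (0, 3) (i₁, 1), b]

/-- Two edges, of heights 2 and 1, with `i₁` even; the first one has two simple roots. -/
def Case521 (h : PYPoly) : Prop :=
  ∃ (i₁ : ℕ) (b : Edge), 2 ∣ i₁ ∧ b.height = 1 ∧
    IsNewtonPolygon h [.actual (0, 3) (i₁, 1), b] ∧
    ∃ c₁ c₂ r, c₁ ≠ c₂ ∧ (Edge.actual (0, 3) (i₁, 1)).IsRoot h c₁ r 1 ∧
      (Edge.actual (0, 3) (i₁, 1)).IsRoot h c₂ r 1

/-- Two edges, of heights 2 and 1, with `i₁` even; the first one has a double root. -/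
def Case522 (h : PYPoly) : Prop :=
  ∃ (i₁ : ℕ) (b : Edge), 2 ∣ i₁ ∧ b.height = 1 ∧
    IsNewtonPolygon h [.actual (0, 3) (i₁, 1), b] ∧
    ∃ c r, (Edge.actual (0, 3) (i₁, 1)).IsRoot h c r 2

/-- Two edges, of heights 1 and 2, with `i₁ + i₂` odd. -/
def Case61 (h : PYPoly) : Prop :=
  ∃ i₁ i₂ : ℕ, ¬ 2 ∣ i₁ + i₂ ∧
    IsNewtonPolygon h [.actual (0, 3) (i₁, 2), .actual (i₁, 2) (i₂, 0)]

/-- Two edges, of heights 1 and 2, with `i₁ + i₂` even; the second one has two simple roots. -/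
def Case621 (h : PYPoly) : Prop :=
  ∃ i₁ i₂ : ℕ, 2 ∣ i₁ + i₂ ∧
    IsNewtonPolygon h [.actual (0, 3) (i₁, 2), .actual (i₁, 2) (i₂, 0)] ∧
    ∃ c₁ c₂ r, c₁ ≠ c₂ ∧ (Edge.actual (i₁, 2) (i₂, 0)).IsRoot h c₁ r 1 ∧
      (Edge.actual (i₁, 2) (i₂, 0)).IsRoot h c₂ r 1

/-- Two edges, of heights 1 and 2, with `i₁ + i₂` even; the second one has a double root. -/
def Case622 (h : PYPoly) : Prop :=
  ∃ i₁ i₂ : ℕ, 2 ∣ i₁ + i₂ ∧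
    IsNewtonPolygon h [.actual (0, 3) (i₁, 2), .actual (i₁, 2) (i₂, 0)] ∧
    ∃ c r, (Edge.actual (i₁, 2) (i₂, 0)).IsRoot h c r 2

/-- Three edges, each of height 1. -/
def Case7 (h : PYPoly) : Prop :=
  ∃ (i₁ i₂ : ℕ) (c : Edge), c.height = 1 ∧
    IsNewtonPolygon h [.actual (0, 3) (i₁, 2), .actual (i₁, 2) (i₂, 1), c]

/-! ### Shapes of parameterizations -/

/-- The sum `k 0 + … + k (n - 1)`. -/
def expSum (k : ℕ → ℕ) (n : ℕ) : ℕ := ∑ i ∈ Finset.range n, k i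

/-- With `hᵢ = H + k 0 + … + k i`, the polynomial
`b 0 T^(N h₀) + … + b (n - 1) T^(N hₙ₋₁)`. -/
def stepSum (N H n : ℕ) (b : ℕ → ℂ) (k : ℕ → ℕ) : PowerSeries ℂ :=
  ∑ i ∈ Finset.range n, PowerSeries.C (b i) * PowerSeries.X ^ (N * (H + expSum k (i + 1)))

/-- `c T^s + …`, the dots standing for the terms of degree `> s` given by `T^(s+1) w(T)`. -/
def tail (c : ℂ) (s : ℕ) (w : PowerSeries ℂ) : PowerSeries ℂ :=
  PowerSeries.C c * PowerSeries.X ^ s + PowerSeries.X ^ (s + 1) * w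

end NewtonPuiseux

end

/-!
The theorem follows the Newton–Puiseux algorithm on a curve whose tangent cone is the triple line
`y = 0`. A polynomial `f` in `x, y` is treated as an element of `ℂ[x][y]` (`toBi`, `toPY`), and three
facts carry the argument.

*A simple root is the beginning of a series.* For a root `c x^(k/N)` of an edge, the substitution
`x = T^N`, `y = T^k (c + z)` turns the polynomial, after division by a power of `T`, into one whose
restriction to `T = 0` vanishes at `z = 0` with the multiplicity of the root (`IsEdge.exists_transform`,
`rootMultiplicity_transform`). If the root is simple, then Hensel's lemma (`exists_root_of_simple`)
continues it to a root `c T^k + ⋯` (`IsEdge.exists_evalS_eq_zero`), and the step of the algorithm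
leads to a polynomial that satisfies the stop criterion. Hence the algorithm can stop as soon as all
roots are simple, which is automatic for an edge of height one, and for an edge of prime height with
a non-integral exponent.

*Multiple roots do not go on forever.* Since `f` is squarefree, there is an identity
`A f + B ∂f/∂y = δ(x) ≠ 0` (`exists_discriminant`). If `r` is a root of multiplicity at least two, the
step for `r` divides the polynomial by at least twice the power of `x` by which `y` has been scaled;
after steps with the exponents `k₁, k₂, …`, therefore, `x^(k₁ + k₂ + ⋯)` divides `δ`
(`IsTransform.le_natDegree`), and a chain of steps for roots of maximal multiplicity ends
(`exists_chain`). For the same reason no polynomial that occurs is divisible by `y²`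
(`IsTransform.exists_ne_zero`), so that a virtual edge has height one. What is left is the list of
Newton polygons of height three and two (`cases_height_three`, `cases_height_two`).

*Three roots are all.* The coefficient of `y³` in `f` does not vanish at `x = 0` and lower coefficients
do, hence there are no more than three roots of `f` in `ℂ⟦x^(1/L)⟧` without constant term
(`eq_of_three_roots`). Every parameterization becomes `(T^N, q(T))` after a change of parameter, and
the order of `x` is the smaller one because the tangent is `y = 0`. A series in `x^(1/N)`, with `N` a
prime, that is not a series in `x`, and its conjugates under the `N`-th roots of unity belong to one
`N`-branch. So the series found account for three roots in each of the cases, and therefore for all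
branches (`branchesAt_triple`, `branchesAt_three_smooth`, `branchesAt_smooth_and_cusp`).
-/

noncomputable section

namespace NewtonPuiseux

/-! ### Substitution into power series -/

/-- Invertible substitutions can be undone: `q = q' ∘ s`. -/
theorem exists_subst_eq {s : PowerSeries ℂ} (h0 : PowerSeries.constantCoeff s = 0)
    (h1 : PowerSeries.coeff 1 s ≠ 0) :
    ∃ t : PowerSeries ℂ, PowerSeries.constantCoeff t = 0 ∧ PowerSeries.coeff 1 t ≠ 0 ∧
      (∀ q : PowerSeries ℂ, PowerSeries.subst s (PowerSeries.subst t q) = q) ∧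
      ∀ q : PowerSeries ℂ, PowerSeries.subst t (PowerSeries.subst s q) = q := by
  have hu : IsUnit (PowerSeries.coeff 1 s) := isUnit_iff_ne_zero.2 h1
  have hs : PowerSeries.HasSubst s := .of_constantCoeff_zero' h0
  have ht0 := PowerSeries.constantCoeff_substInvOfIsUnit s hu
  have ht : PowerSeries.HasSubst (s.substInvOfIsUnit hu) := .of_constantCoeff_zero' ht0
  refine ⟨s.substInvOfIsUnit hu, ht0, ?_, fun q => ?_, fun q => ?_⟩
  · rw [PowerSeries.coeff_one_substInvOfIsUnit]
    exact Units.ne_zero _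
  · rw [PowerSeries.subst_comp_subst_apply ht hs, PowerSeries.subst_substInvOfIsUnit_left s h0 hu,
      PowerSeries.X_subst]
  · rw [PowerSeries.subst_comp_subst_apply hs ht, PowerSeries.subst_substInvOfIsUnit_right s h0 hu,
      PowerSeries.X_subst]

theorem subst_X_pow_injective {n : ℕ} (hn : n ≠ 0) :
    Function.Injective fun p : PowerSeries ℂ => (p.subst (PowerSeries.X ^ n : PowerSeries ℂ) :
      PowerSeries ℂ) := by
  intro p q h
  ext m
  have := congrArg (PowerSeries.coeff (n * m)) h
  simpa [PowerSeries.coeff_subst_X_pow hn, Nat.mul_div_cancel_left m (Nat.pos_of_ne_zero hn)]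
    using this

theorem constantCoeff_subst_of_zero {s : PowerSeries ℂ} (h0 : PowerSeries.constantCoeff s = 0)
    (q : PowerSeries ℂ) :
    PowerSeries.constantCoeff (q.subst s : PowerSeries ℂ) = PowerSeries.constantCoeff q := by
  have hs : PowerSeries.HasSubst s := .of_constantCoeff_zero' h0
  have h1 : q = PowerSeries.C (PowerSeries.constantCoeff q) +
      (q - PowerSeries.C (PowerSeries.constantCoeff q)) := by ring
  have h2 : PowerSeries.constantCoeff
      ((q - PowerSeries.C (PowerSeries.constantCoeff q)).subst s : PowerSeries ℂ) = 0 :=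
    PowerSeries.constantCoeff_subst_eq_zero h0 _ (by simp)
  conv_lhs => rw [h1, PowerSeries.subst_add hs, map_add, h2, PowerSeries.subst_C]
  exact (add_zero _).trans (PowerSeries.constantCoeff_C _)

theorem subst_subst_X_pow {s : PowerSeries ℂ} (h0 : PowerSeries.constantCoeff s = 0)
    {n : ℕ} (hn : n ≠ 0) (q : PowerSeries ℂ) :
    (PowerSeries.subst s (PowerSeries.subst (PowerSeries.X ^ n : PowerSeries ℂ) q) : PowerSeries ℂ) =
      q.subst (s ^ n) := by
  have hs : PowerSeries.HasSubst s := .of_constantCoeff_zero' h0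
  rw [PowerSeries.subst_comp_subst_apply (.X_pow hn) hs, PowerSeries.subst_pow hs,
    PowerSeries.subst_X hs]

theorem subst_X_pow_subst {s : PowerSeries ℂ} (h0 : PowerSeries.constantCoeff s = 0) (n : ℕ) :
    ((PowerSeries.X ^ n : PowerSeries ℂ).subst s : PowerSeries ℂ) = s ^ n := by
  have hs : PowerSeries.HasSubst s := .of_constantCoeff_zero' h0
  rw [PowerSeries.subst_pow hs, PowerSeries.subst_X hs]

/-! ### Substituting series into bivariate polynomials -/

/-- The value `h(p, q)` of a polynomial `h ∈ ℂ[x][y]` at a pair of power series. -/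
def evalS (p q : PowerSeries ℂ) : ℂ[X][X] →+* PowerSeries ℂ :=
  Polynomial.eval₂RingHom (Polynomial.aeval p : ℂ[X] →ₐ[ℂ] PowerSeries ℂ).toRingHom q

@[simp] theorem evalS_X (p q : PowerSeries ℂ) : evalS p q X = q := by simp [evalS]

@[simp] theorem evalS_C (p q : PowerSeries ℂ) (a : ℂ[X]) : evalS p q (C a) = Polynomial.aeval p a := by
  simp [evalS]

theorem evalS_comp (p q : PowerSeries ℂ) (h g : ℂ[X][X]) :
    evalS p q (h.comp g) = evalS p (evalS p q g) h := by
  simp [evalS, Polynomial.eval₂_comp]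

theorem ringHom_evalS (φ : PowerSeries ℂ →ₐ[ℂ] PowerSeries ℂ) (p q : PowerSeries ℂ) (h : ℂ[X][X]) :
    φ (evalS p q h) = evalS (φ p) (φ q) h := by
  have : (φ : PowerSeries ℂ →+* PowerSeries ℂ).comp (evalS p q) = evalS (φ p) (φ q) := by
    refine Polynomial.ringHom_ext (fun a => ?_) (by simp)
    simp [Polynomial.aeval_algHom_apply]
  exact DFunLike.congr_fun this h

theorem evalS_subst {s : PowerSeries ℂ} (h0 : PowerSeries.constantCoeff s = 0)
    (p q : PowerSeries ℂ) (h : ℂ[X][X]) :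
    ((evalS p q h).subst s : PowerSeries ℂ) = evalS (p.subst s) (q.subst s) h := by
  have hs : PowerSeries.HasSubst s := .of_constantCoeff_zero' h0
  have := ringHom_evalS (PowerSeries.substAlgHom hs) p q h
  rw [PowerSeries.coe_substAlgHom] at this
  exact this

theorem constantCoeff_aeval {p : PowerSeries ℂ} (hp : PowerSeries.constantCoeff p = 0) (a : ℂ[X]) :
    PowerSeries.constantCoeff (Polynomial.aeval p a) = a.coeff 0 := by
  have : (PowerSeries.constantCoeff (R := ℂ)).comp
      (Polynomial.aeval p : ℂ[X] →ₐ[ℂ] PowerSeries ℂ).toRingHom = Polynomial.constantCoeff := by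
    refine Polynomial.ringHom_ext (fun a => ?_) (by simp [hp])
    simp
  exact DFunLike.congr_fun this a

/-- The polynomial `f ∈ ℂ[x, y]` as a polynomial in `y` over `ℂ[x]`. -/
def toBi (f : MvPolynomial (Fin 2) ℂ) : ℂ[X][X] := MvPolynomial.aeval ![(C X : ℂ[X][X]), X] f

theorem evalS_toBi (p q : PowerSeries ℂ) (f : MvPolynomial (Fin 2) ℂ) :
    evalS p q (toBi f) = MvPolynomial.aeval ![p, q] f := by
  have : (evalS p q).comp (MvPolynomial.aeval ![(C X : ℂ[X][X]), X] :
      MvPolynomial (Fin 2) ℂ →ₐ[ℂ] ℂ[X][X]).toRingHom =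
      (MvPolynomial.aeval ![p, q] : MvPolynomial (Fin 2) ℂ →ₐ[ℂ] PowerSeries ℂ).toRingHom := by
    refine MvPolynomial.ringHom_ext (fun a => ?_) (fun i => ?_)
    · simp [Polynomial.algebraMap_apply, evalS]
    · fin_cases i <;> simp
  exact DFunLike.congr_fun this f

/-! ### Roots of power series and Hensel's lemma -/

/-- A relation `R a l b`, read as a step labelled `l` from `a` to `b`, can be followed from any
starting point as long as steps are possible. -/
theorem exists_orbit {α β : Type*} [Nonempty β] (R : α → β → α → Prop) (a : α) :
    ∃ (F : ℕ → α) (lab : ℕ → β), F 0 = a ∧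
      ∀ i, (∃ l b, R (F i) l b) → R (F i) (lab i) (F (i + 1)) := by
  classical
  have : ∀ a : α, ∃ lb : β × α, (∃ l b, R a l b) → R a lb.1 lb.2 := fun a => by
    by_cases h : ∃ l b, R a l b
    · obtain ⟨l, b, h⟩ := h
      exact ⟨(l, b), fun _ => h⟩
    · exact ⟨(Classical.arbitrary β, a), fun h' => (h h').elim⟩
  choose nxt hnxt using this
  refine ⟨fun i => (fun b => (nxt b).2)^[i] a, fun i => (nxt ((fun b => (nxt b).2)^[i] a)).1, rfl,
    fun i hi => ?_⟩
  have := hnxt _ hi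
  simpa only [Function.iterate_succ_apply'] using this

theorem eq_zero_of_forall_X_pow_dvd {a : PowerSeries ℂ}
    (h : ∀ n : ℕ, (PowerSeries.X : PowerSeries ℂ) ^ n ∣ a) : a = 0 := by
  ext n
  exact PowerSeries.X_pow_dvd_iff.1 (h (n + 1)) n (Nat.lt_succ_self n)

/-- One digit of a root that is simple modulo `T`: the substitution `z = T (c + z')`. -/
theorem exists_digit (g : (PowerSeries ℂ)[X])
    (h0 : (g.map PowerSeries.constantCoeff).coeff 0 = 0)
    (h1 : (g.map PowerSeries.constantCoeff).coeff 1 ≠ 0) :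
    ∃ (c : ℂ) (g' : (PowerSeries ℂ)[X]),
      g.comp (C PowerSeries.X * (C (PowerSeries.C c) + X)) = C PowerSeries.X * g' ∧
      (g'.map PowerSeries.constantCoeff).coeff 0 = 0 ∧
      (g'.map PowerSeries.constantCoeff).coeff 1 ≠ 0 := by
  rw [coeff_map] at h0 h1
  obtain ⟨b, hb⟩ := PowerSeries.X_dvd_iff.2 h0
  have hg : g = C (g.coeff 0) + C (g.coeff 1) * X + g.divX.divX * X ^ 2 := by
    conv_lhs => rw [← divX_mul_X_add g, ← divX_mul_X_add g.divX, coeff_divX]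
    ring
  -- with `g = T b + a z + ⋯`, the digit has to make `b + a c` vanish
  -- modulo `T`
  set a := g.coeff 1
  set c : ℂ := -(PowerSeries.constantCoeff b) / PowerSeries.constantCoeff a with hc
  refine ⟨c, C b + C a * (C (PowerSeries.C c) + X) + C PowerSeries.X *
    (g.divX.divX.comp (C PowerSeries.X * (C (PowerSeries.C c) + X)) *
      (C (PowerSeries.C c) + X) ^ 2), ?_, ?_, ?_⟩
  · conv_lhs => rw [hg, hb]
    simp only [add_comp, mul_comp, C_comp, X_comp, pow_comp, map_mul]
    ring
  · simp only [Polynomial.map_add, Polynomial.map_mul, map_C, map_X, PowerSeries.constantCoeff_X,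
      map_zero, zero_mul, add_zero, PowerSeries.constantCoeff_C]
    simp [hc]
    field_simp
    ring
  · simp only [Polynomial.map_add, Polynomial.map_mul, map_C, map_X, PowerSeries.constantCoeff_X,
      map_zero, zero_mul, add_zero, PowerSeries.constantCoeff_C]
    simpa [coeff_C, mul_add] using h1

/-- The implicit function theorem for a polynomial over `ℂ⟦T⟧`: a root that is simple modulo `T`
lifts. The digits of the root are found one by one. -/
theorem exists_root_of_simple (g : (PowerSeries ℂ)[X])
    (h0 : PowerSeries.constantCoeff (g.coeff 0) = 0)
    (h1 : PowerSeries.constantCoeff (g.coeff 1) ≠ 0) :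
    ∃ z : PowerSeries ℂ, g.eval (PowerSeries.X * z) = 0 := by
  obtain ⟨G, c, hG0, hG⟩ := exists_orbit (fun (g : (PowerSeries ℂ)[X]) (c : ℂ) g' =>
      g.comp (C PowerSeries.X * (C (PowerSeries.C c) + X)) = C PowerSeries.X * g' ∧
      (g'.map PowerSeries.constantCoeff).coeff 0 = 0 ∧
      (g'.map PowerSeries.constantCoeff).coeff 1 ≠ 0) g
  have hP : ∀ n, ((G n).map PowerSeries.constantCoeff).coeff 0 = 0 ∧
      ((G n).map PowerSeries.constantCoeff).coeff 1 ≠ 0 := by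
    intro n
    induction n with
    | zero => simpa [hG0] using And.intro h0 h1
    | succ n ih => exact (hG n (exists_digit _ ih.1 ih.2)).2
  -- the root is `T z 0`, and `T z n` is what is left of it after `n` digits
  set z : ℕ → PowerSeries ℂ := fun n => PowerSeries.mk fun k => c (n + k) with hz
  have hzs : ∀ n, z n = PowerSeries.C (c n) + PowerSeries.X * z (n + 1) := by
    intro n
    ext k
    cases k with
    | zero => simp [hz]
    | succ k => simp [hz, PowerSeries.coeff_succ_X_mul]; congr 1; ring
  have hstep : ∀ n, (G n).eval (PowerSeries.X * z n) =
      PowerSeries.X * (G (n + 1)).eval (PowerSeries.X * z (n + 1)) := by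
    intro n
    have := congrArg (Polynomial.eval (PowerSeries.X * z (n + 1)))
      (hG n (exists_digit _ (hP n).1 (hP n).2)).1
    simp only [eval_comp, eval_mul, eval_C, eval_add, eval_X] at this
    rw [← this, ← hzs n]
  refine ⟨z 0, eq_zero_of_forall_X_pow_dvd fun n => ?_⟩
  have : ∀ n, g.eval (PowerSeries.X * z 0) =
      PowerSeries.X ^ n * (G n).eval (PowerSeries.X * z n) := by
    intro n
    induction n with
    | zero => simp [hG0]
    | succ n ih => rw [ih, hstep n, pow_succ]; ring
  exact ⟨_, this n⟩

/-- A series with nonzero constant term has an `n`-th root: Hensel's lemma at an `n`-th root of the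
constant term. -/
theorem exists_pow_eq {u : PowerSeries ℂ} (hu : PowerSeries.constantCoeff u ≠ 0) {n : ℕ}
    (hn : n ≠ 0) : ∃ v : PowerSeries ℂ, v ^ n = u ∧ PowerSeries.constantCoeff v ≠ 0 := by
  obtain ⟨c, hc⟩ := IsAlgClosed.exists_pow_nat_eq (PowerSeries.constantCoeff u)
    (Nat.pos_of_ne_zero hn)
  have hc0 : c ≠ 0 := by
    rintro rfl
    exact hu (by rw [← hc, zero_pow hn])
  obtain ⟨z, hz⟩ := exists_root_of_simple ((X + C (PowerSeries.C c)) ^ n - C u)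
    (by simp [coeff_zero_eq_eval_zero, hc]) (by
      rw [coeff_sub, coeff_C_of_ne_zero one_ne_zero, coeff_X_add_C_pow]
      simp [hc0, hn])
  refine ⟨PowerSeries.X * z + PowerSeries.C c, ?_, by simpa using hc0⟩
  simpa [sub_eq_zero] using hz

/-! ### Reduced parameterizations and branches -/

theorem order_eq_one {s : PowerSeries ℂ} (h0 : PowerSeries.constantCoeff s = 0)
    (h1 : PowerSeries.coeff 1 s ≠ 0) : s.order = 1 := by
  refine PowerSeries.order_eq_nat.2 ⟨h1, fun i hi => ?_⟩
  obtain rfl : i = 0 := by omega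
  simpa using h0

theorem order_pow_eq {s : PowerSeries ℂ} (h0 : PowerSeries.constantCoeff s = 0)
    (h1 : PowerSeries.coeff 1 s ≠ 0) (n : ℕ) : (s ^ n).order = n := by
  rw [PowerSeries.order_pow, order_eq_one h0 h1]; simp

/-- The pair `(T^n, Y)` is reduced if `n = 1`, or if `n` is a prime number and `Y` is not a series in
`T^n`. The order of `T^n` shows that `m ∣ n` if the pair is equivalent to one in `T^m`. -/
theorem isReducedParam_of_prime {n : ℕ} {Y : PowerSeries ℂ}
    (h : n = 1 ∨ (n.Prime ∧ ∃ e, ¬ n ∣ e ∧ PowerSeries.coeff e Y ≠ 0)) :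
    IsReducedParam (PowerSeries.X ^ n, Y) := by
  rintro ⟨m, hm, ⟨p, q⟩, s, s0, s1, e1, e2⟩
  dsimp only at e1 e2
  have hm0 : m ≠ 0 := by omega
  have hn0 : n ≠ 0 := by
    rcases h with rfl | ⟨h, -⟩
    · exact one_ne_zero
    · exact h.ne_zero
  obtain ⟨t, t0, t1, -, ht⟩ := exists_subst_eq s0 s1
  have hp : (PowerSeries.subst (PowerSeries.X ^ m : PowerSeries ℂ) p : PowerSeries ℂ) = t ^ n := by
    rw [← ht (PowerSeries.subst (PowerSeries.X ^ m : PowerSeries ℂ) p), ← e1,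
      subst_X_pow_subst t0]
  have hord := PowerSeries.order_eq_nat.1 (order_pow_eq t0 t1 n)
  rw [← hp, PowerSeries.coeff_subst_X_pow hm0] at hord
  obtain ⟨hn, hlt⟩ := hord
  have hmn : m ∣ n := by
    by_contra hmn
    simp [hmn] at hn
  rcases h with rfl | ⟨hprime, e, hne, hYe⟩
  · exact absurd (Nat.dvd_one.1 hmn) hm.ne'
  -- now `T^n = p(s^n)` with `p` of order one, so `s^n` is a series in `T^n`, and so is `Y = q(s^n)`
  obtain rfl : m = n := (hprime.eq_one_or_self_of_dvd m hmn).resolve_left hm.ne'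
  rw [if_pos hmn, Nat.div_self (Nat.pos_of_ne_zero hm0)] at hn
  have hp0 : PowerSeries.constantCoeff p = 0 := by
    have := hlt 0 (Nat.pos_of_ne_zero hm0)
    rw [PowerSeries.coeff_subst_X_pow hm0] at this
    simpa using this
  obtain ⟨r, r0, -, hr, -⟩ := exists_subst_eq hp0 hn
  have hpr : PowerSeries.subst p r = PowerSeries.X := by
    have := hr PowerSeries.X
    rwa [PowerSeries.subst_X (PowerSeries.HasSubst.of_constantCoeff_zero' r0)] at this
  have hsm : PowerSeries.constantCoeff (s ^ m) = 0 := by simp [s0, hm0]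
  have hsm' : PowerSeries.HasSubst (s ^ m) := .of_constantCoeff_zero' hsm
  have hsn : s ^ m = PowerSeries.subst (PowerSeries.X ^ m : PowerSeries ℂ) r := by
    rw [e1, subst_subst_X_pow s0 hm0,
      ← PowerSeries.subst_comp_subst_apply (.of_constantCoeff_zero' hp0) hsm', hpr,
      PowerSeries.subst_X hsm']
  apply hYe
  rw [e2, subst_subst_X_pow s0 hm0, hsn, ← PowerSeries.subst_comp_subst_apply
    (.of_constantCoeff_zero' r0) (.X_pow hm0), PowerSeries.coeff_subst_X_pow hm0, if_neg hne]

theorem not_isReducedParam_zero : ¬ IsReducedParam (0, 0) := by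
  refine not_not.2 ⟨2, one_lt_two, (0, 0), PowerSeries.X, by simp, by simp, ?_, ?_⟩ <;>
  · dsimp only
    rw [PowerSeries.X_subst, ← PowerSeries.coe_substAlgHom (.X_pow two_ne_zero), map_zero]

/-- A polynomial whose terms have degree at least four takes a value divisible by `T^(4o)` at series
divisible by `T^o`. -/
theorem X_pow_dvd_aeval (g : MvPolynomial (Fin 2) ℂ) (hg : ∀ d ∈ g.support, 4 ≤ d.degree)
    {p q : PowerSeries ℂ} {o : ℕ} (hp : PowerSeries.X ^ o ∣ p) (hq : PowerSeries.X ^ o ∣ q) :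
    PowerSeries.X ^ (4 * o) ∣ MvPolynomial.aeval ![p, q] g := by
  rw [MvPolynomial.aeval_def, MvPolynomial.eval₂_eq']
  refine Finset.dvd_sum fun d hd => Dvd.dvd.mul_left ?_ _
  have h4 := hg d hd
  rw [Finsupp.degree_eq_sum, Fin.sum_univ_two] at h4
  rw [Fin.prod_univ_two]
  have := mul_dvd_mul (pow_dvd_pow_of_dvd hp (d 0)) (pow_dvd_pow_of_dvd hq (d 1))
  refine dvd_trans ?_ this
  rw [← pow_mul, ← pow_mul, ← pow_add]
  exact pow_dvd_pow _ (by nlinarith)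

/-- The tangent cone of `f` is the triple line `y = 0`. -/
def HasTripleTangent (f : MvPolynomial (Fin 2) ℂ) : Prop :=
  ∃ g : MvPolynomial (Fin 2) ℂ, f = MvPolynomial.X 1 ^ 3 + g ∧ ∀ d ∈ g.support, 4 ≤ d.degree

theorem hasTripleTangent_of_homogeneousComponent {f : MvPolynomial (Fin 2) ℂ}
    (hlow : ∀ i < 3, MvPolynomial.homogeneousComponent i f = 0)
    (hcone : MvPolynomial.homogeneousComponent 3 f = MvPolynomial.X 1 ^ 3) :
    HasTripleTangent f := by
  refine ⟨f - MvPolynomial.X 1 ^ 3, by ring, fun d hd => ?_⟩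
  have h3 : (MvPolynomial.X 1 ^ 3 : MvPolynomial (Fin 2) ℂ).IsHomogeneous 3 := by
    simpa using (MvPolynomial.isHomogeneous_X ℂ (1 : Fin 2)).pow 3
  by_contra hlt
  rw [MvPolynomial.mem_support_iff] at hd
  apply hd
  have h1 := MvPolynomial.coeff_homogeneousComponent d.degree f d
  rw [if_pos rfl] at h1
  rw [MvPolynomial.coeff_sub, ← h1]
  rcases lt_or_eq_of_le (show d.degree ≤ 3 by omega) with h | h
  · rw [hlow _ h, h3.coeff_eq_zero (by omega)]
    simp
  · rw [h, hcone, sub_self]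

/-- A parameterized branch of a curve with tangent cone `y = 0` is tangent to that line. -/
theorem order_le_order {f : MvPolynomial (Fin 2) ℂ} (hf : HasTripleTangent f)
    {p q : PowerSeries ℂ} (hq : PowerSeries.constantCoeff q = 0)
    (h : MvPolynomial.aeval ![p, q] f = 0) : p.order ≤ q.order := by
  by_contra! hlt
  obtain ⟨g, rfl, hg⟩ := hf
  have hq0 : q ≠ 0 := by
    rintro rfl
    simp at hlt
  have hqo := PowerSeries.coe_toNat_order hq0
  set o := q.order.toNat
  have h1 : PowerSeries.X ^ o ∣ q := PowerSeries.X_pow_order_dvd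
  have h2 : PowerSeries.X ^ o ∣ p := by
    refine PowerSeries.X_pow_dvd_iff.2 fun i hi => PowerSeries.coeff_of_lt_order i ?_
    exact lt_trans (by rw [← hqo]; exact_mod_cast hi) hlt
  have h3 := X_pow_dvd_aeval g hg h2 h1
  have h4 : q ^ 3 = - MvPolynomial.aeval ![p, q] g := by
    rw [map_add, map_pow, MvPolynomial.aeval_X] at h
    exact eq_neg_of_add_eq_zero_left h
  rw [← dvd_neg, ← h4] at h3
  have h5 : (q ^ 3).order = (3 * o : ℕ) := by
    rw [PowerSeries.order_pow, ← hqo]; simp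
  have ho : o ≠ 0 := by
    intro ho
    rw [ho] at hqo
    exact PowerSeries.order_ne_zero_iff_constCoeff_eq_zero.2 hq hqo.symm
  exact (PowerSeries.order_eq_nat.1 h5).1 (PowerSeries.X_pow_dvd_iff.1 h3 _ (by omega))

/-- Every pair `(p, q)` with `p ≠ 0` is of the form `(T^N, q')` after a change of parameter. -/
theorem exists_eq_subst {p : PowerSeries ℂ} (hp : p ≠ 0) (hp0 : PowerSeries.constantCoeff p = 0)
    (q : PowerSeries ℂ) : ∃ (N : ℕ) (s q' : PowerSeries ℂ), 0 < N ∧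
      PowerSeries.constantCoeff s = 0 ∧ PowerSeries.coeff 1 s ≠ 0 ∧ p = s ^ N ∧
      q = PowerSeries.subst s q' := by
  obtain ⟨u, hu⟩ := PowerSeries.X_pow_order_dvd (φ := p)
  have hN := PowerSeries.coe_toNat_order hp
  set N := p.order.toNat
  have hN0 : N ≠ 0 := by
    intro h
    rw [h] at hN
    exact PowerSeries.order_ne_zero_iff_constCoeff_eq_zero.2 hp0 hN.symm
  have hu0 : PowerSeries.constantCoeff u ≠ 0 := by
    have := (PowerSeries.order_eq_nat.1 hN.symm).1
    rw [hu] at this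
    simpa [PowerSeries.coeff_X_pow_mul'] using this
  obtain ⟨v, rfl, hv0⟩ := exists_pow_eq hu0 hN0
  have s0 : PowerSeries.constantCoeff (PowerSeries.X * v) = 0 := by simp
  have s1 : PowerSeries.coeff 1 (PowerSeries.X * v) ≠ 0 := by
    rw [← zero_add 1, PowerSeries.coeff_succ_X_mul]
    simpa using hv0
  obtain ⟨t, -, -, ht, -⟩ := exists_subst_eq s0 s1
  exact ⟨N, PowerSeries.X * v, PowerSeries.subst t q, Nat.pos_of_ne_zero hN0, s0, s1,
    by rw [hu, mul_pow], (ht q).symm⟩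

theorem rescale_eq_subst' (ζ : ℂ) (Y : PowerSeries ℂ) :
    PowerSeries.rescale ζ Y = PowerSeries.subst (ζ • PowerSeries.X : PowerSeries ℂ) Y :=
  PowerSeries.rescale_eq_subst ζ Y

/-- The parameterizations `(T^(n j), Y j)` represent all branches if all Puiseux roots come from
them by the substitutions `T ↦ ζ T^M`. -/
theorem branchesAt_of_roots {f : MvPolynomial (Fin 2) ℂ} (hf : HasTripleTangent f) {s : ℕ}
    (n : Fin s → ℕ) (Y : Fin s → PowerSeries ℂ)
    (hroot : ∀ j, evalS (PowerSeries.X ^ n j) (Y j) (toBi f) = 0)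
    (hY : ∀ j, PowerSeries.constantCoeff (Y j) = 0)
    (hprim : ∀ j, n j = 1 ∨ ((n j).Prime ∧ ∃ e, ¬ n j ∣ e ∧ PowerSeries.coeff e (Y j) ≠ 0))
    (hdist : ∀ i j, n i = n j → i = j ∨ (n i = 1 ∧ Y i ≠ Y j))
    (hall : ∀ (N : ℕ) (q : PowerSeries ℂ), 0 < N → PowerSeries.constantCoeff q = 0 →
      evalS (PowerSeries.X ^ N) q (toBi f) = 0 → ∃ (j : Fin s) (M : ℕ) (ζ : ℂ), N = n j * M ∧
        ζ ^ n j = 1 ∧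
        q = PowerSeries.subst (PowerSeries.X ^ M : PowerSeries ℂ) (PowerSeries.rescale ζ (Y j))) :
    BranchesAt f (fun j => (PowerSeries.X ^ n j, Y j)) n := by
  have hn0 : ∀ j, n j ≠ 0 := fun j => by
    rcases hprim j with h | ⟨h, -⟩
    · omega
    · exact h.ne_zero
  refine ⟨fun j => ⟨⟨?_, ?_, hY j⟩, isReducedParam_of_prime (hprim j), ?_⟩, ?_, ?_⟩
  · rw [← evalS_toBi]; exact hroot j
  · simp [hn0 j]
  · have := order_le_order hf (hY j) (by rw [← evalS_toBi]; exact hroot j)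
    rw [mult, min_eq_left this, PowerSeries.order_X_pow]
  -- equivalent parameterizations have the same order of `x`
  · rintro i j ⟨t, t0, t1, e1, e2⟩
    dsimp only at e1 e2
    rw [subst_X_pow_subst t0] at e1
    have hnn : n i = n j := by
      have := congrArg PowerSeries.order e1
      rw [PowerSeries.order_X_pow, order_pow_eq t0 t1] at this
      exact_mod_cast this
    rcases hdist i j hnn with h | ⟨h, hne⟩
    · exact h
    · rw [← hnn, h, pow_one, pow_one] at e1
      rw [← e1, PowerSeries.X_subst] at e2
      exact absurd e2 hne
  · rintro ⟨p, q⟩ ⟨hpar, hp0, hq0⟩ hred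
    dsimp only at hpar hp0 hq0
    by_cases hp : p = 0
    · have := order_le_order hf hq0 hpar
      rw [hp, PowerSeries.order_zero, top_le_iff, PowerSeries.order_eq_top] at this
      rw [hp, this] at hred
      exact absurd hred not_isReducedParam_zero
    obtain ⟨N, t, q', hN, t0, t1, rfl, rfl⟩ := exists_eq_subst hp hp0 q
    have hev : evalS (PowerSeries.X ^ N) q' (toBi f) = 0 := by
      obtain ⟨r, r0, r1, -, hr⟩ := exists_subst_eq t0 t1
      rw [← hr (evalS (PowerSeries.X ^ N) q' (toBi f)), evalS_subst t0, subst_X_pow_subst t0,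
        evalS_toBi, hpar, ← PowerSeries.coe_substAlgHom (.of_constantCoeff_zero' r0), map_zero]
    rw [constantCoeff_subst_of_zero t0] at hq0
    obtain ⟨j, M, ζ, rfl, hζ, rfl⟩ := hall N q' hN hq0 hev
    have hM0 : M ≠ 0 := by rintro rfl; simp at hN
    refine ⟨j, ?_⟩
    have hζ0 : ζ ≠ 0 := by
      rintro rfl
      rw [zero_pow (hn0 j)] at hζ
      exact zero_ne_one hζ
    -- for `M = 1` the substitution is invertible; for `M > 1` the given pair is not reduced
    by_cases hM : M = 1
    · subst hM
      have ht : PowerSeries.HasSubst t := .of_constantCoeff_zero' t0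
      refine ⟨ζ • t, by simp [t0], by simp [hζ0, t1], ?_, ?_⟩
      · dsimp only
        rw [subst_X_pow_subst (by simp [t0]), mul_one, _root_.smul_pow, hζ, one_smul]
      · dsimp only
        rw [pow_one, PowerSeries.X_subst, rescale_eq_subst',
          PowerSeries.subst_comp_subst_apply (PowerSeries.HasSubst.smul_X' ζ) ht,
          PowerSeries.subst_smul ht, PowerSeries.subst_X ht]
    · exfalso
      refine hred ⟨M, by omega, (PowerSeries.X ^ n j, PowerSeries.rescale ζ (Y j)), t, t0, t1, ?_,
        ?_⟩
      · dsimp only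
        rw [PowerSeries.subst_pow (.X_pow hM0), PowerSeries.subst_X (.X_pow hM0), ← pow_mul,
          subst_X_pow_subst t0, mul_comm]
      · rfl

theorem subst_zero' {t : PowerSeries ℂ} (t0 : PowerSeries.constantCoeff t = 0) :
    PowerSeries.subst t (0 : PowerSeries ℂ) = (0 : PowerSeries ℂ) := by
  rw [← PowerSeries.coe_substAlgHom (.of_constantCoeff_zero' t0), map_zero]

/-! ### Completeness of three roots -/

/-- If `h(0, y)` contains `y³`, then three roots of `h(T^L, y)` that vanish at `T = 0` are all. -/
theorem eq_of_three_roots {h : ℂ[X][X]} (h3 : (h.coeff 3).coeff 0 ≠ 0) {L : ℕ} (hL : L ≠ 0)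
    {Z : Fin 3 → PowerSeries ℂ} (hZ : Function.Injective Z)
    (hZ0 : ∀ i, PowerSeries.constantCoeff (Z i) = 0)
    (hZr : ∀ i, evalS (PowerSeries.X ^ L) (Z i) h = 0) {q : PowerSeries ℂ}
    (hq : PowerSeries.constantCoeff q = 0) (hqr : evalS (PowerSeries.X ^ L) q h = 0) :
    ∃ i, q = Z i := by
  set F : (PowerSeries ℂ)[X] :=
    h.map (Polynomial.aeval (PowerSeries.X ^ L : PowerSeries ℂ) : ℂ[X] →ₐ[ℂ] PowerSeries ℂ).toRingHom
    with hF
  have hev : ∀ p, evalS (PowerSeries.X ^ L) p h = F.eval p := fun p => by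
    simp only [hF, Polynomial.eval_map]; rfl
  simp only [hev] at hZr hqr
  obtain ⟨U, hU⟩ : (X - C (Z 0)) * (X - C (Z 1)) * (X - C (Z 2)) ∣ F := by
    obtain ⟨U, hU⟩ := dvd_iff_isRoot.2 (show F.IsRoot (Z 0) from hZr 0)
    have h1 := hZr 1
    rw [hU] at h1
    simp only [eval_mul, eval_sub, eval_X, eval_C, mul_eq_zero, sub_eq_zero] at h1
    obtain ⟨V, hV⟩ := dvd_iff_isRoot.2 (h1.resolve_left (fun e => by simpa using hZ e))
    have h2 := hZr 2
    rw [hU, hV] at h2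
    simp only [eval_mul, eval_sub, eval_X, eval_C, mul_eq_zero, sub_eq_zero] at h2
    obtain ⟨W, hW⟩ := dvd_iff_isRoot.2 ((h2.resolve_left (fun e => by simpa using hZ e)).resolve_left
      (fun e => by simpa using hZ e))
    exact ⟨W, by rw [hU, hV, hW]; ring⟩
  -- at `T = 0` the product of the three factors is `y³`, so the cofactor is a unit at the origin
  have hU3 : PowerSeries.constantCoeff (U.coeff 0) ≠ 0 := by
    have := congrArg (fun G => (G.map PowerSeries.constantCoeff).coeff 3) hU
    simp only [Polynomial.map_mul, Polynomial.map_sub, map_X, map_C, hZ0, map_zero, sub_zero] at this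
    rw [show (X * X * X * U.map PowerSeries.constantCoeff : ℂ[X]) =
      U.map PowerSeries.constantCoeff * X ^ 3 by ring, coeff_mul_X_pow', if_pos le_rfl, hF,
      coeff_map, coeff_map, coeff_map] at this
    rw [← this]
    have hc := constantCoeff_aeval (p := PowerSeries.X ^ L) (by simp [hL]) (h.coeff 3)
    exact fun e => h3 (hc.symm.trans e)
  have hUq : U.eval q ≠ 0 := by
    intro e
    apply hU3
    have := congrArg PowerSeries.constantCoeff e
    rwa [map_zero, ← eval_map_apply, hq, ← coeff_zero_eq_eval_zero, coeff_map] at this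
  rw [hU] at hqr
  simp only [eval_mul, eval_sub, eval_X, eval_C, mul_eq_zero, sub_eq_zero, hUq, or_false] at hqr
  rcases hqr with (h | h) | h
  exacts [⟨_, h⟩, ⟨_, h⟩, ⟨_, h⟩]

/-- As `eq_of_three_roots`, for the roots of `h(T^(L N), y)`. -/
theorem eq_subst_of_three_roots {h : ℂ[X][X]} (h3 : (h.coeff 3).coeff 0 ≠ 0) {L : ℕ} (hL : L ≠ 0)
    {Z : Fin 3 → PowerSeries ℂ} (hZ : Function.Injective Z)
    (hZ0 : ∀ i, PowerSeries.constantCoeff (Z i) = 0)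
    (hZr : ∀ i, evalS (PowerSeries.X ^ L) (Z i) h = 0) {N : ℕ} (hN : N ≠ 0) {q : PowerSeries ℂ}
    (hq : PowerSeries.constantCoeff q = 0) (hqr : evalS (PowerSeries.X ^ (L * N)) q h = 0) :
    ∃ i, q = PowerSeries.subst (PowerSeries.X ^ N : PowerSeries ℂ) (Z i) := by
  have hX : PowerSeries.constantCoeff (PowerSeries.X ^ N : PowerSeries ℂ) = 0 := by simp [hN]
  refine eq_of_three_roots (Z := fun i => PowerSeries.subst (PowerSeries.X ^ N : PowerSeries ℂ) (Z i))
    h3 (mul_ne_zero hL hN) ((subst_X_pow_injective hN).comp hZ) (fun i => ?_) (fun i => ?_) hq hqr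
  · rw [constantCoeff_subst_of_zero hX, hZ0]
  · have := evalS_subst hX (PowerSeries.X ^ L) (Z i) h
    rw [hZr i, subst_X_pow_subst hX, ← pow_mul, mul_comm N L,
      subst_zero' hX] at this
    exact this.symm

/-- The roots in `ℂ⟦x^(1/n)⟧` are permuted by the `n`-th roots of unity. -/
theorem evalS_rescale {n : ℕ} {ζ : ℂ} (hζ : ζ ^ n = 1) {Y : PowerSeries ℂ} {h : ℂ[X][X]}
    (hY : evalS (PowerSeries.X ^ n) Y h = 0) :
    evalS (PowerSeries.X ^ n) (PowerSeries.rescale ζ Y) h = 0 := by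
  have := ringHom_evalS (PowerSeries.rescaleAlgHom ζ) (PowerSeries.X ^ n) Y h
  rw [hY, map_zero] at this
  have hcoe : ∀ p : PowerSeries ℂ, PowerSeries.rescaleAlgHom ζ p = PowerSeries.rescale ζ p :=
    fun p => DFunLike.congr_fun (PowerSeries.coe_rescaleAlgHom ζ) p
  have hX : PowerSeries.rescaleAlgHom ζ (PowerSeries.X ^ n) = (PowerSeries.X ^ n : PowerSeries ℂ) := by
    rw [hcoe, map_pow, PowerSeries.rescale_X, mul_pow, ← map_pow, hζ, map_one, one_mul]
  rw [hX, hcoe] at this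
  exact this.symm

theorem constantCoeff_rescale (ζ : ℂ) {Y : PowerSeries ℂ} (hY : PowerSeries.constantCoeff Y = 0) :
    PowerSeries.constantCoeff (PowerSeries.rescale ζ Y) = 0 := by
  rw [← PowerSeries.coeff_zero_eq_constantCoeff_apply, PowerSeries.coeff_rescale]
  simpa using hY

/-- If `q(T^n) = Y(ζ T^N)` and `Y` is not a series in `T^n`, `n` a prime number, then `n` divides
`N`. -/
theorem exists_eq_mul_of_subst_eq {n N e : ℕ} (hn : n.Prime) {Y q : PowerSeries ℂ} (he : ¬ n ∣ e)
    (hY : PowerSeries.coeff e Y ≠ 0) {ζ : ℂ} (hζ : ζ ≠ 0) (hN : N ≠ 0)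
    (h : (PowerSeries.subst (PowerSeries.X ^ n : PowerSeries ℂ) q : PowerSeries ℂ) =
      PowerSeries.subst (PowerSeries.X ^ N : PowerSeries ℂ) (PowerSeries.rescale ζ Y)) :
    ∃ M, N = n * M ∧
      q = PowerSeries.subst (PowerSeries.X ^ M : PowerSeries ℂ) (PowerSeries.rescale ζ Y) := by
  have hnN : n ∣ N := by
    by_contra hnN
    have := congrArg (PowerSeries.coeff (N * e)) h
    rw [PowerSeries.coeff_subst_X_pow hn.ne_zero, PowerSeries.coeff_subst_X_pow hN,
      if_neg (fun h => (hn.dvd_mul.1 h).elim hnN he), if_pos (dvd_mul_right _ _),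
      Nat.mul_div_cancel_left _ (Nat.pos_of_ne_zero hN), PowerSeries.coeff_rescale] at this
    exact mul_ne_zero (pow_ne_zero _ hζ) hY this.symm
  obtain ⟨M, rfl⟩ := hnN
  have hM : M ≠ 0 := by rintro rfl; simp at hN
  refine ⟨M, rfl, subst_X_pow_injective hn.ne_zero ?_⟩
  dsimp only
  rw [h, PowerSeries.subst_comp_subst_apply (.X_pow hM) (.X_pow hn.ne_zero),
    PowerSeries.subst_pow (.X_pow hn.ne_zero), PowerSeries.subst_X (.X_pow hn.ne_zero), ← pow_mul]

theorem injective_vec_three {α : Type*} {a b c : α} (hab : a ≠ b) (hac : a ≠ c) (hbc : b ≠ c) :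
    Function.Injective ![a, b, c] := by
  intro i j hij
  fin_cases i <;> fin_cases j <;>
    first
    | rfl
    | exact absurd hij hab
    | exact absurd hij hac
    | exact absurd hij hbc
    | exact absurd hij hab.symm
    | exact absurd hij hac.symm
    | exact absurd hij hbc.symm

/-- Three roots in `ℂ⟦x⟧` give three smooth branches, and there are no other ones. -/
theorem branchesAt_three_smooth {f : MvPolynomial (Fin 2) ℂ} (hf : HasTripleTangent f)
    (h3 : ((toBi f).coeff 3).coeff 0 ≠ 0) {Y : Fin 3 → PowerSeries ℂ} (hY : Function.Injective Y)
    (hY0 : ∀ i, PowerSeries.constantCoeff (Y i) = 0)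
    (hYr : ∀ i, evalS PowerSeries.X (Y i) (toBi f) = 0) :
    BranchesAt f (fun j => (PowerSeries.X, Y j)) ![1, 1, 1] := by
  have := branchesAt_of_roots hf (fun _ : Fin 3 => 1) Y (by simpa using hYr) hY0
    (fun _ => Or.inl rfl)
    (fun i j _ => (eq_or_ne i j).imp_right fun hij => ⟨rfl, fun e => hij (hY e)⟩)
    (fun N q hN hq hqr => by
      obtain ⟨i, hi⟩ := eq_subst_of_three_roots h3 one_ne_zero hY hY0 (by simpa using hYr) hN.ne' hq
        (by simpa using hqr)
      exact ⟨i, N, 1, by simp, by simp, by simpa using hi⟩)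
  convert this using 1
  · simp
  · ext i
    fin_cases i <;> rfl

/-- A root in `ℂ⟦x⟧` and one in `ℂ⟦x^(1/2)⟧` that is not in `ℂ⟦x⟧` give all branches: with the
conjugate of the second one there are three roots in `ℂ⟦x^(1/2)⟧`. -/
theorem branchesAt_smooth_and_cusp {f : MvPolynomial (Fin 2) ℂ} (hf : HasTripleTangent f)
    (h3 : ((toBi f).coeff 3).coeff 0 ≠ 0) {Y₁ Y : PowerSeries ℂ}
    (hY₁ : PowerSeries.constantCoeff Y₁ = 0) (hY : PowerSeries.constantCoeff Y = 0)
    (hY₁r : evalS PowerSeries.X Y₁ (toBi f) = 0) (hYr : evalS (PowerSeries.X ^ 2) Y (toBi f) = 0)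
    {e : ℕ} (he : ¬ 2 ∣ e) (hYe : PowerSeries.coeff e Y ≠ 0) :
    BranchesAt f ![(PowerSeries.X, Y₁), (PowerSeries.X ^ 2, Y)] ![1, 2] := by
  have h2 : PowerSeries.constantCoeff (PowerSeries.X ^ 2 : PowerSeries ℂ) = 0 := by simp
  set Z : Fin 3 → PowerSeries ℂ :=
    ![PowerSeries.subst (PowerSeries.X ^ 2 : PowerSeries ℂ) Y₁, Y, PowerSeries.rescale (-1) Y] with hZ
  have hZi : Function.Injective Z := by
    -- the coefficients of the odd power `T^e` are distinct
    have hc : ∀ i, PowerSeries.coeff e (Z i) =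
        ![0, PowerSeries.coeff e Y, -PowerSeries.coeff e Y] i := by
      intro i
      fin_cases i
      · simp [hZ, PowerSeries.coeff_subst_X_pow, he]
      · rfl
      · simp [hZ, PowerSeries.coeff_rescale, (Nat.not_even_iff_odd.1 (mt Even.two_dvd he)).neg_one_pow]
    intro i j hij
    have := congrArg (PowerSeries.coeff e) hij
    rw [hc, hc] at this
    exact injective_vec_three hYe.symm (neg_ne_zero.2 hYe).symm (fun h => hYe (self_eq_neg.1 h)) this
  have hZ0 : ∀ i, PowerSeries.constantCoeff (Z i) = 0 := by
    intro i
    fin_cases i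
    · exact (constantCoeff_subst_of_zero h2 _).trans hY₁
    · exact hY
    · exact constantCoeff_rescale (-1) hY
  have hZr : ∀ i, evalS (PowerSeries.X ^ 2) (Z i) (toBi f) = 0 := by
    intro i
    fin_cases i
    · have := evalS_subst h2 PowerSeries.X Y₁ (toBi f)
      rw [hY₁r, subst_zero' h2, PowerSeries.subst_X (.of_constantCoeff_zero' h2)] at this
      exact this.symm
    · exact hYr
    · exact evalS_rescale (by norm_num) hYr
  have := branchesAt_of_roots hf ![1, 2] ![Y₁, Y]
    (fun j => by fin_cases j <;> simpa) (fun j => by fin_cases j <;> simpa)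
    (fun j => by
      fin_cases j
      · exact Or.inl rfl
      · exact Or.inr ⟨Nat.prime_two, e, he, hYe⟩)
    (fun i j hij => by fin_cases i <;> fin_cases j <;> simp_all)
    (fun N q hN hq hqr => by
      have hXN : PowerSeries.HasSubst (PowerSeries.X ^ N : PowerSeries ℂ) := .X_pow hN.ne'
      -- compare `q(T²)`, a root of `f(T^(2N), y)`, with the three roots of `f(T², y)`
      have hq2 := evalS_subst h2 (PowerSeries.X ^ N) q (toBi f)
      rw [hqr, subst_zero' h2, subst_X_pow_subst h2, ← pow_mul] at hq2
      obtain ⟨i, hi⟩ := eq_subst_of_three_roots h3 two_ne_zero hZi hZ0 hZr hN.ne'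
        ((constantCoeff_subst_of_zero h2 q).trans hq) hq2.symm
      fin_cases i
      · refine ⟨0, N, 1, by simp, by simp, subst_X_pow_injective two_ne_zero ?_⟩
        simp only [hi, hZ, Matrix.cons_val_zero, Fin.zero_eta, PowerSeries.rescale_one,
          RingHom.id_apply]
        rw [PowerSeries.subst_comp_subst_apply (.X_pow two_ne_zero) hXN,
          PowerSeries.subst_comp_subst_apply hXN (.X_pow two_ne_zero), PowerSeries.subst_pow hXN,
          PowerSeries.subst_X hXN, PowerSeries.subst_pow (.X_pow two_ne_zero),
          PowerSeries.subst_X (.X_pow two_ne_zero), ← pow_mul, ← pow_mul, mul_comm]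
      · obtain ⟨M, hM, hqM⟩ := exists_eq_mul_of_subst_eq (ζ := 1) Nat.prime_two he hYe one_ne_zero
          hN.ne' (by rw [PowerSeries.rescale_one]; exact hi)
        exact ⟨1, M, 1, hM, by simp, hqM⟩
      · obtain ⟨M, hM, hqM⟩ := exists_eq_mul_of_subst_eq (ζ := -1) Nat.prime_two he hYe (by simp)
          hN.ne' hi
        exact ⟨1, M, -1, hM, by simp, hqM⟩)
  convert this using 1
  ext i : 1
  fin_cases i <;> simp

/-- A root in `ℂ⟦x^(1/3)⟧` that is not in `ℂ⟦x⟧` gives the only branch, since it has three conjugates. -/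
theorem branchesAt_triple {f : MvPolynomial (Fin 2) ℂ} (hf : HasTripleTangent f)
    (h3 : ((toBi f).coeff 3).coeff 0 ≠ 0) {Y : PowerSeries ℂ}
    (hY : PowerSeries.constantCoeff Y = 0) (hYr : evalS (PowerSeries.X ^ 3) Y (toBi f) = 0)
    {e : ℕ} (he : ¬ 3 ∣ e) (hYe : PowerSeries.coeff e Y ≠ 0) :
    BranchesAt f ![(PowerSeries.X ^ 3, Y)] ![3] := by
  have hX3 : PowerSeries.constantCoeff (PowerSeries.X ^ 3 : PowerSeries ℂ) = 0 := by simp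
  obtain ⟨ω, hω⟩ : ∃ ω : ℂ, IsPrimitiveRoot ω 3 := ⟨_, Complex.isPrimitiveRoot_exp 3 three_ne_zero⟩
  have hω3 : ∀ i : ℕ, (ω ^ i) ^ 3 = 1 := fun i => by rw [← pow_mul, mul_comm, pow_mul, hω.pow_eq_one,
    one_pow]
  have hZi : Function.Injective fun i : Fin 3 => PowerSeries.rescale (ω ^ (i : ℕ)) Y := by
    intro i j hij
    have := congrArg (PowerSeries.coeff e) hij
    simp only [PowerSeries.coeff_rescale] at this
    have := mul_right_cancel₀ hYe this
    rw [← pow_mul, ← pow_mul, mul_comm, mul_comm (j : ℕ), pow_mul, pow_mul] at this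
    have hcop : Nat.Coprime e 3 := (Nat.coprime_comm.1 ((Nat.Prime.coprime_iff_not_dvd
      Nat.prime_three).2 he))
    exact Fin.ext ((hω.pow_of_coprime e hcop).pow_inj i.2 j.2 this)
  have hZ0 : ∀ i : Fin 3, PowerSeries.constantCoeff (PowerSeries.rescale (ω ^ (i : ℕ)) Y) = 0 := by
    exact fun i => constantCoeff_rescale _ hY
  have := branchesAt_of_roots hf (fun _ : Fin 1 => 3) (fun _ => Y) (fun _ => hYr) (fun _ => hY)
    (fun _ => Or.inr ⟨Nat.prime_three, e, he, hYe⟩) (fun i j _ => Or.inl (Subsingleton.elim i j))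
    (fun N q hN hq hqr => by
      have hq3 := evalS_subst hX3 (PowerSeries.X ^ N) q (toBi f)
      rw [hqr, subst_zero' hX3, subst_X_pow_subst hX3, ← pow_mul] at hq3
      obtain ⟨i, hi⟩ := eq_subst_of_three_roots h3 three_ne_zero hZi hZ0
        (fun i => evalS_rescale (hω3 i) hYr) hN.ne'
        ((constantCoeff_subst_of_zero hX3 q).trans hq) hq3.symm
      obtain ⟨M, hM, hqM⟩ := exists_eq_mul_of_subst_eq Nat.prime_three he hYe
        (pow_ne_zero _ (hω.ne_zero three_ne_zero)) hN.ne' hi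
      exact ⟨0, M, _, hM, hω3 i, hqM⟩)
  convert this using 1
  · ext i : 1
    fin_cases i; rfl
  · ext i
    fin_cases i; rfl

/-! ### Squarefree polynomials and the discriminant -/

theorem toBi_coeff_eq_zero {g : MvPolynomial (Fin 2) ℂ} (hg : ∀ d ∈ g.support, 4 ≤ d.degree)
    {i j : ℕ} (hij : i + j < 4) : ((toBi g).coeff j).coeff i = 0 := by
  rw [toBi, MvPolynomial.aeval_def, MvPolynomial.eval₂_eq', finsetSum_coeff, finsetSum_coeff]
  refine Finset.sum_eq_zero fun d hd => ?_
  have h4 := hg d hd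
  rw [Finsupp.degree_eq_sum, Fin.sum_univ_two] at h4
  rw [Fin.prod_univ_two]
  simp only [Matrix.cons_val_zero, Matrix.cons_val_one]
  rw [Polynomial.algebraMap_apply, ← map_pow, coeff_C_mul, coeff_C_mul, coeff_X_pow]
  split_ifs with h
  · rw [mul_one, Polynomial.algebraMap_apply, coeff_C_mul, coeff_X_pow, if_neg (by omega), mul_zero]
  · simp

theorem toBi_coeff_of_lt {f : MvPolynomial (Fin 2) ℂ} (hf : HasTripleTangent f) {j : ℕ}
    (hj : j < 3) : ((toBi f).coeff j).coeff 0 = 0 := by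
  obtain ⟨g, rfl, hg⟩ := hf
  have h : toBi (MvPolynomial.X 1 ^ 3 + g) = X ^ 3 + toBi g := by simp [toBi]
  rw [h, coeff_add, coeff_add, toBi_coeff_eq_zero hg (by omega), coeff_X_pow, if_neg (by omega)]
  simp

theorem toBi_coeff_three {f : MvPolynomial (Fin 2) ℂ} (hf : HasTripleTangent f) :
    ((toBi f).coeff 3).coeff 0 ≠ 0 := by
  obtain ⟨g, rfl, hg⟩ := hf
  have h : toBi (MvPolynomial.X 1 ^ 3 + g) = X ^ 3 + toBi g := by simp [toBi]
  rw [h, coeff_add, coeff_add, toBi_coeff_eq_zero hg (by omega), coeff_X_pow, if_pos rfl]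
  simp

theorem squarefree_toBi {f : MvPolynomial (Fin 2) ℂ} (hf : Squarefree f) : Squarefree (toBi f) := by
  let ψ : ℂ[X][X] →+* MvPolynomial (Fin 2) ℂ := Polynomial.eval₂RingHom
    (Polynomial.aeval (MvPolynomial.X 0) : ℂ[X] →ₐ[ℂ] MvPolynomial (Fin 2) ℂ).toRingHom
    (MvPolynomial.X 1)
  let φ : MvPolynomial (Fin 2) ℂ →+* ℂ[X][X] := (MvPolynomial.aeval ![(C X : ℂ[X][X]), X] :
    MvPolynomial (Fin 2) ℂ →ₐ[ℂ] ℂ[X][X]).toRingHom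
  have h1 : ψ.comp φ = RingHom.id _ := by
    refine MvPolynomial.ringHom_ext (fun a => ?_) (fun i => ?_)
    · simp [ψ, φ, Polynomial.algebraMap_apply]
    · fin_cases i <;> simp [ψ, φ]
  have h2 : φ.comp ψ = RingHom.id _ := by
    refine Polynomial.ringHom_ext (fun a => ?_) (by simp [ψ, φ])
    have : ((φ.comp ψ).comp (C : ℂ[X] →+* ℂ[X][X])) = C := by
      refine Polynomial.ringHom_ext (fun a => ?_) (by simp [ψ, φ])
      simp [ψ, φ, Polynomial.algebraMap_apply]
    exact DFunLike.congr_fun this a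
  intro P hP
  have hu : IsUnit (ψ P) := hf _ (by
    have := map_dvd ψ hP
    rwa [map_mul, show ψ (toBi f) = f from DFunLike.congr_fun h1 f] at this)
  have := hu.map φ
  rwa [show φ (ψ P) = P from DFunLike.congr_fun h2 P] at this

/-- Gauss's lemma for squarefree polynomials. -/
theorem squarefree_map_fractionRing {f : ℂ[X][X]} (hf : Squarefree f) :
    Squarefree (f.map (algebraMap ℂ[X] (FractionRing ℂ[X]))) := by
  let : NormalizedGCDMonoid ℂ[X] := Nonempty.some inferInstance
  intro p hp
  have hf0 : f.map (algebraMap ℂ[X] (FractionRing ℂ[X])) ≠ 0 :=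
    (Polynomial.map_ne_zero_iff (IsFractionRing.injective _ _)).2 hf.ne_zero
  have hp0 : p ≠ 0 := by
    rintro rfl
    exact hf0 (by simpa using hp)
  obtain ⟨b, hb0, hb⟩ := IsLocalization.integerNormalization_spec (nonZeroDivisors ℂ[X]) p
  set p₀ := IsLocalization.integerNormalization (nonZeroDivisors ℂ[X]) p
  have hbK : algebraMap ℂ[X] (FractionRing ℂ[X]) b ≠ 0 := by
    simpa using nonZeroDivisors.ne_zero hb0
  -- up to a unit, `p` is a primitive polynomial over `ℂ[x]`, to which Gauss's lemma applies
  have hass : Associated (p₀.primPart.map (algebraMap ℂ[X] (FractionRing ℂ[X]))) p := by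
    have h1 : p₀ ≠ 0 := by
      intro h
      rw [h, Polynomial.map_zero, Algebra.smul_def] at hb
      have := hb.symm
      simp only [mul_eq_zero, hp0, or_false] at this
      rw [Polynomial.algebraMap_apply] at this
      exact hbK (by simpa using this)
    have h2 : (C (algebraMap ℂ[X] (FractionRing ℂ[X]) p₀.content)) *
        p₀.primPart.map (algebraMap ℂ[X] (FractionRing ℂ[X])) =
        C (algebraMap ℂ[X] (FractionRing ℂ[X]) b) * p := by
      rw [← map_C, ← Polynomial.map_mul, ← eq_C_content_mul_primPart, hb, Algebra.smul_def,
        Polynomial.algebraMap_apply]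
    have hc : algebraMap ℂ[X] (FractionRing ℂ[X]) p₀.content ≠ 0 := by
      simpa [content_eq_zero_iff] using h1
    have u1 : IsUnit (C (algebraMap ℂ[X] (FractionRing ℂ[X]) p₀.content)) :=
      (isUnit_iff_ne_zero.2 hc).map C
    have u2 : IsUnit (C (algebraMap ℂ[X] (FractionRing ℂ[X]) b)) := (isUnit_iff_ne_zero.2 hbK).map C
    refine (associated_isUnit_mul_left_iff u1).1 ?_
    rw [h2]
    exact (associated_isUnit_mul_left_iff u2).2 (Associated.refl p)
  have hprim : (p₀.primPart * p₀.primPart).IsPrimitive :=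
    (isPrimitive_primPart _).mul (isPrimitive_primPart _)
  have hdvd : p₀.primPart * p₀.primPart ∣ f := by
    refine hprim.dvd_of_fraction_map_dvd_fraction_map (K := FractionRing ℂ[X]) ?_
    rw [Polynomial.map_mul]
    exact (hass.mul_mul hass).dvd.trans hp
  exact hass.isUnit ((hf _ hdvd).map (Polynomial.mapRingHom _))

/-- A squarefree polynomial and its `y`-derivative generate a nonzero polynomial in `x` alone. -/
theorem exists_discriminant {f : ℂ[X][X]} (hf : Squarefree f) :
    ∃ (A B : ℂ[X][X]) (d : ℂ[X]), d ≠ 0 ∧ A * f + B * derivative f = C d := by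
  have hsep := PerfectField.separable_iff_squarefree.2 (squarefree_map_fractionRing hf)
  obtain ⟨a, b, hab⟩ := hsep
  obtain ⟨u, hu0, hu⟩ := IsLocalization.integerNormalization_spec (nonZeroDivisors ℂ[X]) a
  obtain ⟨v, hv0, hv⟩ := IsLocalization.integerNormalization_spec (nonZeroDivisors ℂ[X]) b
  set A := IsLocalization.integerNormalization (nonZeroDivisors ℂ[X]) a
  set B := IsLocalization.integerNormalization (nonZeroDivisors ℂ[X]) b
  refine ⟨C v * A, C u * B, u * v, mul_ne_zero (nonZeroDivisors.ne_zero hu0)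
    (nonZeroDivisors.ne_zero hv0), ?_⟩
  apply Polynomial.map_injective (algebraMap ℂ[X] (FractionRing ℂ[X])) (IsFractionRing.injective _ _)
  rw [Algebra.smul_def, Polynomial.algebraMap_apply] at hu hv
  simp only [Polynomial.map_add, Polynomial.map_mul, map_C, hu, hv, ← derivative_map, map_mul]
  rw [← mul_one (C _ * C _), ← hab]
  ring

/-- `G(x, z)` is obtained from `f` by the substitution `y = D(x) + x^K z`, up to a factor that is
divisible by `x^(2K)`. The factor `x^(2K)` is what makes the `y`-derivative of `f` and `f` itself
divisible by `x^K` after the substitution. -/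
def IsTransform (f : ℂ[X][X]) (D : ℂ[X]) (K : ℕ) (G : ℂ[X][X]) : Prop :=
  ∃ U : ℂ[X][X], f.comp (C D + C (X ^ K) * X) = C (X ^ (2 * K)) * U * G

theorem isTransform_refl (f : ℂ[X][X]) : IsTransform f 0 0 f := ⟨1, by simp⟩

theorem IsTransform.trans {f : ℂ[X][X]} {D : ℂ[X]} {K : ℕ} {G G' V : ℂ[X][X]} {c : ℂ} {k : ℕ}
    (h : IsTransform f D K G)
    (hG : G.comp (C (X ^ k) * (C (C c) + X)) = C (X ^ (2 * k)) * V * G') :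
    IsTransform f (D + C c * X ^ (K + k)) (K + k) G' := by
  obtain ⟨U, hU⟩ := h
  refine ⟨U.comp (C (X ^ k) * (C (C c) + X)) * V, ?_⟩
  have h1 := congrArg (fun p => Polynomial.comp p (C (X ^ k) * (C (C c) + X))) hU
  simp only [comp_assoc, mul_comp, C_comp, hG] at h1
  have h2 : (C D + C (X ^ K) * X : ℂ[X][X]).comp (C (X ^ k) * (C (C c) + X)) =
      C (D + C c * X ^ (K + k)) + C (X ^ (K + k)) * X := by
    simp only [add_comp, mul_comp, C_comp, X_comp, map_add, map_mul, pow_add]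
    ring
  rw [h2] at h1
  rw [h1, Nat.mul_add 2 K k, pow_add _ (2 * K), map_mul]
  ring

/-- The substitution of `y = D(x) + x^K z` turns the discriminant into a multiple of `x^K`. -/
theorem IsTransform.exists_mul_eq {f A B : ℂ[X][X]} {d : ℂ[X]}
    (hd : A * f + B * derivative f = C d) {D : ℂ[X]} {K : ℕ} {G : ℂ[X][X]}
    (h : IsTransform f D K G) :
    ∃ U V W : ℂ[X][X], C d = C (X ^ K) * (V * (U * G) + W * derivative (U * G)) := by
  obtain ⟨U, hU⟩ := h
  refine ⟨U, C (X ^ K) * A.comp (C D + C (X ^ K) * X), B.comp (C D + C (X ^ K) * X), ?_⟩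
  have h1 := congrArg (fun p => Polynomial.comp p (C D + C (X ^ K) * X)) hd
  simp only [add_comp, mul_comp, C_comp] at h1
  have h2 : C (X ^ K) * (derivative f).comp (C D + C (X ^ K) * X) =
      C (X ^ (2 * K)) * derivative (U * G) := by
    have := congrArg derivative hU
    rw [derivative_comp] at this
    rw [mul_assoc, derivative_C_mul] at this
    rw [← this]
    simp
  have h0 : (C (X ^ K) : ℂ[X][X]) ≠ 0 := by simp
  apply mul_left_cancel₀ h0
  rw [← h1, mul_add, hU, mul_left_comm (C (X ^ K)) (B.comp _), h2, two_mul, pow_add, map_mul]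
  ring

/-- The total exponent `K` of the steps is bounded by the degree of the discriminant. -/
theorem IsTransform.le_natDegree {f A B : ℂ[X][X]} {d : ℂ[X]} (hd0 : d ≠ 0)
    (hd : A * f + B * derivative f = C d) {D : ℂ[X]} {K : ℕ} {G : ℂ[X][X]}
    (h : IsTransform f D K G) : K ≤ d.natDegree := by
  obtain ⟨U, V, W, hE⟩ := h.exists_mul_eq hd
  have : (X : ℂ[X]) ^ K ∣ d := by
    have := congrArg (fun p => coeff p 0) hE
    simp only [coeff_C_zero, coeff_C_mul] at this
    exact ⟨_, this⟩
  simpa using natDegree_le_of_dvd this hd0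

/-- If `y²` divided a transform of `f`, the discriminant would vanish on `y = 0`; but it is a nonzero
polynomial in `x` alone. -/
theorem IsTransform.not_sq_dvd {f A B : ℂ[X][X]} {d : ℂ[X]} (hd0 : d ≠ 0)
    (hd : A * f + B * derivative f = C d) {D : ℂ[X]} {K : ℕ} {G : ℂ[X][X]}
    (h : IsTransform f D K G) : ¬ X ^ 2 ∣ G := by
  rintro ⟨H, rfl⟩
  obtain ⟨U, V, W, hE⟩ := h.exists_mul_eq hd
  have := congrArg (Polynomial.eval 0) hE
  simp at this
  exact hd0 this

theorem IsTransform.exists_ne_zero {f A B : ℂ[X][X]} {d : ℂ[X]} (hd0 : d ≠ 0)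
    (hd : A * f + B * derivative f = C d) {D : ℂ[X]} {K : ℕ} {G : ℂ[X][X]}
    (h : IsTransform f D K G) : ∃ j < 2, ∃ i, (G.coeff j).coeff i ≠ 0 := by
  by_contra! hz
  refine h.not_sq_dvd hd0 hd (X_pow_dvd_iff.2 fun j hj => ?_)
  ext i
  simpa using hz j hj i

/-- A root of a transform of `f` gives a root of `f`. -/
theorem IsTransform.evalS_eq_zero {f : ℂ[X][X]} {D : ℂ[X]} {K : ℕ} {G : ℂ[X][X]}
    (h : IsTransform f D K G) {p z : PowerSeries ℂ} (hz : evalS p z G = 0) :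
    evalS p (Polynomial.aeval p D + p ^ K * z) f = 0 := by
  obtain ⟨U, hU⟩ := h
  have := congrArg (evalS p z) hU
  rw [evalS_comp, map_mul, hz, mul_zero] at this
  simpa using this

/-! ### Newton polygons -/

theorem supp_finite (h : PYPoly) : (supp h).Finite := by
  refine (Set.Finite.biUnion (t := fun j => (fun i => (i, j)) '' ((h.coeff j).coeff.support : Set ℚ≥0))
    h.support.finite_toSet fun j _ => (Finset.finite_toSet _).image _).subset ?_
  rintro ⟨i, j⟩ hij
  have hij' : (h.coeff j).coeff i ≠ 0 := hij
  refine Set.mem_biUnion (x := j) ?_ ⟨i, by simpa using hij', rfl⟩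
  rw [Finset.mem_coe, mem_support_iff]
  intro h0
  rw [h0] at hij'
  exact hij' rfl

theorem IsFirstVertex.unique {h : PYPoly} {P P' : ℚ≥0 × ℕ} (hP : IsFirstVertex h P)
    (hP' : IsFirstVertex h P') : P = P' := by
  obtain ⟨i, j⟩ := P
  obtain ⟨i', j'⟩ := P'
  obtain ⟨h1, rfl, h2⟩ := hP
  obtain ⟨h1', rfl, h2'⟩ := hP'
  exact Prod.ext rfl (le_antisymm (h2 _ h1') (h2' _ h1))

theorem IsNextVertex.unique {h : PYPoly} {P Q Q' : ℚ≥0 × ℕ} (hQ : IsNextVertex h P Q)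
    (hQ' : IsNextVertex h P Q') : Q = Q' := by
  obtain ⟨h1, h2, h3, h4⟩ := hQ
  obtain ⟨h1', h2', h3', h4'⟩ := hQ'
  have hs : slope P Q = slope P Q' := le_antisymm (h4 _ h1' h2').1 (h4' _ h1 h2).1
  have hx : Q.1 = Q'.1 := le_antisymm ((h4' _ h1 h2).2 hs) ((h4 _ h1' h2').2 hs.symm)
  refine Prod.ext hx ?_
  rw [slope, slope, hx] at hs
  have : ((Q'.1 : ℚ) - (P.1 : ℚ)) ≠ 0 := by
    have : (P.1 : ℚ) < Q'.1 := by exact_mod_cast h2'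
    exact (sub_pos.2 this).ne'
  have := (div_left_inj' this).1 hs
  have : (Q.2 : ℚ) = Q'.2 := by linarith
  exact_mod_cast this

theorem PolygonFrom.unique {h : PYPoly} {P : ℚ≥0 × ℕ} {E E' : List Edge} (hE : PolygonFrom h P E)
    (hE' : PolygonFrom h P E') : E = E' := by
  induction hE generalizing E' with
  | done P h0 =>
    cases hE' with
    | done => rfl
    | virtual _ h1 _ => omega
    | edge _ Q E hQ _ => exact absurd hQ.2.2.1 (by omega)
  | virtual P h0 h1 =>
    cases hE' with
    | done _ h => omega
    | virtual => rfl
    | edge _ Q E hQ _ => exact absurd hQ.2.2.1 (not_lt.2 (h1 Q hQ.1))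
  | edge P Q E hQ _ ih =>
    cases hE' with
    | done _ h => exact absurd hQ.2.2.1 (by omega)
    | virtual _ _ h1 => exact absurd hQ.2.2.1 (not_lt.2 (h1 Q hQ.1))
    | edge _ Q' E'' hQ' hE'' =>
      obtain rfl := hQ.unique hQ'
      rw [ih hE'']

theorem IsNewtonPolygon.unique {h : PYPoly} {E E' : List Edge} (hE : IsNewtonPolygon h E)
    (hE' : IsNewtonPolygon h E') : E = E' := by
  obtain ⟨P, hP, hE⟩ := hE
  obtain ⟨P', hP', hE'⟩ := hE'
  obtain rfl := hP.unique hP'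
  exact hE.unique hE'

theorem exists_isNextVertex {h : PYPoly} {P : ℚ≥0 × ℕ}
    (hP : ∃ R ∈ supp h, P.1 < R.1 ∧ R.2 < P.2) : ∃ Q, IsNextVertex h P Q := by
  obtain ⟨R, hR, hR1, hR2⟩ := hP
  have hfin : {R | R ∈ supp h ∧ P.1 < R.1}.Finite := (supp_finite h).subset fun R h => h.1
  obtain ⟨A, hA, hmin⟩ := Set.exists_min_image _ (slope P) hfin ⟨R, hR, hR1⟩
  have hfin' : {R | (R ∈ supp h ∧ P.1 < R.1) ∧ slope P R = slope P A}.Finite :=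
    hfin.subset fun R h => h.1
  obtain ⟨Q, ⟨⟨hQ, hQ1⟩, hQs⟩, hmax⟩ := Set.exists_max_image _ Prod.fst hfin' ⟨A, hA, rfl⟩
  refine ⟨Q, hQ, hQ1, ?_, fun R hR hR1 => ?_⟩
  · have h1 : slope P Q < 0 := by
      rw [hQs]
      refine lt_of_le_of_lt (hmin R ⟨hR, hR1⟩) (div_neg_of_neg_of_pos ?_ ?_)
      · rw [sub_neg]; exact_mod_cast hR2
      · rw [sub_pos]; exact_mod_cast hR1
    by_contra! hle
    refine absurd h1 (not_lt.2 (div_nonneg ?_ ?_))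
    · rw [sub_nonneg]; exact_mod_cast hle
    · rw [sub_nonneg]; exact_mod_cast hQ1.le
  · rw [hQs]
    exact ⟨hmin R ⟨hR, hR1⟩, fun hs => hmax R ⟨⟨hR, hR1⟩, hs⟩⟩

/-- The support of `h` lies on or above the line of slope `-1/r` through the vertex `P`, which is
the rightmost point of the support on this line, and there is no lower point to the left of `P`. -/
def IsAbove (h : PYPoly) (r : ℚ) (P : ℚ≥0 × ℕ) : Prop :=
  ∀ R ∈ supp h, (P.1 : ℚ) + r * P.2 ≤ R.1 + r * R.2 ∧
    ((P.1 : ℚ) + r * P.2 = R.1 + r * R.2 → R.1 ≤ P.1) ∧ (R.1 ≤ P.1 → P.2 ≤ R.2)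

/-- `PQ` is an edge of a Newton polygon: the support lies on or above the line `PQ`, and its points
on this line are between `P` and `Q`. -/
structure IsEdge (h : PYPoly) (P Q : ℚ≥0 × ℕ) : Prop where
  left_mem : P ∈ supp h
  right_mem : Q ∈ supp h
  lt : P.1 < Q.1
  gt : Q.2 < P.2
  le : ∀ R ∈ supp h, P.1 + edgeExponent P Q * P.2 ≤ R.1 + edgeExponent P Q * R.2
  between : ∀ R ∈ supp h, P.1 + edgeExponent P Q * P.2 = R.1 + edgeExponent P Q * R.2 →
    Q.2 ≤ R.2 ∧ R.2 ≤ P.2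

theorem edgeExponent_mul {P Q : ℚ≥0 × ℕ} (h1 : P.1 < Q.1) (h2 : Q.2 < P.2) :
    (edgeExponent P Q : ℚ) * ((P.2 : ℚ) - Q.2) = Q.1 - P.1 := by
  have h3 : ((P.2 : ℚ) - Q.2) ≠ 0 := by
    have : (Q.2 : ℚ) < P.2 := by exact_mod_cast h2
    linarith
  rw [edgeExponent, NNRat.cast_div, NNRat.coe_sub h1.le, NNRat.cast_natCast, Nat.cast_sub h2.le,
    div_mul_cancel₀ _ h3]

theorem edgeExponent_pos {P Q : ℚ≥0 × ℕ} (h1 : P.1 < Q.1) (h2 : Q.2 < P.2) :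
    0 < edgeExponent P Q :=
  div_pos (tsub_pos_of_lt h1) (by exact_mod_cast Nat.sub_pos_of_lt h2)

theorem IsFirstVertex.isAbove {h : PYPoly} {P : ℚ≥0 × ℕ} (hP : IsFirstVertex h P) :
    IsAbove h 0 P := by
  obtain ⟨i, j⟩ := P
  obtain ⟨h1, rfl, h2⟩ := hP
  rintro ⟨a, b⟩ hR
  simp only [zero_mul, add_zero, NNRat.cast_zero]
  refine ⟨NNRat.cast_nonneg _, fun h => ?_, fun h => ?_⟩
  · have : a = 0 := by exact_mod_cast h.symm
    exact this.le
  · obtain rfl : a = 0 := le_antisymm h (zero_le)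
    exact h2 _ hR

/-- The slopes of the edges increase, and every edge leaves the support on one side. -/
theorem IsAbove.next {h : PYPoly} {r : ℚ} {P Q : ℚ≥0 × ℕ} (hP : P ∈ supp h)
    (hA : IsAbove h r P) (hQ : IsNextVertex h P Q) :
    r < edgeExponent P Q ∧ IsAbove h (edgeExponent P Q) Q ∧ IsEdge h P Q := by
  obtain ⟨hQs, hQ1, hQ2, hQm⟩ := hQ
  have hs := edgeExponent_mul hQ1 hQ2
  have hs0 : (0 : ℚ) < edgeExponent P Q := by exact_mod_cast edgeExponent_pos hQ1 hQ2
  set s : ℚ := (edgeExponent P Q : ℚ) with hsdef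
  have q1 : (P.1 : ℚ) < Q.1 := by exact_mod_cast hQ1
  have q2 : (Q.2 : ℚ) < P.2 := by exact_mod_cast hQ2
  have hrs : r < s := by
    obtain ⟨a1, a2, -⟩ := hA Q hQs
    have : (P.1 : ℚ) + r * P.2 < Q.1 + r * Q.2 :=
      lt_of_le_of_ne a1 fun e => absurd hQ1 (not_lt.2 (a2 e))
    by_contra! hle
    have : s * ((P.2 : ℚ) - Q.2) ≤ r * ((P.2 : ℚ) - Q.2) :=
      mul_le_mul_of_nonneg_right hle (by linarith)
    nlinarith
  -- the points to the right of `P`, by the choice of `Q`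
  have key : ∀ R ∈ supp h, P.1 < R.1 → (P.1 : ℚ) + s * P.2 ≤ R.1 + s * R.2 ∧
      ((P.1 : ℚ) + s * P.2 = R.1 + s * R.2 → R.1 ≤ Q.1) := by
    intro R hR hR1
    have r1 : (P.1 : ℚ) < R.1 := by exact_mod_cast hR1
    obtain ⟨m1, m2⟩ := hQm R hR hR1
    have e1 : slope P Q = -1 / s := by
      rw [slope, ← hs]
      have : (P.2 : ℚ) - Q.2 ≠ 0 := by linarith
      field_simp
      ring
    rw [e1, slope] at m1
    rw [e1, slope] at m2
    rw [div_le_div_iff₀ hs0 (by linarith)] at m1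
    rw [div_eq_div_iff (by linarith) hs0.ne'] at m2
    exact ⟨by linarith, fun e => m2 (by linarith)⟩
  -- the points not to the right of `P`
  have key' : ∀ R ∈ supp h, R.1 ≤ P.1 → (P.1 : ℚ) + s * P.2 ≤ R.1 + s * R.2 ∧
      ((P.1 : ℚ) + s * P.2 = R.1 + s * R.2 → R.2 ≤ P.2) := by
    intro R hR hR1
    obtain ⟨a1, -, a3⟩ := hA R hR
    have r2 : (P.2 : ℚ) ≤ R.2 := by exact_mod_cast a3 hR1
    refine ⟨by nlinarith, fun e => ?_⟩
    by_contra! hlt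
    have : (P.2 : ℚ) < R.2 := by exact_mod_cast hlt
    nlinarith
  have hle : ∀ R ∈ supp h, (P.1 : ℚ) + s * P.2 ≤ R.1 + s * R.2 := fun R hR =>
    (lt_or_ge P.1 R.1).elim (fun h1 => (key R hR h1).1) fun h1 => (key' R hR h1).1
  have heq : ∀ R ∈ supp h, (P.1 : ℚ) + s * P.2 = R.1 + s * R.2 → R.1 ≤ Q.1 := fun R hR e =>
    (lt_or_ge P.1 R.1).elim (fun h1 => (key R hR h1).2 e) fun h1 => h1.trans hQ1.le
  have hPQ : (Q.1 : ℚ) + s * Q.2 = P.1 + s * P.2 := by linarith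
  have hlow : ∀ R ∈ supp h, R.1 ≤ Q.1 → Q.2 ≤ R.2 := by
    intro R hR hR1
    have r1 : (R.1 : ℚ) ≤ Q.1 := by exact_mod_cast hR1
    have := hle R hR
    have : s * Q.2 ≤ s * R.2 := by linarith
    exact_mod_cast le_of_mul_le_mul_left this hs0
  refine ⟨hrs, fun R hR => ⟨by rw [hPQ]; exact hle R hR, by rw [hPQ]; exact heq R hR, hlow R hR⟩,
    hP, hQs, hQ1, hQ2, fun R hR => ?_, fun R hR e => ?_⟩
  · have := hle R hR
    rw [hsdef] at this
    exact_mod_cast this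
  · have e' : (P.1 : ℚ) + s * P.2 = R.1 + s * R.2 := by
      rw [hsdef]; exact_mod_cast e
    refine ⟨hlow R hR (heq R hR e'), ?_⟩
    rcases lt_or_ge P.1 R.1 with h1 | h1
    · have : (P.1 : ℚ) < R.1 := by exact_mod_cast h1
      have : s * R.2 ≤ s * P.2 := by linarith
      exact_mod_cast le_of_mul_le_mul_left this hs0
    · exact (key' R hR h1).2 e'

theorem PolygonFrom.isEdge {h : PYPoly} {P : ℚ≥0 × ℕ} {E : List Edge} (hE : PolygonFrom h P E)
    {r : ℚ} (hP : P ∈ supp h) (hA : IsAbove h r P) {A B : ℚ≥0 × ℕ}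
    (hAB : Edge.actual A B ∈ E) : IsEdge h A B := by
  induction hE generalizing r with
  | done => simp at hAB
  | virtual => simp at hAB
  | edge P Q E hQ _ ih =>
    obtain ⟨h1, h2, h3⟩ := hA.next hP hQ
    rcases List.mem_cons.1 hAB with h | h
    · obtain ⟨rfl, rfl⟩ := Edge.actual.inj h
      exact h3
    · exact ih hQ.1 h2 h

theorem IsNewtonPolygon.isEdge {h : PYPoly} {E : List Edge} (hE : IsNewtonPolygon h E)
    {A B : ℚ≥0 × ℕ} (hAB : Edge.actual A B ∈ E) : IsEdge h A B := by
  obtain ⟨P, hP, hE⟩ := hE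
  exact hE.isEdge hP.1 hP.isAbove hAB

/-! ### Polynomials in `x^(1/N)` and `y` as Puiseux `y`-polynomials -/

/-- The embedding `T ↦ x^(1/N)` of `ℂ[T]` into the Puiseux polynomials. -/
def toPuiseuxPoly (N : ℕ) : ℂ[X] →+* PuiseuxPoly :=
  (Polynomial.aeval (xMon 1 (1 / N)) : ℂ[X] →ₐ[ℂ] PuiseuxPoly).toRingHom

theorem toPuiseuxPoly_monomial (N n : ℕ) (a : ℂ) :
    toPuiseuxPoly N (monomial n a) = xMon a (n / N) := by
  change Polynomial.aeval (xMon 1 (1 / N)) (monomial n a) = xMon a (n / N)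
  rw [aeval_monomial, xMon, AddMonoidAlgebra.single_pow, one_pow, ← Algebra.smul_def,
    AddMonoidAlgebra.smul_single, smul_eq_mul, mul_one, nsmul_eq_mul, mul_one_div]

theorem toPuiseuxPoly_C (N : ℕ) (a : ℂ) : toPuiseuxPoly N (C a) = xMon a 0 := by
  rw [← monomial_zero_left, toPuiseuxPoly_monomial]; simp

theorem toPuiseuxPoly_X_pow (N n : ℕ) : toPuiseuxPoly N (X ^ n) = xMon 1 (n / N) := by
  rw [X_pow_eq_monomial, toPuiseuxPoly_monomial]

theorem coeff_toPuiseuxPoly {N : ℕ} (hN : 0 < N) (a : ℂ[X]) (n : ℕ) :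
    (toPuiseuxPoly N a).coeff (n / N) = a.coeff n := by
  induction a using Polynomial.induction_on' with
  | add p q hp hq => rw [map_add, AddMonoidAlgebra.coeff_add, Finsupp.add_apply, hp, hq, coeff_add]
  | monomial m c =>
    rw [toPuiseuxPoly_monomial, AddMonoidAlgebra.coeff_single, Finsupp.single_apply, coeff_monomial]
    have : (m / N : ℚ≥0) = n / N ↔ m = n := by
      rw [div_left_inj' (by exact_mod_cast hN.ne')]
      exact Nat.cast_inj
    simp only [this]

theorem exists_eq_of_coeff_toPuiseuxPoly_ne_zero {N : ℕ} {a : ℂ[X]} {i : ℚ≥0}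
    (h : (toPuiseuxPoly N a).coeff i ≠ 0) : ∃ n : ℕ, i = n / N := by
  induction a using Polynomial.induction_on' with
  | add p q hp hq =>
    rw [map_add, AddMonoidAlgebra.coeff_add, Finsupp.add_apply] at h
    by_cases h1 : (toPuiseuxPoly N p).coeff i = 0
    · exact hq (by simpa [h1] using h)
    · exact hp h1
  | monomial m c =>
    rw [toPuiseuxPoly_monomial, AddMonoidAlgebra.coeff_single, Finsupp.single_apply] at h
    exact ⟨m, by_contra fun hne => h (if_neg fun e => hne e.symm)⟩

/-- A polynomial in `T, y` as a Puiseux `y`-polynomial, with `T = x^(1/N)`. -/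
def toPY (N : ℕ) : ℂ[X][X] →+* PYPoly := Polynomial.mapRingHom (toPuiseuxPoly N)

theorem toPY_C (N : ℕ) (a : ℂ[X]) : toPY N (C a) = C (toPuiseuxPoly N a) := by simp [toPY]

theorem toPY_X (N : ℕ) : toPY N X = X := by simp [toPY]

theorem toPY_comp (N : ℕ) (p q : ℂ[X][X]) : toPY N (p.comp q) = (toPY N p).comp (toPY N q) := by
  simp [toPY, Polynomial.map_comp]

theorem coeffXY_toPY {N : ℕ} (hN : 0 < N) (h : ℂ[X][X]) (n j : ℕ) :
    coeffXY (toPY N h) (n / N) j = (h.coeff j).coeff n := by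
  rw [coeffXY, toPY, coe_mapRingHom, coeff_map, coeff_toPuiseuxPoly hN]

theorem coeffXY_toPY_zero {N : ℕ} (hN : 0 < N) (h : ℂ[X][X]) (j : ℕ) :
    coeffXY (toPY N h) 0 j = (h.coeff j).coeff 0 := by
  simpa using coeffXY_toPY hN h 0 j

theorem coeffXY_toPY_one (h : ℂ[X][X]) (n j : ℕ) :
    coeffXY (toPY 1 h) n j = (h.coeff j).coeff n := by
  simpa using coeffXY_toPY one_pos h n j

theorem exists_nat_of_mem_supp {h : ℂ[X][X]} {P : ℚ≥0 × ℕ} (hP : P ∈ supp (toPY 1 h)) :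
    ∃ a : ℕ, P = ((a : ℚ≥0), P.2) := by
  have h1 : ((toPY 1 h).coeff P.2).coeff P.1 ≠ 0 := hP
  rw [toPY, coe_mapRingHom, coeff_map] at h1
  obtain ⟨a, ha⟩ := exists_eq_of_coeff_toPuiseuxPoly_ne_zero h1
  exact ⟨a, Prod.ext (by simpa using ha) rfl⟩

theorem mem_supp_toPY {h : ℂ[X][X]} {a j : ℕ} :
    ((a : ℚ≥0), j) ∈ supp (toPY 1 h) ↔ (h.coeff j).coeff a ≠ 0 := by
  rw [← coeffXY_toPY_one]; rfl

theorem toPY_injective {N : ℕ} (hN : 0 < N) : Function.Injective (toPY N) := by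
  intro p q hpq
  ext j n
  rw [← coeffXY_toPY hN, ← coeffXY_toPY hN, hpq]

theorem toPuiseuxPoly_expand {N : ℕ} (hN : 0 < N) (a : ℂ[X]) :
    toPuiseuxPoly N (expand ℂ N a) = toPuiseuxPoly 1 a := by
  induction a using Polynomial.induction_on' with
  | add p q hp hq => rw [map_add, map_add, map_add, hp, hq]
  | monomial m c =>
    rw [expand_monomial, toPuiseuxPoly_monomial, toPuiseuxPoly_monomial]
    congr 1
    have : (N : ℚ≥0) ≠ 0 := by exact_mod_cast hN.ne'
    push_cast
    field_simp

/-- The substitution `x = T^N`. -/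
def expandX (N : ℕ) : ℂ[X][X] →+* ℂ[X][X] := Polynomial.mapRingHom (expand ℂ N).toRingHom

theorem toPY_expandX {N : ℕ} (hN : 0 < N) (h : ℂ[X][X]) : toPY N (expandX N h) = toPY 1 h := by
  ext1 j
  simp only [toPY, expandX, coe_mapRingHom, coeff_map]
  exact toPuiseuxPoly_expand hN _

theorem expandX_one (h : ℂ[X][X]) : expandX 1 h = h :=
  toPY_injective one_pos (toPY_expandX one_pos h)

theorem coeffXY_expandX {N : ℕ} (hN : 0 < N) (h : ℂ[X][X]) (n j : ℕ) :
    coeffXY (toPY 1 h) (n / N) j = ((expandX N h).coeff j).coeff n := by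
  rw [← toPY_expandX hN, coeffXY_toPY hN]

theorem evalS_expandX (N : ℕ) (p q : PowerSeries ℂ) (h : ℂ[X][X]) :
    evalS p q (expandX N h) = evalS (p ^ N) q h := by
  have : (evalS p q).comp (expandX N) = evalS (p ^ N) q := by
    refine Polynomial.ringHom_ext (fun a => ?_) (by simp [expandX])
    simp [expandX, expand_aeval]
  exact DFunLike.congr_fun this h

theorem toPuiseux_eq (f : MvPolynomial (Fin 2) ℂ) : toPuiseux f = toPY 1 (toBi f) := by
  have : ((toPY 1).comp (MvPolynomial.aeval ![(C X : ℂ[X][X]), X] :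
      MvPolynomial (Fin 2) ℂ →ₐ[ℂ] ℂ[X][X]).toRingHom) =
      (MvPolynomial.aeval ![(C (xMon 1 1) : PYPoly), (X : PYPoly)] :
        MvPolynomial (Fin 2) ℂ →ₐ[ℂ] PYPoly).toRingHom := by
    refine MvPolynomial.ringHom_ext (fun a => ?_) (fun i => ?_)
    · simp [Polynomial.algebraMap_apply, toPY_C, toPuiseuxPoly_C]
    · fin_cases i
      · simpa [toPY_C] using toPuiseuxPoly_X_pow 1 1
      · simp [toPY_X]
  exact (DFunLike.congr_fun this f).symm

/-! ### The restriction to `x = 0` -/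

/-- The value at `x = 0`. -/
def evalZero : PuiseuxPoly →+* ℂ :=
  (AddMonoidAlgebra.lift ℂ ℂ ℚ≥0
    { toFun := fun i => if i.toAdd = 0 then 1 else 0
      map_one' := by simp
      map_mul' := fun i j => by
        simp only [toAdd_mul, add_eq_zero]
        split_ifs <;> simp_all } : PuiseuxPoly →ₐ[ℂ] ℂ).toRingHom

theorem evalZero_apply (p : PuiseuxPoly) : evalZero p = p.coeff 0 := by
  induction p using AddMonoidAlgebra.induction_linear with
  | zero => simp
  | add p q hp hq => rw [map_add, hp, hq, AddMonoidAlgebra.coeff_add, Finsupp.add_apply]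
  | single i a =>
    change AddMonoidAlgebra.lift ℂ ℂ ℚ≥0 _ (AddMonoidAlgebra.single i a) = _
    rw [AddMonoidAlgebra.lift_single, AddMonoidAlgebra.coeff_single, Finsupp.single_apply]
    simp

theorem coeff_map_evalZero (g : PYPoly) (j : ℕ) : (g.map evalZero).coeff j = coeffXY g 0 j := by
  rw [coeff_map, evalZero_apply, coeffXY]

theorem map_evalZero_ne_zero_iff {g : PYPoly} : g.map evalZero ≠ 0 ↔ ∃ j, coeffXY g 0 j ≠ 0 := by
  rw [Ne, Polynomial.ext_iff, not_forall]
  simp only [coeff_map_evalZero, coeff_zero]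

theorem map_evalZero_toPY {N : ℕ} (hN : 0 < N) (g : ℂ[X][X]) :
    (toPY N g).map evalZero = g.map constantCoeff := by
  ext j
  rw [coeff_map_evalZero, coeffXY_toPY_zero hN, coeff_map, constantCoeff_apply]

theorem xMon_mul_xMon (a b : ℂ) (r s : ℚ≥0) : xMon a r * xMon b s = xMon (a * b) (r + s) :=
  AddMonoidAlgebra.single_mul_single _ _ _ _

theorem xMon_pow (a : ℂ) (r : ℚ≥0) (n : ℕ) : xMon a r ^ n = xMon (a ^ n) (n * r) := by
  rw [xMon, AddMonoidAlgebra.single_pow, nsmul_eq_mul]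

theorem xMon_ne_zero {a : ℂ} (ha : a ≠ 0) (r : ℚ≥0) : xMon a r ≠ 0 := by
  intro h
  have := congrArg (fun p : PuiseuxPoly => p.coeff r) h
  simp [xMon] at this
  exact ha this

theorem evalZero_xMon_of_pos {r : ℚ≥0} (hr : 0 < r) (a : ℂ) : evalZero (xMon a r) = 0 := by
  rw [evalZero_apply, xMon, AddMonoidAlgebra.coeff_single, Finsupp.single_apply, if_neg hr.ne']

/-- The highest power of `x` can be removed in only one way. -/
theorem eq_of_xMon_mul_eq {s t : ℚ≥0} {g g' : PYPoly} (h : C (xMon 1 s) * g = C (xMon 1 t) * g')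
    (hg : g.map evalZero ≠ 0) (hg' : g'.map evalZero ≠ 0) : g = g' := by
  have key : ∀ {s t : ℚ≥0} {g g' : PYPoly}, C (xMon 1 s) * g = C (xMon 1 t) * g' →
      g.map evalZero ≠ 0 → ¬ s < t := by
    intro s t g g' h hg hlt
    obtain ⟨d, rfl⟩ := exists_add_of_le hlt.le
    have hd : 0 < d := by
      rcases eq_or_ne d 0 with rfl | h
      · simp at hlt
      · exact pos_iff_ne_zero.2 h
    have h1 : g = C (xMon 1 d) * g' := by
      apply mul_left_cancel₀ (C_ne_zero.2 (xMon_ne_zero one_ne_zero s))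
      rw [h, ← mul_assoc, ← map_mul, xMon_mul_xMon, one_mul]
    rw [h1, Polynomial.map_mul, map_C, evalZero_xMon_of_pos hd, map_zero, zero_mul] at hg
    exact hg rfl
  obtain rfl : s = t := le_antisymm (not_lt.1 (key h.symm hg')) (not_lt.1 (key h hg))
  exact mul_left_cancel₀ (C_ne_zero.2 (xMon_ne_zero one_ne_zero s)) h

theorem eq_of_X_pow_mul_eq {R : Type*} [CommRing R] [IsDomain R] {e e' : ℕ} {p p' : R[X]}
    (h : X ^ e * p = X ^ e' * p') (hp : ¬ X ∣ p) (hp' : ¬ X ∣ p') : e = e' ∧ p = p' := by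
  have key : ∀ {e e' : ℕ} {p p' : R[X]}, X ^ e * p = X ^ e' * p' → ¬ X ∣ p → ¬ e < e' := by
    intro e e' p p' h hp hlt
    obtain ⟨d, rfl⟩ := Nat.exists_eq_add_of_lt hlt
    apply hp
    refine ⟨X ^ d * p', mul_left_cancel₀ (pow_ne_zero e X_ne_zero) ?_⟩
    rw [h]; ring
  obtain rfl : e = e' := le_antisymm (not_lt.1 (key h.symm hp')) (not_lt.1 (key h hp))
  exact ⟨rfl, mul_left_cancel₀ (pow_ne_zero e X_ne_zero) h⟩

/-- The step of the algorithm is determined by the root. -/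
theorem StarStep.unique {h : PYPoly} {c : ℂ} {r : ℚ≥0} {g g' : PYPoly} (hg : StarStep h c r g)
    (hg' : StarStep h c r g') : g = g' := by
  have hpos : ∀ {E P Q}, IsNewtonPolygon h E → Edge.actual P Q ∈ E →
      (∃ m, (Edge.actual P Q).IsRoot h c r m) → 0 < r := by
    rintro E P Q hE hPQ ⟨m, rfl, -⟩
    have := hE.isEdge hPQ
    exact edgeExponent_pos this.lt this.gt
  obtain ⟨E, hE, ⟨P, Q, hPQ, hm, e, p, hp, hXp, m, hpm, hgm⟩ | ⟨e, he, rfl, rfl, rfl⟩⟩ := hg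
  · obtain ⟨E', hE', ⟨P', Q', hPQ', hm', e', p', hp', hXp', m', hpm', hgm'⟩ | ⟨e', he', rfl, rfl, rfl⟩⟩ :=
      hg'
    · obtain ⟨rfl, rfl⟩ := eq_of_X_pow_mul_eq (hp.symm.trans hp') hXp hXp'
      exact eq_of_xMon_mul_eq (hpm.symm.trans hpm') (map_evalZero_ne_zero_iff.2 hgm)
        (map_evalZero_ne_zero_iff.2 hgm')
    · exact absurd (hpos hE hPQ hm) (lt_irrefl _)
  · obtain ⟨E', hE', ⟨P', Q', hPQ', hm', -⟩ | ⟨e', he', -, -, rfl⟩⟩ := hg'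
    · exact absurd (hpos hE' hPQ' hm') (lt_irrefl _)
    · rfl

/-! ### The polynomial of an edge -/

/-- The polynomial of the edge `PQ` at `x = 1`. -/
def edgeChar (h : PYPoly) (P Q : ℚ≥0 × ℕ) : ℂ[X] :=
  ∑ j ∈ Finset.Icc Q.2 P.2,
    C (coeffXY h (P.1 + edgeExponent P Q * ((P.2 - j : ℕ) : ℚ≥0)) j) * X ^ (j - Q.2)

theorem coeff_edgeChar (h : PYPoly) (P Q : ℚ≥0 × ℕ) (i : ℕ) :
    (edgeChar h P Q).coeff i = if i + Q.2 ≤ P.2 then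
      coeffXY h (P.1 + edgeExponent P Q * ((P.2 - (i + Q.2) : ℕ) : ℚ≥0)) (i + Q.2) else 0 := by
  simp only [edgeChar, finsetSum_coeff, coeff_C_mul, coeff_X_pow]
  split_ifs with hi
  · rw [Finset.sum_eq_single (i + Q.2)]
    · simp
    · intro j hj hne
      rw [Finset.mem_Icc] at hj
      rw [if_neg (by omega), mul_zero]
    · intro hn
      exact absurd (Finset.mem_Icc.2 ⟨by omega, hi⟩) hn
  · refine Finset.sum_eq_zero fun j hj => ?_
    rw [Finset.mem_Icc] at hj
    rw [if_neg (by omega), mul_zero]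

theorem edgeChar_coeff_zero {h : PYPoly} {P Q : ℚ≥0 × ℕ} (hE : IsEdge h P Q) :
    (edgeChar h P Q).coeff 0 ≠ 0 := by
  have h2 := hE.gt
  have hne : ((P.2 - Q.2 : ℕ) : ℚ≥0) ≠ 0 := by
    exact_mod_cast (Nat.sub_pos_of_lt h2).ne'
  rw [coeff_edgeChar, if_pos (by omega), zero_add, edgeExponent, div_mul_cancel₀ _ hne,
    add_tsub_cancel_of_le hE.lt.le]
  exact hE.right_mem

theorem edgeChar_coeff_top {h : PYPoly} {P Q : ℚ≥0 × ℕ} (hE : IsEdge h P Q) :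
    (edgeChar h P Q).coeff (P.2 - Q.2) ≠ 0 := by
  have h2 := hE.gt
  rw [coeff_edgeChar, Nat.sub_add_cancel h2.le, if_pos le_rfl]
  simpa only [Nat.sub_self, Nat.cast_zero, mul_zero, add_zero] using
    (show coeffXY h P.1 P.2 ≠ 0 from hE.left_mem)

theorem edgeChar_natDegree {h : PYPoly} {P Q : ℚ≥0 × ℕ} (hE : IsEdge h P Q) :
    (edgeChar h P Q).natDegree = P.2 - Q.2 := by
  refine natDegree_eq_of_le_of_coeff_ne_zero (natDegree_le_iff_coeff_eq_zero.2 fun i hi => ?_)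
    (edgeChar_coeff_top hE)
  rw [coeff_edgeChar, if_neg (by omega)]

theorem edgeChar_ne_zero {h : PYPoly} {P Q : ℚ≥0 × ℕ} (hE : IsEdge h P Q) : edgeChar h P Q ≠ 0 := by
  intro h0
  have := edgeChar_coeff_zero hE
  simp [h0] at this

/-- The coefficients `c` of the roots `c x^r` that an edge gives, with multiplicity. -/
def edgeRoots (h : PYPoly) (P Q : ℚ≥0 × ℕ) : Multiset ℂ := (edgeChar h P Q).roots

theorem card_edgeRoots {h : PYPoly} {P Q : ℚ≥0 × ℕ} (hE : IsEdge h P Q) :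
    Multiset.card (edgeRoots h P Q) = P.2 - Q.2 := by
  rw [edgeRoots, IsAlgClosed.card_roots_eq_natDegree, edgeChar_natDegree hE]

theorem ne_zero_of_mem_edgeRoots {h : PYPoly} {P Q : ℚ≥0 × ℕ} (hE : IsEdge h P Q) {c : ℂ}
    (hc : c ∈ edgeRoots h P Q) : c ≠ 0 := by
  rintro rfl
  have := (mem_roots'.1 hc).2
  rw [IsRoot.def, ← coeff_zero_eq_eval_zero] at this
  exact edgeChar_coeff_zero hE this

/-- The substitution `y = x^r y'` removes `x` from the polynomial of an edge of slope `-1/r`, up to a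
power of `x`. -/
theorem edgePoly_comp (h : PYPoly) (P Q : ℚ≥0 × ℕ) :
    (edgePoly h P Q).comp (C (xMon 1 (edgeExponent P Q)) * X) =
      C (xMon 1 (((P.2 - Q.2 : ℕ) : ℚ≥0) * edgeExponent P Q)) *
        (edgeChar h P Q).map (algebraMap ℂ PuiseuxPoly) := by
  rw [edgePoly, edgeChar, Polynomial.sum_comp, Polynomial.map_sum, Finset.mul_sum]
  refine Finset.sum_congr rfl fun j hj => ?_
  rw [Finset.mem_Icc] at hj
  have halg : ∀ a : ℂ, algebraMap ℂ PuiseuxPoly a = xMon a 0 := fun a => by simp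
  simp only [mul_comp, C_comp, pow_comp, X_comp, Polynomial.map_mul, map_C, Polynomial.map_pow,
    map_X, mul_pow, halg]
  rw [← mul_assoc, ← mul_assoc, ← map_pow, ← map_mul, ← map_mul, xMon_pow, xMon_mul_xMon,
    xMon_mul_xMon]
  congr 3
  · ring
  · have : ((P.2 - Q.2 : ℕ) : ℚ≥0) = ((P.2 - j : ℕ) : ℚ≥0) + ((j - Q.2 : ℕ) : ℚ≥0) := by
      rw [← Nat.cast_add]; congr 1; omega
    rw [this]; ring

theorem iterate_derivative_comp_C_mul_X {R : Type*} [CommRing R] (p : R[X]) (a : R) (k : ℕ) :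
    derivative^[k] (p.comp (C a * X)) = C (a ^ k) * (derivative^[k] p).comp (C a * X) := by
  induction k with
  | zero => simp
  | succ k ih =>
    rw [Function.iterate_succ_apply', ih, derivative_C_mul, derivative_comp,
      Function.iterate_succ_apply', derivative_C_mul, derivative_X, pow_succ, map_mul]
    ring

/-- The multiplicity of `c x^r` as a root of the polynomial of an edge over the Puiseux polynomials is
that of `c` as a root at `x = 1`. -/
theorem edgePoly_rootMultiplicity {h : PYPoly} {P Q : ℚ≥0 × ℕ} (hE : IsEdge h P Q) (c : ℂ) :
    (edgePoly h P Q).rootMultiplicity (xMon c (edgeExponent P Q)) = (edgeRoots h P Q).count c := by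
  classical
  have hcomp := edgePoly_comp h P Q
  have hχ := edgeChar_ne_zero hE
  have hinj : Function.Injective (algebraMap ℂ PuiseuxPoly) := (algebraMap ℂ PuiseuxPoly).injective
  have : CharZero PuiseuxPoly := charZero_of_injective_algebraMap hinj
  have h0 : edgePoly h P Q ≠ 0 := by
    intro h0
    rw [h0, zero_comp] at hcomp
    exact mul_ne_zero (C_ne_zero.2 (xMon_ne_zero one_ne_zero _))
      ((Polynomial.map_ne_zero_iff hinj).2 hχ) hcomp.symm
  rw [edgeRoots, count_roots]
  -- the Puiseux polynomials are a domain of characteristic zero, so that it is enough to compare the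
  -- zeros of the derivatives
  have key : ∀ k, (derivative^[k] (edgePoly h P Q)).IsRoot (xMon c (edgeExponent P Q)) ↔
      (derivative^[k] (edgeChar h P Q)).IsRoot c := by
    intro k
    have h1 := congrArg (fun p => eval (algebraMap ℂ PuiseuxPoly c) (derivative^[k] p)) hcomp
    rw [iterate_derivative_comp_C_mul_X, iterate_derivative_C_mul, iterate_derivative_map] at h1
    simp only [eval_mul, eval_C, eval_comp, eval_X, eval_map_apply] at h1
    have hc : xMon 1 (edgeExponent P Q) * algebraMap ℂ PuiseuxPoly c = xMon c (edgeExponent P Q) := by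
      rw [show algebraMap ℂ PuiseuxPoly c = xMon c 0 by simp, xMon_mul_xMon, one_mul, add_zero]
    rw [hc] at h1
    have hz1 := pow_ne_zero k (xMon_ne_zero (one_ne_zero (α := ℂ)) (edgeExponent P Q))
    have hz2 := xMon_ne_zero (one_ne_zero (α := ℂ)) (((P.2 - Q.2 : ℕ) : ℚ≥0) * edgeExponent P Q)
    rw [IsRoot.def, IsRoot.def]
    constructor
    · intro h2
      rw [h2, mul_zero] at h1
      have := (mul_eq_zero.1 h1.symm).resolve_left hz2
      exact hinj (by rw [this, map_zero])
    · intro h2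
      rw [h2, map_zero, mul_zero] at h1
      exact (mul_eq_zero.1 h1).resolve_left hz1
  refine eq_of_forall_lt_iff fun n => ?_
  rw [lt_rootMultiplicity_iff_isRoot_iterate_derivative h0,
    lt_rootMultiplicity_iff_isRoot_iterate_derivative hχ]
  simp only [key]

theorem isRoot_actual_iff {h : PYPoly} {P Q : ℚ≥0 × ℕ} (hE : IsEdge h P Q) {c : ℂ} {r : ℚ≥0} {m : ℕ} :
    (Edge.actual P Q).IsRoot h c r m ↔
      r = edgeExponent P Q ∧ 0 < m ∧ (edgeRoots h P Q).count c = m := by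
  change (r = edgeExponent P Q ∧ 0 < m ∧ (edgePoly h P Q).rootMultiplicity (xMon c r) = m) ↔ _
  constructor
  · rintro ⟨rfl, h1, h2⟩
    exact ⟨rfl, h1, by rw [← edgePoly_rootMultiplicity hE]; exact h2⟩
  · rintro ⟨rfl, h1, h2⟩
    exact ⟨rfl, h1, by rw [edgePoly_rootMultiplicity hE]; exact h2⟩

/-! ### The substitution for a root of an edge -/

theorem IsEdge.exists_nat {h : ℂ[X][X]} {P Q : ℚ≥0 × ℕ} (hE : IsEdge (toPY 1 h) P Q) :
    ∃ a b j₁ j₂ : ℕ, P = ((a : ℚ≥0), j₁) ∧ Q = ((b : ℚ≥0), j₂) := by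
  obtain ⟨a, ha⟩ := exists_nat_of_mem_supp hE.left_mem
  obtain ⟨b, hb⟩ := exists_nat_of_mem_supp hE.right_mem
  exact ⟨a, b, _, _, ha, hb⟩

/-- The substitution `x = T^N`, `y = T^k y'` for an edge with the exponent `r = k/N`: the power of `T`
that can be split off, and what is left at `T = 0`. -/
theorem IsEdge.exists_scaled {h : ℂ[X][X]} {a b j₁ j₂ : ℕ}
    (hE : IsEdge (toPY 1 h) ((a : ℚ≥0), j₁) ((b : ℚ≥0), j₂)) {N k : ℕ} (hN : 0 < N)
    (hr : edgeExponent ((a : ℚ≥0), j₁) ((b : ℚ≥0), j₂) = k / N) :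
    ∃ H : ℂ[X][X], (expandX N h).comp (C (X ^ k) * X) = C (X ^ (N * a + k * j₁)) * H ∧
      H.map constantCoeff = X ^ j₂ * edgeChar (toPY 1 h) ((a : ℚ≥0), j₁) ((b : ℚ≥0), j₂) := by
  have hN0 : (N : ℚ≥0) ≠ 0 := by exact_mod_cast hN.ne'
  have hj := hE.gt
  dsimp only at hj
  -- the weight `n + k j` of the term `T^n y^j` is minimal on the edge
  have hweight : ∀ n j, ((expandX N h).coeff j).coeff n ≠ 0 → N * a + k * j₁ ≤ n + k * j := by
    intro n j hne
    rw [← coeffXY_expandX hN] at hne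
    have := hE.le (n / N, j) hne
    rw [hr] at this
    dsimp only at this
    rw [← mul_le_mul_iff_of_pos_left (show (0 : ℚ≥0) < N by exact_mod_cast hN)] at this
    field_simp at this
    exact_mod_cast this
  have hbetween : ∀ n j, ((expandX N h).coeff j).coeff n ≠ 0 → N * a + k * j₁ = n + k * j →
      j₂ ≤ j ∧ j ≤ j₁ := by
    intro n j hne e
    rw [← coeffXY_expandX hN] at hne
    refine hE.between (n / N, j) hne ?_
    rw [hr]
    dsimp only
    have e' : (N * a + k * j₁ : ℚ≥0) = n + k * j := by exact_mod_cast e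
    field_simp
    rw [mul_comm (a : ℚ≥0)]
    exact e'
  obtain ⟨H, hH⟩ : C (X ^ (N * a + k * j₁)) ∣ (expandX N h).comp (C (X ^ k) * X) := by
    rw [C_dvd_iff_dvd_coeff]
    intro j
    rw [comp_C_mul_X_coeff, X_pow_dvd_iff, ← pow_mul]
    intro d hd
    rw [coeff_mul_X_pow']
    split_ifs with hkd
    · by_contra hne
      have := hweight _ _ hne
      omega
    · rfl
  refine ⟨H, hH, ?_⟩
  ext j
  have hc : (H.coeff j).coeff 0 = if k * j ≤ N * a + k * j₁ then
      ((expandX N h).coeff j).coeff (N * a + k * j₁ - k * j) else 0 := by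
    have := congrArg (fun p => (p.coeff j).coeff (N * a + k * j₁)) hH
    simp only [comp_C_mul_X_coeff, coeff_C_mul, ← pow_mul, coeff_mul_X_pow', coeff_X_pow_mul',
      le_refl, if_true, Nat.sub_self] at this
    exact this.symm
  rw [coeff_map, constantCoeff_apply, hc, coeff_X_pow_mul', coeff_edgeChar]
  by_cases hj2 : j₂ ≤ j
  · rw [if_pos hj2]
    dsimp only
    rw [Nat.sub_add_cancel hj2]
    by_cases hj1 : j ≤ j₁
    · have hkj : k * j ≤ k * j₁ := Nat.mul_le_mul_left k hj1
      rw [if_pos (by omega), if_pos hj1, ← coeffXY_expandX hN, hr]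
      congr 1
      have : N * a + k * j₁ - k * j = N * a + k * (j₁ - j) := by
        rw [Nat.mul_sub]; omega
      rw [this]
      push_cast
      field_simp
    · rw [if_neg hj1]
      split_ifs with hk
      · by_contra hne
        exact hj1 (hbetween _ _ hne (by omega)).2
      · rfl
  · rw [if_neg hj2]
    split_ifs with hk
    · by_contra hne
      exact hj2 (hbetween _ _ hne (by omega)).1
    · rfl

/-- The substitution `x = T^N`, `y = T^k (c + z)` for a root of an edge. -/
theorem IsEdge.exists_transform {h : ℂ[X][X]} {a b j₁ j₂ : ℕ}
    (hE : IsEdge (toPY 1 h) ((a : ℚ≥0), j₁) ((b : ℚ≥0), j₂)) {N k : ℕ} (hN : 0 < N)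
    (hr : edgeExponent ((a : ℚ≥0), j₁) ((b : ℚ≥0), j₂) = k / N) (c : ℂ) :
    ∃ g : ℂ[X][X], (expandX N h).comp (C (X ^ k) * (C (C c) + X)) =
        C (X ^ (N * a + k * j₁)) * g ∧
      g.map constantCoeff = (X ^ j₂ * edgeChar (toPY 1 h) ((a : ℚ≥0), j₁) ((b : ℚ≥0), j₂)).comp
        (C c + X) := by
  obtain ⟨H, hH1, hH2⟩ := hE.exists_scaled hN hr
  refine ⟨H.comp (C (C c) + X), ?_, ?_⟩
  · have := congrArg (fun p => Polynomial.comp p (C (C c) + X)) hH1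
    simpa only [comp_assoc, mul_comp, C_comp, X_comp] using this
  · rw [Polynomial.map_comp, hH2]
    simp

/-- For `c ≠ 0` the order in `z` of the restriction to `x = 0` is the multiplicity of the root. The
factor `(c + z)^e` comes from the power `y^e` that is split off before the substitution; it does not
vanish at `z = 0`. -/
theorem rootMultiplicity_transform {h : PYPoly} {P Q : ℚ≥0 × ℕ} (hE : IsEdge h P Q) {c : ℂ}
    (hc : c ≠ 0) (e j : ℕ) {G : ℂ[X]}
    (hG : (C c + X) ^ e * G = (X ^ j * edgeChar h P Q).comp (C c + X)) :
    (∀ i < (edgeRoots h P Q).count c, G.coeff i = 0) ∧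
      G.coeff ((edgeRoots h P Q).count c) ≠ 0 := by
  classical
  obtain ⟨ψ, hψ, hψc⟩ := exists_eq_pow_rootMultiplicity_mul_and_not_dvd (edgeChar h P Q)
    (edgeChar_ne_zero hE) c
  rw [← count_roots, ← edgeRoots] at hψ
  set m := (edgeRoots h P Q).count c
  have h1 : (C c + X) ^ e * G = X ^ m * ((C c + X) ^ j * ψ.comp (C c + X)) := by
    rw [hG, hψ]
    simp only [mul_comp, pow_comp, sub_comp, X_comp, C_comp]
    ring
  have hψ0 : (ψ.comp (C c + X)).eval 0 ≠ 0 := by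
    rw [eval_comp]
    simpa [dvd_iff_isRoot] using hψc
  have hcop : IsCoprime (X ^ m) ((C c + X) ^ e : ℂ[X]) := by
    refine IsCoprime.pow ⟨-C c⁻¹, C c⁻¹, ?_⟩
    rw [mul_add, ← map_mul, inv_mul_cancel₀ hc, map_one]
    ring
  obtain ⟨u, rfl⟩ := hcop.dvd_of_dvd_mul_left ⟨_, h1⟩
  have h2 : (C c + X) ^ e * u = (C c + X) ^ j * ψ.comp (C c + X) := by
    apply mul_left_cancel₀ (pow_ne_zero m X_ne_zero)
    rw [← h1]; ring
  have hu : u.coeff 0 ≠ 0 := by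
    intro hu
    rw [coeff_zero_eq_eval_zero] at hu
    have := congrArg (eval 0) h2
    rw [eval_mul, hu, mul_zero, eval_mul] at this
    exact mul_ne_zero (by simp [hc]) hψ0 this.symm
  exact ⟨fun i hi => by rw [coeff_X_pow_mul', if_neg (by omega)],
    by simpa [coeff_X_pow_mul'] using hu⟩

/-- A simple root `c x^(k/N)` of an edge is the beginning of a root in `ℂ⟦x^(1/N)⟧`. -/
theorem IsEdge.exists_evalS_eq_zero {h : ℂ[X][X]} {P Q : ℚ≥0 × ℕ}
    (hE : IsEdge (toPY 1 h) P Q) {N k : ℕ} (hN : 0 < N)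
    (hr : edgeExponent P Q = k / N) {c : ℂ} (hc : (edgeRoots (toPY 1 h) P Q).count c = 1) :
    ∃ w : PowerSeries ℂ, evalS (PowerSeries.X ^ N) (tail c k w) h = 0 := by
  obtain ⟨a, b, j₁, j₂, rfl, rfl⟩ := hE.exists_nat
  obtain ⟨g, hg1, hg2⟩ := hE.exists_transform hN hr c
  have hc0 : c ≠ 0 := ne_zero_of_mem_edgeRoots hE (Multiset.count_pos.1 (by omega))
  obtain ⟨h0, h1⟩ := rootMultiplicity_transform hE hc0 0 j₂ (G := g.map constantCoeff)
    (by rw [pow_zero, one_mul]; exact hg2)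
  rw [hc] at h0 h1
  have hcc : ∀ i, PowerSeries.constantCoeff ((g.map
      (Polynomial.aeval (PowerSeries.X) : ℂ[X] →ₐ[ℂ] PowerSeries ℂ).toRingHom).coeff i) =
      (g.map constantCoeff).coeff i := fun i => by
    rw [coeff_map, coeff_map, constantCoeff_apply]
    exact constantCoeff_aeval PowerSeries.constantCoeff_X _
  obtain ⟨w, hw⟩ := exists_root_of_simple (g.map
      (Polynomial.aeval (PowerSeries.X) : ℂ[X] →ₐ[ℂ] PowerSeries ℂ).toRingHom)
    (by rw [hcc]; exact h0 0 one_pos) (by rw [hcc]; exact h1)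
  refine ⟨w, ?_⟩
  have hw' : evalS PowerSeries.X (PowerSeries.X * w) g = 0 := by
    rw [← hw, eval_map]; rfl
  have := congrArg (evalS PowerSeries.X (PowerSeries.X * w)) hg1
  rw [map_mul, hw', mul_zero, evalS_comp, evalS_expandX] at this
  rw [← this]
  congr 2
  simp only [tail, map_mul, map_add, evalS_C, evalS_X, aeval_C, map_pow, aeval_X]
  rw [PowerSeries.algebraMap_apply, Algebra.algebraMap_self, RingHom.id_apply]
  ring

/-! ### Steps of the algorithm -/

theorem toPY_substitution {N : ℕ} (hN : 0 < N) (h : ℂ[X][X]) (k : ℕ) (c : ℂ) :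
    toPY N ((expandX N h).comp (C (X ^ k) * (C (C c) + X))) =
      (toPY 1 h).comp (C (xMon 1 (k / N)) * (C (xMon c 0) + X)) := by
  rw [toPY_comp, toPY_expandX hN, map_mul, map_add, toPY_C, toPY_C, toPY_X, toPuiseuxPoly_X_pow,
    toPuiseuxPoly_C]

/-- A step of the algorithm from a polynomial in `x, y` either is the one for the virtual edge, or it
belongs to an edge and leads to a polynomial whose restriction to `x = 0` has the multiplicity of the
root as its order. -/
theorem StarStep.order_eq {h : ℂ[X][X]} {c : ℂ} {r : ℚ≥0} {g : PYPoly}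
    (hg : StarStep (toPY 1 h) c r g) {E : List Edge} (hE : IsNewtonPolygon (toPY 1 h) E) :
    (c = 0 ∧ r = 0 ∧ g = 0) ∨ ∃ P Q, Edge.actual P Q ∈ E ∧ r = edgeExponent P Q ∧
      c ∈ edgeRoots (toPY 1 h) P Q ∧
      (∀ i < (edgeRoots (toPY 1 h) P Q).count c, coeffXY g 0 i = 0) ∧
      coeffXY g 0 ((edgeRoots (toPY 1 h) P Q).count c) ≠ 0 := by
  obtain ⟨E', hE', ⟨P, Q, hPQ, ⟨m, hm⟩, e, p, hp, hXp, s, hps, hgs⟩ | ⟨e, he, rfl, rfl, rfl⟩⟩ := hg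
  swap
  · exact Or.inl ⟨rfl, rfl, rfl⟩
  obtain rfl := hE'.unique hE
  right
  have hEd := hE.isEdge hPQ
  rw [isRoot_actual_iff hEd] at hm
  obtain ⟨rfl, hm0, hmc⟩ := hm
  have hcmem : c ∈ edgeRoots (toPY 1 h) P Q := Multiset.count_pos.1 (by omega)
  have hc0 := ne_zero_of_mem_edgeRoots hEd hcmem
  refine ⟨P, Q, hPQ, rfl, hcmem, ?_⟩
  obtain ⟨a, b, j₁, j₂, rfl, rfl⟩ := hEd.exists_nat
  have hab : a < b := by exact_mod_cast (show (a : ℚ≥0) < b from hEd.lt)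
  have hj : j₂ < j₁ := hEd.gt
  have hr : edgeExponent ((a : ℚ≥0), j₁) ((b : ℚ≥0), j₂) = ((b - a : ℕ) : ℚ≥0) / (j₁ - j₂ : ℕ) := by
    rw [edgeExponent, Nat.cast_tsub b a]
  have hN : 0 < j₁ - j₂ := by omega
  obtain ⟨G, hG1, hG2⟩ := hEd.exists_transform hN hr c
  -- the substitution in `h` and in `h / y^e` differ by the unit `(c + z)^e`
  have h1 : C (xMon 1 (e * edgeExponent ((a : ℚ≥0), j₁) ((b : ℚ≥0), j₂) + s)) *
      ((C (xMon c 0) + X) ^ e * g) =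
      C (xMon 1 (((j₁ - j₂) * a + (b - a) * j₁ : ℕ) / (j₁ - j₂ : ℕ))) * toPY (j₁ - j₂) G := by
    rw [← toPuiseuxPoly_X_pow, ← toPY_C, ← map_mul, ← hG1, toPY_substitution hN, ← hr, hp, mul_comp,
      hps, pow_comp, X_comp, mul_pow, ← map_pow C (xMon 1 _), xMon_pow, one_pow,
      ← one_mul (1 : ℂ), ← xMon_mul_xMon, one_mul, map_mul]
    ring
  have hmap : ((C (xMon c 0) + X) ^ e * g).map evalZero = (C c + X) ^ e * g.map evalZero := by
    rw [Polynomial.map_mul, Polynomial.map_pow, Polynomial.map_add, map_C, map_X, evalZero_apply]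
    simp
  have hcX : (C c + X : ℂ[X]) ≠ 0 := by
    rw [add_comm]; exact X_add_C_ne_zero c
  have hgz := map_evalZero_ne_zero_iff.2 hgs
  have h2 := eq_of_xMon_mul_eq h1 (by rw [hmap]; exact mul_ne_zero (pow_ne_zero _ hcX) hgz) (by
    rw [map_evalZero_toPY hN, hG2, Ne, comp_eq_zero_iff, not_or]
    refine ⟨mul_ne_zero (pow_ne_zero _ X_ne_zero) (edgeChar_ne_zero hEd), fun h3 => ?_⟩
    have := congrArg (fun p => coeff p 1) h3.2
    simp [coeff_C] at this)
  have h3 := congrArg (Polynomial.map evalZero) h2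
  rw [hmap, map_evalZero_toPY hN, hG2] at h3
  simpa only [coeff_map_evalZero] using rootMultiplicity_transform hEd hc0 e j₂ h3

/-- The step for a root `c x^k` with an integer `k`, from a polynomial in `x, y`. The power of `x` that
is split off is at least `x^(2k)` because the edge starts at height at least two. -/
theorem exists_starStep {h : ℂ[X][X]} {E : List Edge} (hE : IsNewtonPolygon (toPY 1 h) E)
    {P Q : ℚ≥0 × ℕ} (hPQ : Edge.actual P Q ∈ E) (hP : 2 ≤ P.2) {k : ℕ}
    (hr : edgeExponent P Q = k) {c : ℂ} (hc : c ∈ edgeRoots (toPY 1 h) P Q) :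
    ∃ g V : ℂ[X][X], StarStep (toPY 1 h) c k (toPY 1 g) ∧
      h.comp (C (X ^ k) * (C (C c) + X)) = C (X ^ (2 * k)) * V * g ∧
      (∀ i < (edgeRoots (toPY 1 h) P Q).count c, (g.coeff i).coeff 0 = 0) ∧
      (g.coeff ((edgeRoots (toPY 1 h) P Q).count c)).coeff 0 ≠ 0 := by
  obtain ⟨a, b, j₁, j₂, rfl, rfl⟩ := (hE.isEdge hPQ).exists_nat
  have hj₁ : 2 ≤ j₁ := hP
  have hEd := hE.isEdge hPQ
  have hh0 : h ≠ 0 := by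
    rintro rfl
    exact mem_supp_toPY.1 hEd.right_mem (by simp)
  obtain ⟨p, hp, hXp⟩ := exists_eq_pow_rootMultiplicity_mul_and_not_dvd h hh0 0
  rw [map_zero, sub_zero] at hp hXp
  set e := h.rootMultiplicity 0
  have hej : e ≤ j₂ := by
    by_contra! hlt
    refine mem_supp_toPY.1 hEd.right_mem ?_
    rw [hp, coeff_X_pow_mul', if_neg (by omega), coeff_zero]
  have hj := hEd.gt
  dsimp only at hj
  obtain ⟨H, hH1, hH2⟩ := hEd.exists_scaled one_pos (k := k) (by simpa using hr)
  rw [expandX_one, one_mul] at hH1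
  -- for `h / y^e` the edge is lower by `e`, and the power of `x` that can be split off is `x^M`
  have hM : a + k * j₁ = k * e + (a + k * (j₁ - e)) := by
    obtain ⟨d, rfl⟩ := Nat.exists_eq_add_of_le (hej.trans hj.le)
    rw [Nat.add_sub_cancel_left]; ring
  set M := a + k * (j₁ - e)
  clear_value M
  have h1 : X ^ e * p.comp (C (X ^ k) * X) = C (X ^ M) * H := by
    have h0 : (C (X ^ (k * e)) : ℂ[X][X]) ≠ 0 := by simp
    apply mul_left_cancel₀ h0
    rw [← mul_assoc (C (X ^ (k * e))) (C (X ^ M)), ← map_mul, ← pow_add, ← hM, ← hH1]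
    conv_rhs => rw [hp]
    rw [mul_comp, pow_comp, X_comp, mul_pow, ← map_pow, ← pow_mul, mul_assoc]
  obtain ⟨H, rfl⟩ : X ^ e ∣ H := by
    rw [X_pow_dvd_iff]
    intro d hd
    have := X_pow_dvd_iff.1 ⟨_, h1.symm⟩ d hd
    rw [coeff_C_mul] at this
    exact (mul_eq_zero.1 this).resolve_left (pow_ne_zero _ X_ne_zero)
  have h2 : p.comp (C (X ^ k) * X) = C (X ^ M) * H := by
    apply mul_left_cancel₀ (pow_ne_zero e (X_ne_zero (R := ℂ[X])))
    rw [h1]; ring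
  have h3 : p.comp (C (X ^ k) * (C (C c) + X)) = C (X ^ M) * H.comp (C (C c) + X) := by
    have := congrArg (fun p => Polynomial.comp p (C (C c) + X)) h2
    simpa only [comp_assoc, mul_comp, C_comp, X_comp] using this
  refine ⟨H.comp (C (C c) + X), C (X ^ (a + k * (j₁ - 2))) * (C (C c) + X) ^ e, ?_, ?_, ?_⟩
  · refine ⟨E, hE, Or.inl ⟨_, _, hPQ, ⟨_, (isRoot_actual_iff hEd).2 ⟨hr.symm,
      Multiset.count_pos.2 hc, rfl⟩⟩, e, toPY 1 p, ?_, ?_, (M : ℚ≥0), ?_, ?_⟩⟩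
    · conv_lhs => rw [hp]
      rw [map_mul, map_pow, toPY_X]
    · rw [X_dvd_iff] at hXp ⊢
      intro h0
      apply hXp
      ext n
      rw [← coeffXY_toPY_one, coeffXY, h0]
      simp
    · have := toPY_substitution one_pos p k c
      rw [expandX_one, h3, map_mul, toPY_C, toPuiseuxPoly_X_pow] at this
      simpa using this.symm
    · rw [← map_evalZero_ne_zero_iff, map_evalZero_toPY one_pos, Polynomial.map_comp]
      have hne : H.map constantCoeff ≠ 0 := by
        intro h0
        rw [Polynomial.map_mul, h0, mul_zero] at hH2
        exact mul_ne_zero (pow_ne_zero _ X_ne_zero) (edgeChar_ne_zero hEd) hH2.symm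
      rw [Ne, comp_eq_zero_iff, not_or]
      refine ⟨hne, fun h3 => ?_⟩
      have := congrArg (fun p => coeff p 1) h3.2
      simp [coeff_C] at this
  · conv_lhs => rw [hp]
    have hM2 : a + k * j₁ = 2 * k + (a + k * (j₁ - 2)) := by
      obtain ⟨d, rfl⟩ := Nat.exists_eq_add_of_le hj₁
      rw [Nat.add_sub_cancel_left]; ring
    rw [mul_comp, pow_comp, X_comp, h3, mul_pow, ← map_pow C (X ^ k), ← pow_mul]
    calc C (X ^ (k * e)) * (C (C c) + X) ^ e * (C (X ^ M) * H.comp (C (C c) + X))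
        = C (X ^ (k * e + M)) * ((C (C c) + X) ^ e * H.comp (C (C c) + X)) := by
          rw [pow_add, map_mul]; ring
      _ = _ := by rw [← hM, hM2, pow_add, map_mul]; ring
  · have h4 : (C c + X) ^ e * (H.comp (C (C c) + X)).map constantCoeff =
        (X ^ j₂ * edgeChar (toPY 1 h) ((a : ℚ≥0), j₁) ((b : ℚ≥0), j₂)).comp (C c + X) := by
      rw [← hH2, Polynomial.map_comp]
      simp
    have h5 := rootMultiplicity_transform hEd (ne_zero_of_mem_edgeRoots hEd hc) e j₂ h4
    simpa only [coeff_map, constantCoeff_apply] using h5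

/-! ### Simple and multiple roots of the edges -/

theorem isFirstVertex_toPY_iff {h : ℂ[X][X]} {d : ℕ} :
    IsFirstVertex (toPY 1 h) (0, d) ↔
      (∀ i < d, (h.coeff i).coeff 0 = 0) ∧ (h.coeff d).coeff 0 ≠ 0 := by
  have hs : ∀ j, ((0 : ℚ≥0), j) ∈ supp (toPY 1 h) ↔ (h.coeff j).coeff 0 ≠ 0 := fun j => by
    rw [← mem_supp_toPY, Nat.cast_zero]
  simp only [IsFirstVertex, hs, true_and]
  rw [and_comm]
  refine and_congr_left fun _ => ⟨fun H i hi => ?_, fun H j hj => ?_⟩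
  · by_contra hne
    exact absurd (H i hne) (by omega)
  · by_contra! hlt
    exact hj (H j hlt)

theorem not_stopCriterion {h : ℂ[X][X]} {d : ℕ} (hd : 2 ≤ d)
    (hV : IsFirstVertex (toPY 1 h) (0, d)) : ¬ StopCriterion (toPY 1 h) := by
  have hV' := isFirstVertex_toPY_iff.1 hV
  rintro (h0 | ⟨-, h1⟩)
  · have h00 : h = 0 := toPY_injective one_pos (by rw [h0, map_zero])
    rw [h00] at hV'
    exact hV'.2 (by simp)
  · rw [coeffXY_toPY_zero one_pos] at h1
    exact h1 (hV'.1 1 (by omega))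

/-- Only a multiple root can lead to a polynomial that does not satisfy the stop criterion. -/
theorem stopCriterion_of_simple {h : ℂ[X][X]} {c : ℂ} {r : ℚ≥0} {g : PYPoly}
    (hg : StarStep (toPY 1 h) c r g) {E : List Edge} (hE : IsNewtonPolygon (toPY 1 h) E) :
    StopCriterion g ∨ ∃ P Q, Edge.actual P Q ∈ E ∧ r = edgeExponent P Q ∧
      c ∈ edgeRoots (toPY 1 h) P Q ∧ (edgeRoots (toPY 1 h) P Q).count c ≠ 1 := by
  rcases hg.order_eq hE with ⟨-, -, rfl⟩ | ⟨P, Q, hPQ, hr, hc, h1, h2⟩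
  · exact Or.inl (Or.inl rfl)
  · by_cases h3 : (edgeRoots (toPY 1 h) P Q).count c = 1
    · rw [h3] at h1 h2
      exact Or.inl (Or.inr ⟨h1 0 one_pos, h2⟩)
    · exact Or.inr ⟨P, Q, hPQ, hr, hc, h3⟩

theorem canStop_of_nodup {h : ℂ[X][X]} {E : List Edge} (hE : IsNewtonPolygon (toPY 1 h) E)
    (hn : ∀ P Q, Edge.actual P Q ∈ E → (edgeRoots (toPY 1 h) P Q).Nodup) :
    CanStop (toPY 1 h) := by
  intro c r g hg
  rcases stopCriterion_of_simple hg hE with h1 | ⟨P, Q, hPQ, -, hc, h1⟩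
  · exact h1
  · exact absurd (Multiset.count_eq_one_of_mem (hn P Q hPQ) hc) h1

/-- A polynomial `a X^d + b` with `a, b ≠ 0` has no multiple roots. -/
theorem nodup_roots_of_binomial {p : ℂ[X]} {d : ℕ} (hd : p.natDegree = d) (hd0 : d ≠ 0)
    (h0 : p.coeff 0 ≠ 0) (hm : ∀ i, 0 < i → i < d → p.coeff i = 0) : p.roots.Nodup := by
  refine nodup_roots ?_
  -- `d p - X p' = d b` is a unit
  have hp : (d : ℂ[X]) * p - X * derivative p = C (d * p.coeff 0) := by
    ext i
    rw [coeff_sub, coeff_natCast_mul]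
    cases i with
    | zero => simp
    | succ i =>
      rw [coeff_X_mul, coeff_derivative, coeff_C_succ]
      rcases lt_trichotomy (i + 1) d with h | h | h
      · rw [hm _ (Nat.succ_pos i) h]; simp
      · rw [← h]; push_cast; ring
      · rw [coeff_eq_zero_of_natDegree_lt (by omega)]; simp
  have hdc : (d : ℂ) * p.coeff 0 ≠ 0 := mul_ne_zero (by exact_mod_cast hd0) h0
  refine ⟨C (d * p.coeff 0)⁻¹ * (d : ℂ[X]), - C (d * p.coeff 0)⁻¹ * X, ?_⟩
  calc C (d * p.coeff 0)⁻¹ * (d : ℂ[X]) * p + - C (d * p.coeff 0)⁻¹ * X * derivative p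
      = C (d * p.coeff 0)⁻¹ * ((d : ℂ[X]) * p - X * derivative p) := by ring
    _ = 1 := by rw [hp, ← map_mul, inv_mul_cancel₀ hdc, map_one]

theorem edgeExponent_natCast {a b j₁ j₂ : ℕ} :
    edgeExponent ((a : ℚ≥0), j₁) ((b : ℚ≥0), j₂) = ((b - a : ℕ) : ℚ≥0) / (j₁ - j₂ : ℕ) := by
  rw [edgeExponent, Nat.cast_tsub b a]

/-- An edge of prime height `p` whose exponent is not an integer has only simple roots, since only
its endpoints can be in the support. -/
theorem IsEdge.nodup_of_not_dvd {h : ℂ[X][X]} {a b j₁ j₂ : ℕ}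
    (hE : IsEdge (toPY 1 h) ((a : ℚ≥0), j₁) ((b : ℚ≥0), j₂)) (hp : (j₁ - j₂).Prime)
    (hk : ¬ j₁ - j₂ ∣ b - a) : (edgeRoots (toPY 1 h) ((a : ℚ≥0), j₁) ((b : ℚ≥0), j₂)).Nodup := by
  refine nodup_roots_of_binomial (edgeChar_natDegree hE) hp.ne_zero (edgeChar_coeff_zero hE)
    fun i hi0 hi => ?_
  dsimp only at hi
  rw [coeff_edgeChar, if_pos (by dsimp only; omega), edgeExponent_natCast]
  dsimp only
  have hN0 : ((j₁ - j₂ : ℕ) : ℚ≥0) ≠ 0 := by exact_mod_cast hp.ne_zero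
  have hx : (a : ℚ≥0) + ((b - a : ℕ) : ℚ≥0) / (j₁ - j₂ : ℕ) * ((j₁ - (i + j₂) : ℕ) : ℚ≥0) =
      (((j₁ - j₂) * a + (b - a) * (j₁ - (i + j₂)) : ℕ) : ℚ≥0) / (j₁ - j₂ : ℕ) := by
    rw [eq_div_iff hN0, Nat.cast_add, Nat.cast_mul, Nat.cast_mul]
    field_simp
  rw [hx, coeffXY_expandX hp.pos]
  simp only [expandX, coe_mapRingHom, coeff_map]
  change (expand ℂ (j₁ - j₂) (h.coeff (i + j₂))).coeff _ = 0
  rw [coeff_expand hp.pos, if_neg]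
  intro hdvd
  rw [Nat.dvd_add_right (dvd_mul_right _ _), hp.dvd_mul] at hdvd
  rcases hdvd with hdvd | hdvd
  · exact hk hdvd
  · exact absurd (Nat.le_of_dvd (by omega) hdvd) (by omega)

/-- The step for a root `c x^k` with an integer `k`, when all other roots are simple. -/
theorem exists_multiple_step {h : ℂ[X][X]} {E : List Edge} (hE : IsNewtonPolygon (toPY 1 h) E)
    {P Q : ℚ≥0 × ℕ} (hPQ : Edge.actual P Q ∈ E) (hP : 2 ≤ P.2) {k : ℕ}
    (hr : edgeExponent P Q = k) {c : ℂ} {m : ℕ} (hm : 0 < m)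
    (hc : (edgeRoots (toPY 1 h) P Q).count c = m)
    (hother : ∀ P' Q' c', Edge.actual P' Q' ∈ E → c' ∈ edgeRoots (toPY 1 h) P' Q' →
      (edgeRoots (toPY 1 h) P' Q').count c' = 1 ∨ (edgeExponent P' Q' = k ∧ c' = c)) :
    ∃ g V : ℂ[X][X], StarStep (toPY 1 h) c k (toPY 1 g) ∧
      h.comp (C (X ^ k) * (C (C c) + X)) = C (X ^ (2 * k)) * V * g ∧
      IsFirstVertex (toPY 1 g) (0, m) ∧
      ∀ c' r g', StarStep (toPY 1 h) c' r g' →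
        StopCriterion g' ∨ (c' = c ∧ r = k ∧ g' = toPY 1 g) := by
  obtain ⟨g, V, hg, hV, h1, h2⟩ := exists_starStep hE hPQ hP hr
    (Multiset.count_pos.1 (by omega : 0 < (edgeRoots (toPY 1 h) P Q).count c))
  rw [hc] at h1 h2
  refine ⟨g, V, hg, hV, isFirstVertex_toPY_iff.2 ⟨h1, h2⟩, fun c' r g' hg' => ?_⟩
  rcases stopCriterion_of_simple hg' hE with h3 | ⟨P', Q', hPQ', rfl, hc', h3⟩
  · exact Or.inl h3
  · obtain ⟨h4, rfl⟩ := (hother P' Q' c' hPQ' hc').resolve_left h3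
    rw [h4] at hg'
    exact Or.inr ⟨rfl, h4, hg'.unique hg⟩

/-! ### Chains of steps for roots of maximal multiplicity -/

/-- From `h` there is only one step, for the root `b x^k`; it leads to `g`, and the Newton polygons of
`h` and `g` start at the same height `d`. -/
def IsOnlyStep (d : ℕ) (h : ℂ[X][X]) (b : ℂ) (k : ℕ) (g : ℂ[X][X]) : Prop :=
  b ≠ 0 ∧ 0 < k ∧
    (∀ c r g', StarStep (toPY 1 h) c r g' ↔ (c = b ∧ r = k ∧ g' = toPY 1 g)) ∧
    (∃ V, h.comp (C (X ^ k) * (C (C b) + X)) = C (X ^ (2 * k)) * V * g) ∧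
    IsFirstVertex (toPY 1 g) (0, d)

/-- If the only edge has one root of multiplicity `d`, then there is only one step. -/
theorem exists_isOnlyStep {h : ℂ[X][X]} {d k : ℕ} (hd : 2 ≤ d) {b : ℂ} {i : ℕ}
    (hE : IsNewtonPolygon (toPY 1 h) [.actual (0, d) (i, 0)]) (hi : i = d * k)
    (hb : edgeRoots (toPY 1 h) (0, d) (i, 0) = Multiset.replicate d b) :
    ∃ g, IsOnlyStep d h b k g := by
  have hEd := hE.isEdge (List.mem_singleton_self _)
  have hbm : b ∈ edgeRoots (toPY 1 h) (0, d) (i, 0) := by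
    rw [hb]; exact Multiset.mem_replicate.2 ⟨by omega, rfl⟩
  have hr : edgeExponent (0, d) ((i : ℚ≥0), 0) = k := by
    have hd0 : (d : ℚ≥0) ≠ 0 := by exact_mod_cast (by omega : d ≠ 0)
    rw [edgeExponent, hi]
    simp only [tsub_zero, Nat.cast_mul]
    exact mul_div_cancel_left₀ _ hd0
  have hk : 0 < k := by
    have := edgeExponent_pos hEd.lt hEd.gt
    rw [hr] at this
    exact_mod_cast this
  obtain ⟨g, V, hg, hV, hF, -⟩ := exists_multiple_step hE (List.mem_singleton_self _) hd hr
    (by omega : 0 < d) (by rw [hb, Multiset.count_replicate_self]) (fun P' Q' c' hPQ' hc' => by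
      obtain ⟨rfl, rfl⟩ := Edge.actual.inj (List.mem_singleton.1 hPQ')
      rw [hb] at hc'
      exact Or.inr ⟨hr, Multiset.eq_of_mem_replicate hc'⟩)
  refine ⟨g, ne_zero_of_mem_edgeRoots hEd hbm, hk, fun c r g' => ⟨fun hs => ?_, ?_⟩, ⟨V, hV⟩, hF⟩
  · rcases hs.order_eq hE with ⟨-, rfl, -⟩ | ⟨P', Q', hPQ', rfl, hc', -⟩
    · exfalso
      obtain ⟨E', hE', ⟨P', Q', hPQ', ⟨m, hm, -⟩, -⟩ | ⟨e, he, -⟩⟩ := hs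
      · have h1 := hE'.isEdge hPQ'
        exact (edgeExponent_pos h1.lt h1.gt).ne hm
      · obtain rfl := hE'.unique hE
        simp at he
    · obtain ⟨rfl, rfl⟩ := Edge.actual.inj (List.mem_singleton.1 hPQ')
      rw [hb] at hc'
      obtain rfl := Multiset.eq_of_mem_replicate hc'
      rw [hr] at hs
      exact ⟨rfl, hr, hs.unique hg⟩
  · rintro ⟨rfl, rfl, rfl⟩
    exact hg

/-- The partial sum `b 0 x^(H + k 0) + … + b (n - 1) x^(H + k 0 + … + k (n - 1))` that a chain of
steps contributes to a Puiseux series. -/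
def stepPoly (H n : ℕ) (b : ℕ → ℂ) (k : ℕ → ℕ) : ℂ[X] :=
  ∑ i ∈ Finset.range n, C (b i) * X ^ (H + expSum k (i + 1))

theorem aeval_stepPoly (N H n : ℕ) (b : ℕ → ℂ) (k : ℕ → ℕ) :
    Polynomial.aeval (PowerSeries.X ^ N : PowerSeries ℂ) (stepPoly H n b k) = stepSum N H n b k := by
  rw [stepPoly, stepSum, map_sum]
  refine Finset.sum_congr rfl fun i _ => ?_
  rw [map_mul, aeval_C, map_pow, aeval_X, ← pow_mul, PowerSeries.algebraMap_apply,
    Algebra.algebraMap_self, RingHom.id_apply]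

/-- The steps for roots of maximal multiplicity come to an end, because each of them raises the power
of `x` in the discriminant of `f`. -/
theorem exists_chain {f A B : ℂ[X][X]} {δ : ℂ[X]} (hδ0 : δ ≠ 0)
    (hδ : A * f + B * derivative f = C δ) (d : ℕ) (p : PYPoly → Prop) {D : ℂ[X]} {K : ℕ}
    {h : ℂ[X][X]} (hT : IsTransform f D K h) (hV : IsFirstVertex (toPY 1 h) (0, d)) :
    ∃ (n : ℕ) (b : ℕ → ℂ) (k : ℕ → ℕ) (F : ℕ → ℂ[X][X]), F 0 = h ∧
      (∀ i < n, p (toPY 1 (F i)) ∧ IsOnlyStep d (F i) (b i) (k i) (F (i + 1))) ∧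
      (∀ i ≤ n, IsFirstVertex (toPY 1 (F i)) (0, d)) ∧
      IsTransform f (D + stepPoly K n b k) (K + expSum k n) (F n) ∧
      ¬ ∃ b k g, p (toPY 1 (F n)) ∧ IsOnlyStep d (F n) b k g := by
  classical
  obtain ⟨F, lab, hF0, hF⟩ := exists_orbit (fun (h : ℂ[X][X]) (l : ℂ × ℕ) g =>
    p (toPY 1 h) ∧ IsOnlyStep d h l.1 l.2 g) h
  set b : ℕ → ℂ := fun i => (lab i).1
  set k : ℕ → ℕ := fun i => (lab i).2
  -- each exponent is at least one, so the length of the chain is at most the sum of the exponents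
  have key : ∀ n, (∀ i < n, ∃ l g, p (toPY 1 (F i)) ∧ IsOnlyStep d (F i) (l : ℂ × ℕ).1 l.2 g) →
      IsFirstVertex (toPY 1 (F n)) (0, d) ∧
      IsTransform f (D + stepPoly K n b k) (K + expSum k n) (F n) ∧ n ≤ expSum k n := by
    intro n
    induction n with
    | zero =>
      intro _
      rw [hF0]
      exact ⟨hV, by simpa [stepPoly, expSum] using hT, Nat.zero_le _⟩
    | succ n ih =>
      intro hn
      obtain ⟨h1, h2, h3⟩ := ih fun i hi => hn i (by omega)
      obtain ⟨-, -, h5, -, ⟨V, h6⟩, h7⟩ := hF n (hn n (Nat.lt_succ_self n))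
      have hsum : expSum k (n + 1) = expSum k n + k n := Finset.sum_range_succ _ _
      refine ⟨h7, ?_, ?_⟩
      · have := h2.trans h6
        rw [hsum, ← Nat.add_assoc]
        convert this using 1
        rw [stepPoly, Finset.sum_range_succ, ← stepPoly, hsum, add_assoc, Nat.add_assoc]
      · rw [hsum]
        have : 0 < k n := h5
        omega
  have hex : ∃ n, ¬ ∃ l g, p (toPY 1 (F n)) ∧ IsOnlyStep d (F n) (l : ℂ × ℕ).1 l.2 g := by
    by_contra! hall
    obtain ⟨-, h2, h3⟩ := key (δ.natDegree + 1) fun i _ => hall i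
    have := h2.le_natDegree hδ0 hδ
    omega
  have hmin : ∀ i < Nat.find hex, ∃ l g, p (toPY 1 (F i)) ∧
      IsOnlyStep d (F i) (l : ℂ × ℕ).1 l.2 g := fun i hi => by
    have := Nat.find_min hex hi
    rwa [not_not] at this
  refine ⟨Nat.find hex, b, k, F, hF0, fun i hi => hF i (hmin i hi),
    fun i hi => (key i fun j hj => hmin j (by omega)).1, (key _ hmin).2.1, ?_⟩
  rintro ⟨b', k', g, hg⟩
  exact Nat.find_spec hex ⟨(b', k'), g, hg⟩

/-! ### Simple roots and the series they begin -/

/-- `c x^q` is a simple root for `h`, with an integer `q`, and `c x^q + x^(q+1) w(x)` is a root of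
`h`; the root `0` of a virtual edge is represented by `c = 0`, `q = 0`, `w = 0`. -/
def IsSmoothRoot (h : ℂ[X][X]) (c : ℂ) (q : ℕ) (w : PowerSeries ℂ) : Prop :=
  IsRootOf (toPY 1 h) c q 1 ∧ (c = 0 ↔ q = 0) ∧ (q = 0 → w = 0) ∧
    evalS PowerSeries.X (tail c q w) h = 0

/-- `c x^(i/N)` is a simple root for `h`, where `N` does not divide `i`, and with `x = T^N` the series
`c T^i + T^(i+1) w(T)` is a root of `h`. -/
def IsRamifiedRoot (N : ℕ) (h : ℂ[X][X]) (c : ℂ) (i : ℕ) (w : PowerSeries ℂ) : Prop :=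
  IsRootOf (toPY 1 h) c (i / N) 1 ∧ c ≠ 0 ∧ 0 < i ∧ ¬ N ∣ i ∧
    evalS (PowerSeries.X ^ N) (tail c i w) h = 0

theorem exists_isSmoothRoot {h : ℂ[X][X]} {E : List Edge} (hE : IsNewtonPolygon (toPY 1 h) E)
    {P Q : ℚ≥0 × ℕ} (hPQ : Edge.actual P Q ∈ E) {q : ℕ} (hq : edgeExponent P Q = q) {c : ℂ}
    (hc : (edgeRoots (toPY 1 h) P Q).count c = 1) : ∃ w, IsSmoothRoot h c q w := by
  have hEd := hE.isEdge hPQ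
  obtain ⟨w, hw⟩ := hEd.exists_evalS_eq_zero one_pos (by simpa using hq) hc
  have hq0 : q ≠ 0 := by
    have := edgeExponent_pos hEd.lt hEd.gt
    rw [hq] at this
    exact_mod_cast this.ne'
  have hc0 := ne_zero_of_mem_edgeRoots hEd (Multiset.count_pos.1 (by rw [hc]; exact one_pos))
  exact ⟨w, ⟨E, hE, _, hPQ, (isRoot_actual_iff hEd).2 ⟨hq.symm, one_pos, hc⟩⟩,
    iff_of_false hc0 hq0, fun h => absurd h hq0, by simpa using hw⟩

theorem isSmoothRoot_virtual {h : ℂ[X][X]} {E : List Edge} (hE : IsNewtonPolygon (toPY 1 h) E)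
    (hv : Edge.virtual 1 ∈ E) (hX : X ∣ h) : IsSmoothRoot h 0 0 0 := by
  obtain ⟨g, rfl⟩ := hX
  exact ⟨⟨E, hE, _, hv, rfl, by simp, rfl⟩, by simp, fun _ => rfl, by simp [tail]⟩

/-- An edge of prime height `N` whose exponent is not an integer has only simple roots. -/
theorem IsEdge.nodup_of_exponent {h : ℂ[X][X]} {P Q : ℚ≥0 × ℕ} (hE : IsEdge (toPY 1 h) P Q)
    {N i : ℕ} (hN : P.2 - Q.2 = N) (hp : N.Prime) (hr : edgeExponent P Q = i / N) (hi : ¬ N ∣ i) :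
    (edgeRoots (toPY 1 h) P Q).Nodup := by
  obtain ⟨a, b, j₁, j₂, rfl, rfl⟩ := hE.exists_nat
  dsimp only at hN
  rw [edgeExponent_natCast, hN] at hr
  have hN0 : (N : ℚ≥0) ≠ 0 := by exact_mod_cast hp.ne_zero
  have : b - a = i := by exact_mod_cast (div_left_inj' hN0).1 hr
  refine hE.nodup_of_not_dvd (by rwa [hN]) ?_
  rwa [hN, this]

theorem exists_isRamifiedRoot {h : ℂ[X][X]} {E : List Edge} (hE : IsNewtonPolygon (toPY 1 h) E)
    {P Q : ℚ≥0 × ℕ} (hPQ : Edge.actual P Q ∈ E) {N i : ℕ} (hN : P.2 - Q.2 = N) (hp : N.Prime)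
    (hr : edgeExponent P Q = i / N) (hi : ¬ N ∣ i) : ∃ c w, IsRamifiedRoot N h c i w := by
  have hEd := hE.isEdge hPQ
  have hcard := card_edgeRoots hEd
  obtain ⟨c, hc⟩ := Multiset.card_pos_iff_exists_mem.1
    (by rw [hcard, hN]; exact hp.pos : 0 < Multiset.card (edgeRoots (toPY 1 h) P Q))
  have hc1 := Multiset.count_eq_one_of_mem (hEd.nodup_of_exponent hN hp hr hi) hc
  obtain ⟨w, hw⟩ := hEd.exists_evalS_eq_zero hp.pos hr hc1
  refine ⟨c, w, ⟨E, hE, _, hPQ, (isRoot_actual_iff hEd).2 ⟨hr.symm, one_pos, hc1⟩⟩,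
    ne_zero_of_mem_edgeRoots hEd hc, Nat.pos_of_ne_zero ?_, hi, hw⟩
  rintro rfl
  exact hi (dvd_zero N)

theorem IsEdge.nodup_of_height_one {h : ℂ[X][X]} {P Q : ℚ≥0 × ℕ} (hE : IsEdge (toPY 1 h) P Q)
    (h1 : P.2 - Q.2 = 1) : (edgeRoots (toPY 1 h) P Q).Nodup := by
  obtain ⟨c, hc⟩ := Multiset.card_eq_one.1 ((card_edgeRoots hE).trans h1)
  rw [hc]
  exact Multiset.nodup_singleton c

theorem exists_isSmoothRoot_of_height_one {h : ℂ[X][X]} {E : List Edge}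
    (hE : IsNewtonPolygon (toPY 1 h) E) {P Q : ℚ≥0 × ℕ} (hPQ : Edge.actual P Q ∈ E)
    (h1 : P.2 - Q.2 = 1) : ∃ c q w, IsSmoothRoot h c q w ∧ edgeExponent P Q = q := by
  have hEd := hE.isEdge hPQ
  obtain ⟨c, hc⟩ := Multiset.card_eq_one.1 ((card_edgeRoots hEd).trans h1)
  obtain ⟨a, b, j₁, j₂, rfl, rfl⟩ := hEd.exists_nat
  have hq : edgeExponent ((a : ℚ≥0), j₁) ((b : ℚ≥0), j₂) = ((b - a : ℕ) : ℚ≥0) := by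
    dsimp only at h1
    rw [edgeExponent_natCast, h1]
    simp
  obtain ⟨w, hw⟩ := exists_isSmoothRoot hE hPQ hq (c := c) (by rw [hc]; simp)
  exact ⟨c, _, w, hw, hq⟩

/-! ### The possible Newton polygons -/

/-- From a vertex of the Newton polygon there is a next one, or it is a lowest point of the support. -/
theorem next_cases {h : ℂ[X][X]} {P : ℚ≥0 × ℕ} {r : ℚ} (hA : IsAbove (toPY 1 h) r P) :
    (∀ Q ∈ supp (toPY 1 h), P.2 ≤ Q.2) ∨ ∃ b j : ℕ, IsNextVertex (toPY 1 h) P ((b : ℚ≥0), j) := by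
  by_cases hall : ∀ Q ∈ supp (toPY 1 h), P.2 ≤ Q.2
  · exact Or.inl hall
  · push Not at hall
    obtain ⟨R, hR, hlt⟩ := hall
    obtain ⟨Q, hQ⟩ := exists_isNextVertex ⟨R, hR, by
      by_contra! hle
      exact absurd ((hA R hR).2.2 hle) (not_le.2 hlt), hlt⟩
    obtain ⟨b, hb⟩ := exists_nat_of_mem_supp hQ.1
    exact Or.inr ⟨b, Q.2, by rw [← hb]; exact hQ⟩

theorem X_dvd_of_supp {h : ℂ[X][X]} (hs : ∀ Q ∈ supp (toPY 1 h), 1 ≤ Q.2) : X ∣ h := by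
  rw [X_dvd_iff]
  ext a
  by_contra hne
  exact absurd (hs _ (mem_supp_toPY.2 hne)) (by norm_num)

/-- From a vertex of ordinate one, the Newton polygon has one more edge, of height one. -/
theorem exists_last_edge {h : ℂ[X][X]} {P : ℚ≥0 × ℕ} (hP : P ∈ supp (toPY 1 h)) (hP1 : P.2 = 1)
    {r : ℚ≥0} (hA : IsAbove (toPY 1 h) r P) :
    ∃ b : Edge, b.height = 1 ∧ PolygonFrom (toPY 1 h) P [b] ∧
      (∀ A B, Edge.actual A B = b → (edgeRoots (toPY 1 h) A B).Nodup) ∧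
      ∀ E, IsNewtonPolygon (toPY 1 h) E → b ∈ E →
        ∃ c q w, IsSmoothRoot h c q w ∧ (q = 0 ∨ r < q) := by
  rcases next_cases hA with hall | ⟨b, j, hQ⟩
  · refine ⟨.virtual 1, rfl, ?_, fun A B hAB => by simp at hAB, fun E hE hv => ?_⟩
    · have := PolygonFrom.virtual (h := toPY 1 h) P (by omega) hall
      simpa only [hP1] using this
    · exact ⟨0, 0, 0, isSmoothRoot_virtual hE hv (X_dvd_of_supp (by rwa [hP1] at hall)), Or.inl rfl⟩
  · obtain ⟨h1, h2, h3⟩ := hA.next hP hQ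
    have hlt := h3.gt
    rw [hP1] at hlt
    dsimp only at hlt
    obtain rfl : j = 0 := by omega
    refine ⟨.actual P ((b : ℚ≥0), 0), by simp [Edge.height, hP1], .edge _ _ _ hQ (.done _ rfl), ?_, ?_⟩
    · intro A B hAB
      obtain ⟨rfl, rfl⟩ := Edge.actual.inj hAB
      exact h3.nodup_of_height_one (by simp [hP1])
    · intro E hE hb
      obtain ⟨c, q, w, hw, hq⟩ := exists_isSmoothRoot_of_height_one hE hb (by simp [hP1])
      rw [hq] at h1
      exact ⟨c, q, w, hw, Or.inr (by exact_mod_cast h1)⟩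

theorem edgeExponent_eq_of_dvd {P Q : ℚ≥0 × ℕ} {N i k : ℕ} (hN : N ≠ 0) (hi : i = N * k)
    (hr : edgeExponent P Q = i / N) : edgeExponent P Q = k := by
  have hN0 : (N : ℚ≥0) ≠ 0 := by exact_mod_cast hN
  rw [hr, hi, Nat.cast_mul, mul_div_cancel_left₀ _ hN0]

theorem count_eq_one_of_ne {x y : ℂ} (hxy : x ≠ y) :
    ({x, y} : Multiset ℂ).count x = 1 ∧ ({x, y} : Multiset ℂ).count y = 1 := by
  simp [Multiset.insert_eq_cons, hxy, hxy.symm]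

/-- The possible Newton polygons of height two. -/
theorem cases_height_two {h : ℂ[X][X]} (hV : IsFirstVertex (toPY 1 h) (0, 2))
    (hsq : ∃ j < 2, ∃ i, (h.coeff j).coeff i ≠ 0) :
    (∃ b k g, Case222 (toPY 1 h) ∧ IsOnlyStep 2 h b k g) ∨
    (Case21 (toPY 1 h) ∧ CanStop (toPY 1 h) ∧ ∃ c i w, IsRamifiedRoot 2 h c i w) ∨
    ((Case221 (toPY 1 h) ∨ Case3 (toPY 1 h)) ∧ CanStop (toPY 1 h) ∧
      ∃ c₁ c₂ q₁ q₂ w₁ w₂, IsSmoothRoot h c₁ q₁ w₁ ∧ IsSmoothRoot h c₂ q₂ w₂ ∧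
        ¬ (c₁ = c₂ ∧ q₁ = q₂) ∧ (Case221 (toPY 1 h) → q₁ = q₂)) := by
  have hA := hV.isAbove
  obtain ⟨j₀, hj₀, i₀, hi₀⟩ := hsq
  rcases next_cases hA with hall | ⟨i₁, j, hQ⟩
  · exact absurd (hall _ (mem_supp_toPY.2 hi₀)) (not_le.2 hj₀)
  obtain ⟨-, hA₁, hE₁⟩ := hA.next hV.1 hQ
  have hj := hE₁.gt
  dsimp only at hj
  interval_cases j
  · -- one edge
    have hE : IsNewtonPolygon (toPY 1 h) [.actual (0, 2) (i₁, 0)] :=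
      ⟨_, hV, .edge _ _ _ hQ (.done _ rfl)⟩
    have hmem := List.mem_singleton_self (Edge.actual (0, 2) ((i₁ : ℚ≥0), 0))
    have hr : edgeExponent (0, 2) ((i₁ : ℚ≥0), 0) = i₁ / (2 : ℕ) := by
      simpa using edgeExponent_natCast (a := 0) (b := i₁) (j₁ := 2) (j₂ := 0)
    by_cases hdvd : 2 ∣ i₁
    · obtain ⟨k, hk⟩ := hdvd
      have hrk := edgeExponent_eq_of_dvd two_ne_zero hk hr
      obtain ⟨x, y, hxy⟩ := Multiset.card_eq_two.1 (card_edgeRoots hE₁)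
      by_cases hne : x = y
      · subst hne
        left
        obtain ⟨g, hg⟩ := exists_isOnlyStep le_rfl hE hk (b := x) (by rw [hxy]; rfl)
        refine ⟨x, k, g, ⟨i₁, ⟨k, hk⟩, hE, x, _, (isRoot_actual_iff hE₁).2 ⟨rfl, two_pos, ?_⟩⟩, hg⟩
        rw [hxy]
        simp [Multiset.insert_eq_cons]
      · right; right
        obtain ⟨cx, cy⟩ := count_eq_one_of_ne hne
        rw [← hxy] at cx cy
        obtain ⟨w₁, hw₁⟩ := exists_isSmoothRoot hE hmem hrk cx
        obtain ⟨w₂, hw₂⟩ := exists_isSmoothRoot hE hmem hrk cy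
        refine ⟨Or.inl ⟨i₁, ⟨k, hk⟩, hE, x, y, _, hne, (isRoot_actual_iff hE₁).2 ⟨rfl, one_pos, cx⟩,
          (isRoot_actual_iff hE₁).2 ⟨rfl, one_pos, cy⟩⟩, canStop_of_nodup hE fun P Q hPQ => ?_,
          x, y, k, k, w₁, w₂, hw₁, hw₂, fun h => hne h.1, fun _ => rfl⟩
        obtain ⟨rfl, rfl⟩ := Edge.actual.inj (List.mem_singleton.1 hPQ)
        rw [hxy]
        simpa [Multiset.insert_eq_cons] using hne
    · right; left
      refine ⟨⟨i₁, hdvd, hE⟩, canStop_of_nodup hE fun P Q hPQ => ?_, ?_⟩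
      · obtain ⟨rfl, rfl⟩ := Edge.actual.inj (List.mem_singleton.1 hPQ)
        exact hE₁.nodup_of_exponent rfl Nat.prime_two hr hdvd
      · obtain ⟨c, w, hw⟩ := exists_isRamifiedRoot hE hmem rfl Nat.prime_two hr hdvd
        exact ⟨c, i₁, w, hw⟩
  · -- two edges
    right; right
    obtain ⟨b, hb, hPb, hbn, hbr⟩ := exists_last_edge hE₁.right_mem rfl hA₁
    have hE : IsNewtonPolygon (toPY 1 h) [.actual (0, 2) (i₁, 1), b] :=
      ⟨_, hV, .edge _ _ _ hQ hPb⟩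
    obtain ⟨c₁, q₁, w₁, hw₁, hq₁⟩ :=
      exists_isSmoothRoot_of_height_one hE (P := (0, 2)) (Q := ((i₁ : ℚ≥0), 1)) (by simp) rfl
    obtain ⟨c₂, q₂, w₂, hw₂, hq₂⟩ := hbr _ hE (by simp)
    have hq₁0 : 0 < q₁ := by
      have := edgeExponent_pos hE₁.lt hE₁.gt
      rw [hq₁] at this
      exact_mod_cast this
    refine ⟨Or.inr ⟨i₁, b, hb, hE⟩, canStop_of_nodup hE fun P Q hPQ => ?_,
      c₁, c₂, q₁, q₂, w₁, w₂, hw₁, hw₂, ?_, ?_⟩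
    · simp only [List.mem_cons, List.not_mem_nil, or_false] at hPQ
      rcases hPQ with hPQ | hPQ
      · obtain ⟨rfl, rfl⟩ := Edge.actual.inj hPQ
        exact hE₁.nodup_of_height_one rfl
      · exact hbn _ _ hPQ
    · rintro ⟨-, rfl⟩
      rw [hq₁] at hq₂
      rcases hq₂ with h0 | h0
      · omega
      · exact lt_irrefl _ h0
    · rintro ⟨i, -, hE', -⟩
      exact absurd (hE.unique hE') (by simp)

/-- The step for a double root `c x^p`, `c ≠ 0`, leads from `h` to `g`, and all other steps lead to
polynomials that satisfy the stop criterion. -/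
structure IsDoubleRootStep (h : ℂ[X][X]) (c : ℂ) (p : ℕ) (g : ℂ[X][X]) : Prop where
  isRootOf : IsRootOf (toPY 1 h) c p 2
  ne_zero : c ≠ 0
  pos : 0 < p
  step : StarStep (toPY 1 h) c p (toPY 1 g)
  comp_eq : ∃ V, h.comp (C (X ^ p) * (C (C c) + X)) = C (X ^ (2 * p)) * V * g
  isFirstVertex : IsFirstVertex (toPY 1 g) (0, 2)
  other : ∀ c' r g', StarStep (toPY 1 h) c' r g' →
    StopCriterion g' ∨ (c' = c ∧ r = p ∧ g' = toPY 1 g)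

theorem exists_isDoubleRootStep {h : ℂ[X][X]} {E : List Edge} (hE : IsNewtonPolygon (toPY 1 h) E)
    {P Q : ℚ≥0 × ℕ} (hPQ : Edge.actual P Q ∈ E) (hP : 2 ≤ P.2) {p : ℕ}
    (hr : edgeExponent P Q = p) {c : ℂ} (hc : (edgeRoots (toPY 1 h) P Q).count c = 2)
    (hother : ∀ P' Q' c', Edge.actual P' Q' ∈ E → c' ∈ edgeRoots (toPY 1 h) P' Q' →
      (edgeRoots (toPY 1 h) P' Q').count c' = 1 ∨ (edgeExponent P' Q' = p ∧ c' = c)) :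
    ∃ g, IsDoubleRootStep h c p g := by
  obtain ⟨g, V, h1, h2, h3, h4⟩ := exists_multiple_step hE hPQ hP hr two_pos hc hother
  have hEd := hE.isEdge hPQ
  have hpos := edgeExponent_pos hEd.lt hEd.gt
  rw [hr] at hpos
  exact ⟨g, ⟨E, hE, _, hPQ, (isRoot_actual_iff hEd).2 ⟨hr.symm, two_pos, hc⟩⟩,
    ne_zero_of_mem_edgeRoots hEd (Multiset.count_pos.1 (by rw [hc]; exact two_pos)),
    by exact_mod_cast hpos, h1, ⟨V, h2⟩, h3, h4⟩

theorem multiset_card_two_cases {s : Multiset ℂ} (hs : Multiset.card s = 2) :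
    (∃ b, s = Multiset.replicate 2 b) ∨ ∃ x y, x ≠ y ∧ s = {x, y} := by
  obtain ⟨x, y, rfl⟩ := Multiset.card_eq_two.1 hs
  by_cases hxy : x = y
  · subst hxy
    exact Or.inl ⟨x, rfl⟩
  · exact Or.inr ⟨x, y, hxy, rfl⟩

theorem multiset_card_three_cases {s : Multiset ℂ} (hs : Multiset.card s = 3) :
    (∃ b, s = Multiset.replicate 3 b) ∨ (∃ x y, x ≠ y ∧ s = {x, y, y}) ∨
      ∃ x y z, x ≠ y ∧ y ≠ z ∧ z ≠ x ∧ s = {x, y, z} := by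
  obtain ⟨x, y, z, rfl⟩ := Multiset.card_eq_three.1 hs
  by_cases hxy : x = y
  · subst hxy
    by_cases hxz : x = z
    · subst hxz
      exact Or.inl ⟨x, rfl⟩
    · exact Or.inr (Or.inl ⟨z, x, Ne.symm hxz, by
        simp only [Multiset.insert_eq_cons]
        rw [Multiset.cons_swap z x, ← Multiset.cons_zero z, ← Multiset.cons_zero x,
          Multiset.cons_swap z x]⟩)
  · by_cases hxz : x = z
    · subst hxz
      exact Or.inr (Or.inl ⟨y, x, Ne.symm hxy, by
        simp only [Multiset.insert_eq_cons]; rw [Multiset.cons_swap]⟩)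
    · by_cases hyz : y = z
      · subst hyz
        exact Or.inr (Or.inl ⟨x, y, hxy, rfl⟩)
      · exact Or.inr (Or.inr ⟨x, y, z, hxy, hyz, Ne.symm hxz, rfl⟩)

/-- The possible Newton polygons of height three with one edge. -/
theorem cases_one_edge {h : ℂ[X][X]} {i₁ : ℕ}
    (hE : IsNewtonPolygon (toPY 1 h) [.actual (0, 3) (i₁, 0)]) :
    (∃ b k g, Case423 (toPY 1 h) ∧ IsOnlyStep 3 h b k g) ∨
    (Case41 (toPY 1 h) ∧ CanStop (toPY 1 h) ∧ ∃ c i w, IsRamifiedRoot 3 h c i w) ∨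
    (Case421 (toPY 1 h) ∧ CanStop (toPY 1 h) ∧
      ∃ c₁ c₂ c₃ q w₁ w₂ w₃, IsSmoothRoot h c₁ q w₁ ∧ IsSmoothRoot h c₂ q w₂ ∧
        IsSmoothRoot h c₃ q w₃ ∧ c₁ ≠ c₂ ∧ c₂ ≠ c₃ ∧ c₃ ≠ c₁) ∨
    (Case422 (toPY 1 h) ∧ ∃ c₁ c₂ p w g, IsSmoothRoot h c₁ p w ∧ c₁ ≠ c₂ ∧
      IsDoubleRootStep h c₂ p g) := by
  have hmem := List.mem_singleton_self (Edge.actual (0, 3) ((i₁ : ℚ≥0), 0))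
  have hE₁ := hE.isEdge hmem
  have hr : edgeExponent (0, 3) ((i₁ : ℚ≥0), 0) = i₁ / (3 : ℕ) := by
    simpa using edgeExponent_natCast (a := 0) (b := i₁) (j₁ := 3) (j₂ := 0)
  by_cases hdvd : 3 ∣ i₁
  · obtain ⟨k, hk⟩ := hdvd
    have hrk := edgeExponent_eq_of_dvd three_ne_zero hk hr
    rcases multiset_card_three_cases (card_edgeRoots hE₁) with
      ⟨b, hb⟩ | ⟨x, y, hxy, hs⟩ | ⟨x, y, z, hxy, hyz, hzx, hs⟩
    · left
      obtain ⟨g, hg⟩ := exists_isOnlyStep (by norm_num) hE hk (b := b) hb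
      refine ⟨b, k, g, ⟨i₁, ⟨k, hk⟩, hE, b, _, (isRoot_actual_iff hE₁).2 ⟨rfl, three_pos, ?_⟩⟩, hg⟩
      rw [hb, Multiset.count_replicate_self]
    · right; right; right
      have cx : (edgeRoots (toPY 1 h) (0, 3) (i₁, 0)).count x = 1 := by
        rw [hs]; simp [Multiset.insert_eq_cons, hxy]
      have cy : (edgeRoots (toPY 1 h) (0, 3) (i₁, 0)).count y = 2 := by
        rw [hs]; simp [Multiset.insert_eq_cons, hxy.symm]
      obtain ⟨w, hw⟩ := exists_isSmoothRoot hE hmem hrk cx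
      obtain ⟨g, hg⟩ := exists_isDoubleRootStep hE hmem (by norm_num) hrk cy
        fun P' Q' c' hPQ' hc' => by
          obtain ⟨rfl, rfl⟩ := Edge.actual.inj (List.mem_singleton.1 hPQ')
          have hc'' := hc'
          rw [hs] at hc''
          simp only [Multiset.insert_eq_cons, Multiset.mem_cons, Multiset.mem_singleton,
            or_self] at hc''
          rcases hc'' with rfl | rfl
          · exact Or.inl cx
          · exact Or.inr ⟨hrk, rfl⟩
      exact ⟨⟨i₁, ⟨k, hk⟩, hE, x, y, _, (isRoot_actual_iff hE₁).2 ⟨rfl, one_pos, cx⟩,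
        (isRoot_actual_iff hE₁).2 ⟨rfl, two_pos, cy⟩⟩, x, y, k, w, g, hw, hxy, hg⟩
    · right; right; left
      have hn : (edgeRoots (toPY 1 h) (0, 3) (i₁, 0)).Nodup := by
        rw [hs]; simpa [Multiset.insert_eq_cons] using ⟨⟨hxy, hzx.symm⟩, hyz⟩
      have hm : ∀ c ∈ ({x, y, z} : Multiset ℂ),
          (edgeRoots (toPY 1 h) (0, 3) (i₁, 0)).count c = 1 := fun c hc =>
        Multiset.count_eq_one_of_mem hn (by rwa [hs])
      have cx := hm x (by simp [Multiset.insert_eq_cons])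
      have cy := hm y (by simp [Multiset.insert_eq_cons])
      have cz := hm z (by simp [Multiset.insert_eq_cons])
      obtain ⟨w₁, hw₁⟩ := exists_isSmoothRoot hE hmem hrk cx
      obtain ⟨w₂, hw₂⟩ := exists_isSmoothRoot hE hmem hrk cy
      obtain ⟨w₃, hw₃⟩ := exists_isSmoothRoot hE hmem hrk cz
      refine ⟨⟨i₁, ⟨k, hk⟩, hE, x, y, z, _, hxy, hyz, hzx,
        (isRoot_actual_iff hE₁).2 ⟨rfl, one_pos, cx⟩, (isRoot_actual_iff hE₁).2 ⟨rfl, one_pos, cy⟩,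
        (isRoot_actual_iff hE₁).2 ⟨rfl, one_pos, cz⟩⟩, canStop_of_nodup hE fun P Q hPQ => ?_,
        x, y, z, k, w₁, w₂, w₃, hw₁, hw₂, hw₃, hxy, hyz, hzx⟩
      obtain ⟨rfl, rfl⟩ := Edge.actual.inj (List.mem_singleton.1 hPQ)
      exact hn
  · right; left
    refine ⟨⟨i₁, hdvd, hE⟩, canStop_of_nodup hE fun P Q hPQ => ?_, ?_⟩
    · obtain ⟨rfl, rfl⟩ := Edge.actual.inj (List.mem_singleton.1 hPQ)
      exact hE₁.nodup_of_exponent rfl Nat.prime_three hr hdvd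
    · obtain ⟨c, w, hw⟩ := exists_isRamifiedRoot hE hmem rfl Nat.prime_three hr hdvd
      exact ⟨c, i₁, w, hw⟩

/-- The Newton polygons of height three that begin with an edge of height two. -/
theorem cases_height_two_first {h : ℂ[X][X]} {i₁ : ℕ} (hV : IsFirstVertex (toPY 1 h) (0, 3))
    (hQ : IsNextVertex (toPY 1 h) (0, 3) ((i₁ : ℚ≥0), 1)) :
    (Case51 (toPY 1 h) ∧ CanStop (toPY 1 h) ∧
      ∃ c q w d i v, IsSmoothRoot h c q w ∧ IsRamifiedRoot 2 h d i v) ∨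
    (Case521 (toPY 1 h) ∧ CanStop (toPY 1 h) ∧
      ∃ c₁ c₂ c₃ q q' w₁ w₂ w₃, IsSmoothRoot h c₁ q w₁ ∧ IsSmoothRoot h c₂ q w₂ ∧
        IsSmoothRoot h c₃ q' w₃ ∧ c₁ ≠ c₂ ∧ q ≠ q') ∨
    (Case522 (toPY 1 h) ∧ ∃ c₁ c₂ p₁ p₂ w g, IsSmoothRoot h c₁ p₁ w ∧ (p₁ = 0 ∨ p₂ < p₁) ∧
      IsDoubleRootStep h c₂ p₂ g) := by
  obtain ⟨-, hA₁, hE₁⟩ := hV.isAbove.next hV.1 hQ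
  obtain ⟨b, hb, hPb, hbn, hbr⟩ := exists_last_edge hE₁.right_mem rfl hA₁
  have hE : IsNewtonPolygon (toPY 1 h) [.actual (0, 3) (i₁, 1), b] :=
    ⟨_, hV, .edge _ _ _ hQ hPb⟩
  have hmem : Edge.actual (0, 3) ((i₁ : ℚ≥0), 1) ∈ [.actual (0, 3) ((i₁ : ℚ≥0), 1), b] := by simp
  have hr : edgeExponent (0, 3) ((i₁ : ℚ≥0), 1) = i₁ / (2 : ℕ) := by
    simpa using edgeExponent_natCast (a := 0) (b := i₁) (j₁ := 3) (j₂ := 1)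
  obtain ⟨c₁, q₁, w₁, hw₁, hq₁⟩ := hbr _ hE (by simp)
  have hnodup : (edgeRoots (toPY 1 h) (0, 3) (i₁, 1)).Nodup → CanStop (toPY 1 h) := fun hn =>
    canStop_of_nodup hE fun P Q hPQ => by
      simp only [List.mem_cons, List.not_mem_nil, or_false] at hPQ
      rcases hPQ with hPQ | hPQ
      · obtain ⟨rfl, rfl⟩ := Edge.actual.inj hPQ
        exact hn
      · exact hbn _ _ hPQ
  by_cases hdvd : 2 ∣ i₁
  · obtain ⟨k, hk⟩ := hdvd
    have hrk := edgeExponent_eq_of_dvd two_ne_zero hk hr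
    have hq₁' : q₁ = 0 ∨ k < q₁ := by
      rw [hrk] at hq₁
      exact_mod_cast hq₁
    have hk0 : 0 < k := by
      have := edgeExponent_pos hE₁.lt hE₁.gt
      rw [hrk] at this
      exact_mod_cast this
    rcases multiset_card_two_cases (card_edgeRoots hE₁) with ⟨x, hx⟩ | ⟨x, y, hxy, hs⟩
    · right; right
      have cx : (edgeRoots (toPY 1 h) (0, 3) (i₁, 1)).count x = 2 := by
        rw [hx, Multiset.count_replicate_self]
      obtain ⟨g, hg⟩ := exists_isDoubleRootStep hE hmem (by norm_num) hrk cx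
        fun P' Q' c' hPQ' hc' => by
          simp only [List.mem_cons, List.not_mem_nil, or_false] at hPQ'
          rcases hPQ' with hPQ' | hPQ'
          · obtain ⟨rfl, rfl⟩ := Edge.actual.inj hPQ'
            rw [hx] at hc'
            exact Or.inr ⟨hrk, Multiset.eq_of_mem_replicate hc'⟩
          · exact Or.inl (Multiset.count_eq_one_of_mem (hbn _ _ hPQ') hc')
      exact ⟨⟨i₁, b, ⟨k, hk⟩, hb, hE, x, _, (isRoot_actual_iff hE₁).2 ⟨rfl, two_pos, cx⟩⟩,
        c₁, x, q₁, k, w₁, g, hw₁, hq₁', hg⟩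
    · right; left
      obtain ⟨cx, cy⟩ := count_eq_one_of_ne hxy
      rw [← hs] at cx cy
      obtain ⟨w₂, hw₂⟩ := exists_isSmoothRoot hE hmem hrk cx
      obtain ⟨w₃, hw₃⟩ := exists_isSmoothRoot hE hmem hrk cy
      refine ⟨⟨i₁, b, ⟨k, hk⟩, hb, hE, x, y, _, hxy, (isRoot_actual_iff hE₁).2 ⟨rfl, one_pos, cx⟩,
          (isRoot_actual_iff hE₁).2 ⟨rfl, one_pos, cy⟩⟩, hnodup ?_,
          x, y, c₁, k, q₁, w₂, w₃, w₁, hw₂, hw₃, hw₁, hxy, by omega⟩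
      rw [hs]
      simpa [Multiset.insert_eq_cons] using hxy
  · left
    refine ⟨⟨i₁, b, hdvd, hb, hE⟩, hnodup (hE₁.nodup_of_exponent rfl Nat.prime_two hr hdvd), ?_⟩
    obtain ⟨d, v, hv⟩ := exists_isRamifiedRoot hE hmem rfl Nat.prime_two hr hdvd
    exact ⟨c₁, q₁, w₁, d, i₁, v, hw₁, hv⟩

/-- The Newton polygons of height three that begin with an edge of height one. -/
theorem cases_height_one_first {h : ℂ[X][X]} {i₁ : ℕ} (hV : IsFirstVertex (toPY 1 h) (0, 3))
    (hQ : IsNextVertex (toPY 1 h) (0, 3) ((i₁ : ℚ≥0), 2))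
    (hsq : ∃ j < 2, ∃ i, (h.coeff j).coeff i ≠ 0) :
    (Case61 (toPY 1 h) ∧ CanStop (toPY 1 h) ∧
      ∃ c q w d i v, IsSmoothRoot h c q w ∧ IsRamifiedRoot 2 h d i v) ∨
    (Case621 (toPY 1 h) ∧ CanStop (toPY 1 h) ∧
      ∃ c₁ c₂ c₃ q q' w₁ w₂ w₃, IsSmoothRoot h c₁ q w₁ ∧ IsSmoothRoot h c₂ q w₂ ∧
        IsSmoothRoot h c₃ q' w₃ ∧ c₁ ≠ c₂ ∧ q ≠ q') ∨
    (Case622 (toPY 1 h) ∧ ∃ c₁ c₂ p₁ p₂ w g, IsSmoothRoot h c₁ p₁ w ∧ p₁ < p₂ ∧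
      IsDoubleRootStep h c₂ p₂ g) ∨
    (Case7 (toPY 1 h) ∧ CanStop (toPY 1 h) ∧
      ∃ c₁ c₂ c₃ q₁ q₂ q₃ w₁ w₂ w₃, IsSmoothRoot h c₁ q₁ w₁ ∧ IsSmoothRoot h c₂ q₂ w₂ ∧
        IsSmoothRoot h c₃ q₃ w₃ ∧ q₁ ≠ q₂ ∧ q₂ ≠ q₃ ∧ q₃ ≠ q₁) := by
  obtain ⟨-, hA₁, hE₁⟩ := hV.isAbove.next hV.1 hQ
  obtain ⟨j₀, hj₀, i₀, hi₀⟩ := hsq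
  rcases next_cases hA₁ with hall | ⟨i₂, j, hQ₂⟩
  · exact absurd (hall _ (mem_supp_toPY.2 hi₀)) (not_le.2 hj₀)
  obtain ⟨hlt, hA₂, hE₂⟩ := hA₁.next hQ.1 hQ₂
  have hj := hE₂.gt
  dsimp only at hj
  interval_cases j
  · -- two edges
    have hE : IsNewtonPolygon (toPY 1 h) [.actual (0, 3) (i₁, 2), .actual (i₁, 2) (i₂, 0)] :=
      ⟨_, hV, .edge _ _ _ hQ (.edge _ _ _ hQ₂ (.done _ rfl))⟩
    obtain ⟨c₁, q₁, w₁, hw₁, hq₁⟩ :=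
      exists_isSmoothRoot_of_height_one hE (P := (0, 3)) (Q := ((i₁ : ℚ≥0), 2)) (by simp) rfl
    have hmem : Edge.actual ((i₁ : ℚ≥0), 2) ((i₂ : ℚ≥0), 0) ∈
      [.actual (0, 3) ((i₁ : ℚ≥0), 2), .actual ((i₁ : ℚ≥0), 2) ((i₂ : ℚ≥0), 0)] := by simp
    have hr : edgeExponent ((i₁ : ℚ≥0), 2) ((i₂ : ℚ≥0), 0) = (i₂ - i₁ : ℕ) / (2 : ℕ) :=
      edgeExponent_natCast
    have hle : i₁ < i₂ := by
      have := hE₂.lt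
      dsimp only at this
      exact_mod_cast this
    have hnodup : (edgeRoots (toPY 1 h) (i₁, 2) (i₂, 0)).Nodup → CanStop (toPY 1 h) := fun hn =>
      canStop_of_nodup hE fun P Q hPQ => by
        simp only [List.mem_cons, List.not_mem_nil, or_false] at hPQ
        rcases hPQ with hPQ | hPQ
        · obtain ⟨rfl, rfl⟩ := Edge.actual.inj hPQ
          exact hE₁.nodup_of_height_one rfl
        · obtain ⟨rfl, rfl⟩ := Edge.actual.inj hPQ
          exact hn
    by_cases hdvd : 2 ∣ i₁ + i₂
    · obtain ⟨k, hk⟩ : 2 ∣ i₂ - i₁ := by omega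
      have hrk := edgeExponent_eq_of_dvd two_ne_zero hk hr
      have hq₁k : q₁ < k := by
        rw [hq₁, hrk] at hlt
        exact_mod_cast hlt
      rcases multiset_card_two_cases (card_edgeRoots hE₂) with ⟨x, hx⟩ | ⟨x, y, hxy, hs⟩
      · right; right; left
        have cx : (edgeRoots (toPY 1 h) (i₁, 2) (i₂, 0)).count x = 2 := by
          rw [hx, Multiset.count_replicate_self]
        obtain ⟨g, hg⟩ := exists_isDoubleRootStep hE hmem le_rfl hrk cx
          fun P' Q' c' hPQ' hc' => by
            simp only [List.mem_cons, List.not_mem_nil, or_false] at hPQ'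
            rcases hPQ' with hPQ' | hPQ'
            · obtain ⟨rfl, rfl⟩ := Edge.actual.inj hPQ'
              exact Or.inl (Multiset.count_eq_one_of_mem (hE₁.nodup_of_height_one rfl) hc')
            · obtain ⟨rfl, rfl⟩ := Edge.actual.inj hPQ'
              rw [hx] at hc'
              exact Or.inr ⟨hrk, Multiset.eq_of_mem_replicate hc'⟩
        exact ⟨⟨i₁, i₂, hdvd, hE, x, _, (isRoot_actual_iff hE₂).2 ⟨rfl, two_pos, cx⟩⟩,
          c₁, x, q₁, k, w₁, g, hw₁, hq₁k, hg⟩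
      · right; left
        obtain ⟨cx, cy⟩ := count_eq_one_of_ne hxy
        rw [← hs] at cx cy
        obtain ⟨w₂, hw₂⟩ := exists_isSmoothRoot hE hmem hrk cx
        obtain ⟨w₃, hw₃⟩ := exists_isSmoothRoot hE hmem hrk cy
        refine ⟨⟨i₁, i₂, hdvd, hE, x, y, _, hxy, (isRoot_actual_iff hE₂).2 ⟨rfl, one_pos, cx⟩,
            (isRoot_actual_iff hE₂).2 ⟨rfl, one_pos, cy⟩⟩, hnodup ?_,
            x, y, c₁, k, q₁, w₂, w₃, w₁, hw₂, hw₃, hw₁, hxy, hq₁k.ne'⟩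
        rw [hs]
        simpa [Multiset.insert_eq_cons] using hxy
    · left
      have hdvd' : ¬ 2 ∣ i₂ - i₁ := by omega
      refine ⟨⟨i₁, i₂, hdvd, hE⟩, hnodup (hE₂.nodup_of_exponent rfl Nat.prime_two hr hdvd'), ?_⟩
      obtain ⟨d, v, hv⟩ := exists_isRamifiedRoot hE hmem rfl Nat.prime_two hr hdvd'
      exact ⟨c₁, q₁, w₁, d, i₂ - i₁, v, hw₁, hv⟩
  · -- three edges
    right; right; right
    obtain ⟨b, hb, hPb, hbn, hbr⟩ := exists_last_edge hE₂.right_mem rfl hA₂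
    have hE : IsNewtonPolygon (toPY 1 h) [.actual (0, 3) (i₁, 2), .actual (i₁, 2) (i₂, 1), b] :=
      ⟨_, hV, .edge _ _ _ hQ (.edge _ _ _ hQ₂ hPb)⟩
    obtain ⟨c₁, q₁, w₁, hw₁, hq₁⟩ :=
      exists_isSmoothRoot_of_height_one hE (P := (0, 3)) (Q := ((i₁ : ℚ≥0), 2)) (by simp) rfl
    obtain ⟨c₂, q₂, w₂, hw₂, hq₂⟩ := exists_isSmoothRoot_of_height_one hE
      (P := ((i₁ : ℚ≥0), 2)) (Q := ((i₂ : ℚ≥0), 1)) (by simp) rfl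
    obtain ⟨c₃, q₃, w₃, hw₃, hq₃⟩ := hbr _ hE (by simp)
    have hq₁0 : 0 < q₁ := by
      have := edgeExponent_pos hE₁.lt hE₁.gt
      rw [hq₁] at this
      exact_mod_cast this
    have h12 : q₁ < q₂ := by
      rw [hq₁, hq₂] at hlt
      exact_mod_cast hlt
    have h23 : q₃ = 0 ∨ q₂ < q₃ := by
      rw [hq₂] at hq₃
      exact_mod_cast hq₃
    refine ⟨⟨i₁, i₂, b, hb, hE⟩, canStop_of_nodup hE fun P Q hPQ => ?_,
      c₁, c₂, c₃, q₁, q₂, q₃, w₁, w₂, w₃, hw₁, hw₂, hw₃, by omega, by omega, by omega⟩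
    simp only [List.mem_cons, List.not_mem_nil, or_false] at hPQ
    rcases hPQ with hPQ | hPQ | hPQ
    · obtain ⟨rfl, rfl⟩ := Edge.actual.inj hPQ
      exact hE₁.nodup_of_height_one rfl
    · obtain ⟨rfl, rfl⟩ := Edge.actual.inj hPQ
      exact hE₂.nodup_of_height_one rfl
    · exact hbn _ _ hPQ

theorem Case421.not_other {h : PYPoly} (h1 : Case421 h) :
    ¬ Case521 h ∧ ¬ Case621 h ∧ ¬ Case7 h := by
  obtain ⟨i, -, hE, -⟩ := h1
  exact ⟨fun ⟨_, _, _, _, hE', _⟩ => absurd (hE.unique hE') (by simp),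
    fun ⟨_, _, _, hE', _⟩ => absurd (hE.unique hE') (by simp),
    fun ⟨_, _, _, _, hE'⟩ => absurd (hE.unique hE') (by simp)⟩

theorem Case7.not_other {h : PYPoly} (h1 : Case7 h) : ¬ Case521 h ∧ ¬ Case621 h := by
  obtain ⟨_, _, _, -, hE⟩ := h1
  exact ⟨fun ⟨_, _, _, _, hE', _⟩ => absurd (hE.unique hE') (by simp),
    fun ⟨_, _, _, hE', _⟩ => absurd (hE.unique hE') (by simp)⟩

theorem Case522.not_other {h : PYPoly} (h1 : Case522 h) : ¬ Case422 h ∧ ¬ Case622 h := by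
  obtain ⟨_, b, -, hb, hE, -⟩ := h1
  exact ⟨fun ⟨_, _, hE', _⟩ => absurd (hE.unique hE') (by simp),
    fun ⟨_, _, _, hE', _⟩ => absurd (hE.unique hE') (by simp)⟩

theorem Case422.not_case622 {h : PYPoly} (h1 : Case422 h) : ¬ Case622 h := by
  obtain ⟨_, -, hE, -⟩ := h1
  exact fun ⟨_, _, _, hE', _⟩ => absurd (hE.unique hE') (by simp)

/-- The possible Newton polygons of height three. -/
theorem cases_height_three {h : ℂ[X][X]} (hV : IsFirstVertex (toPY 1 h) (0, 3))
    (hsq : ∃ j < 2, ∃ i, (h.coeff j).coeff i ≠ 0) :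
    (∃ b k g, Case423 (toPY 1 h) ∧ IsOnlyStep 3 h b k g) ∨
    (Case41 (toPY 1 h) ∧ CanStop (toPY 1 h) ∧ ∃ c i w, IsRamifiedRoot 3 h c i w) ∨
    ((Case421 (toPY 1 h) ∨ Case521 (toPY 1 h) ∨ Case621 (toPY 1 h) ∨ Case7 (toPY 1 h)) ∧
      CanStop (toPY 1 h) ∧ ∃ (c : Fin 3 → ℂ) (q : Fin 3 → ℕ) (w : Fin 3 → PowerSeries ℂ),
        (∀ j, IsSmoothRoot h (c j) (q j) (w j)) ∧ (∀ i j, c i = c j → q i = q j → i = j) ∧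
        (Case421 (toPY 1 h) → q 0 = q 1 ∧ q 1 = q 2) ∧
        (Case521 (toPY 1 h) ∨ Case621 (toPY 1 h) → q 0 = q 1)) ∨
    ((Case51 (toPY 1 h) ∨ Case61 (toPY 1 h)) ∧ CanStop (toPY 1 h) ∧
      ∃ c q w d i v, IsSmoothRoot h c q w ∧ IsRamifiedRoot 2 h d i v) ∨
    ((Case422 (toPY 1 h) ∨ Case522 (toPY 1 h) ∨ Case622 (toPY 1 h)) ∧
      ∃ c₁ c₂ p₁ p₂ w g, IsSmoothRoot h c₁ p₁ w ∧ IsDoubleRootStep h c₂ p₂ g ∧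
        ¬ (c₁ = c₂ ∧ p₁ = p₂) ∧ (Case422 (toPY 1 h) → p₁ = p₂ ∧ c₁ ≠ c₂) ∧
        (Case522 (toPY 1 h) → p₁ = 0 ∨ p₂ < p₁) ∧ (Case622 (toPY 1 h) → p₁ < p₂)) := by
  have hcons : ∀ {c₁ c₂ c₃ : ℂ} {q₁ q₂ q₃ : ℕ}, ¬ (c₁ = c₂ ∧ q₁ = q₂) → ¬ (c₂ = c₃ ∧ q₂ = q₃) →
      ¬ (c₁ = c₃ ∧ q₁ = q₃) →
      ∀ i j, ![c₁, c₂, c₃] i = ![c₁, c₂, c₃] j → ![q₁, q₂, q₃] i = ![q₁, q₂, q₃] j → i = j := by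
    intro c₁ c₂ c₃ q₁ q₂ q₃ h12 h23 h13 i j hc hq
    fin_cases i <;> fin_cases j <;> simp_all
  obtain ⟨j₀, hj₀, i₀, hi₀⟩ := hsq
  rcases next_cases hV.isAbove with hall | ⟨i₁, j, hQ⟩
  · exact absurd (hall _ (mem_supp_toPY.2 hi₀)) (by simp only [not_le]; omega)
  have hj := hQ.2.2.1
  dsimp only at hj
  interval_cases j
  · rcases cases_one_edge ⟨_, hV, .edge _ _ _ hQ (.done _ rfl)⟩ with
      h1 | h1 | ⟨h1, h2, c₁, c₂, c₃, q, w₁, w₂, w₃, hw₁, hw₂, hw₃, h12, h23, h31⟩ |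
      ⟨h1, c₁, c₂, p, w, g, hw, hne, hg⟩
    · exact Or.inl h1
    · exact Or.inr (Or.inl h1)
    · refine Or.inr (Or.inr (Or.inl ⟨Or.inl h1, h2, ![c₁, c₂, c₃], ![q, q, q], ![w₁, w₂, w₃], ?_,
        hcons (fun h => h12 h.1) (fun h => h23 h.1) (fun h => h31 h.1.symm), fun _ => ⟨rfl, rfl⟩,
        fun _ => rfl⟩))
      intro j
      fin_cases j <;> assumption
    · exact Or.inr (Or.inr (Or.inr (Or.inr ⟨Or.inl h1, c₁, c₂, p, p, w, g, hw, hg,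
        fun h => hne h.1, fun _ => ⟨rfl, hne⟩, fun h => absurd h1 h.not_other.1,
        fun h => absurd h h1.not_case622⟩)))
  · rcases cases_height_two_first hV hQ with
      ⟨h1, h2⟩ | ⟨h1, h2, c₁, c₂, c₃, q, q', w₁, w₂, w₃, hw₁, hw₂, hw₃, h12, hq⟩ |
      ⟨h1, c₁, c₂, p₁, p₂, w, g, hw, hp, hg⟩
    · exact Or.inr (Or.inr (Or.inr (Or.inl ⟨Or.inl h1, h2⟩)))
    · refine Or.inr (Or.inr (Or.inl ⟨Or.inr (Or.inl h1), h2, ![c₁, c₂, c₃], ![q, q, q'],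
        ![w₁, w₂, w₃], ?_, hcons (fun h => h12 h.1) (fun h => hq h.2) (fun h => hq h.2),
        fun h => absurd h1 h.not_other.1, fun _ => rfl⟩))
      intro j
      fin_cases j <;> assumption
    · have := hg.pos
      exact Or.inr (Or.inr (Or.inr (Or.inr ⟨Or.inr (Or.inl h1), c₁, c₂, p₁, p₂, w, g, hw, hg,
        fun h => by omega, fun h => absurd h h1.not_other.1, fun _ => hp,
        fun h => absurd h h1.not_other.2⟩)))
  · rcases cases_height_one_first hV hQ ⟨j₀, hj₀, i₀, hi₀⟩ with
      ⟨h1, h2⟩ | ⟨h1, h2, c₁, c₂, c₃, q, q', w₁, w₂, w₃, hw₁, hw₂, hw₃, h12, hq⟩ |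
      ⟨h1, c₁, c₂, p₁, p₂, w, g, hw, hp, hg⟩ |
      ⟨h1, h2, c₁, c₂, c₃, q₁, q₂, q₃, w₁, w₂, w₃, hw₁, hw₂, hw₃, h12, h23, h31⟩
    · exact Or.inr (Or.inr (Or.inr (Or.inl ⟨Or.inr h1, h2⟩)))
    · refine Or.inr (Or.inr (Or.inl ⟨Or.inr (Or.inr (Or.inl h1)), h2, ![c₁, c₂, c₃], ![q, q, q'],
        ![w₁, w₂, w₃], ?_, hcons (fun h => h12 h.1) (fun h => hq h.2) (fun h => hq h.2),
        fun h => absurd h1 h.not_other.2.1, fun _ => rfl⟩))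
      intro j
      fin_cases j <;> assumption
    · exact Or.inr (Or.inr (Or.inr (Or.inr ⟨Or.inr (Or.inr h1), c₁, c₂, p₁, p₂, w, g, hw, hg,
        fun h => by omega, fun h => absurd h1 h.not_case622, fun h => absurd h1 h.not_other.2,
        fun _ => hp⟩)))
    · refine Or.inr (Or.inr (Or.inl ⟨Or.inr (Or.inr (Or.inr h1)), h2, ![c₁, c₂, c₃], ![q₁, q₂, q₃],
        ![w₁, w₂, w₃], ?_, hcons (fun h => h12 h.2) (fun h => h23 h.2) (fun h => h31 h.2.symm),
        fun h => absurd h1 h.not_other.2.2,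
        fun h => h.elim (fun h => absurd h h1.not_other.1) fun h => absurd h h1.not_other.2⟩))
      intro j
      fin_cases j <;> assumption

/-! ### The series `c T^s + …` -/

theorem tail_add (c : ℂ) (K q : ℕ) (w : PowerSeries ℂ) :
    tail c (K + q) w = PowerSeries.X ^ K * tail c q w := by
  simp only [tail]
  ring

theorem coeff_tail_self (c : ℂ) (s : ℕ) (w : PowerSeries ℂ) : PowerSeries.coeff s (tail c s w) = c := by
  rw [tail, map_add, PowerSeries.coeff_C_mul, PowerSeries.coeff_X_pow_self, mul_one,
    PowerSeries.coeff_X_pow_mul', if_neg (by omega), add_zero]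

theorem coeff_tail_of_lt (c : ℂ) {e s : ℕ} (h : e < s) (w : PowerSeries ℂ) :
    PowerSeries.coeff e (tail c s w) = 0 := by
  rw [tail, map_add, PowerSeries.coeff_C_mul, PowerSeries.coeff_X_pow, if_neg h.ne, mul_zero,
    PowerSeries.coeff_X_pow_mul', if_neg (by omega), add_zero]

theorem coeff_aeval_X_pow_of_not_dvd {N e : ℕ} (h : ¬ N ∣ e) (D : ℂ[X]) :
    PowerSeries.coeff e (Polynomial.aeval (PowerSeries.X ^ N : PowerSeries ℂ) D) = 0 := by
  induction D using Polynomial.induction_on' with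
  | add p q hp hq => rw [map_add, map_add, hp, hq, add_zero]
  | monomial k a =>
    rw [aeval_monomial, PowerSeries.algebraMap_apply, ← pow_mul, PowerSeries.coeff_C_mul,
      PowerSeries.coeff_X_pow, if_neg, mul_zero]
    rintro rfl
    exact h (dvd_mul_right N k)

theorem stepPoly_coeff_zero {H n : ℕ} {b : ℕ → ℂ} {k : ℕ → ℕ} (hk : ∀ i < n, 0 < k i) :
    (stepPoly H n b k).coeff 0 = 0 := by
  rw [stepPoly, finsetSum_coeff]
  refine Finset.sum_eq_zero fun i hi => ?_
  have := hk i (Finset.mem_range.1 hi)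
  have h1 : expSum k (i + 1) = expSum k i + k i := Finset.sum_range_succ _ _
  rw [coeff_C_mul, coeff_X_pow, if_neg (by omega), mul_zero]

/-- The leading term of a series is determined by the series, where the zero series is represented by
`c = 0`, `q = 0`, `w = 0`. -/
theorem eq_of_tail_eq {c c' : ℂ} {q q' : ℕ} {w w' : PowerSeries ℂ}
    (hc : c = 0 ↔ q = 0) (hw : q = 0 → w = 0) (hc' : c' = 0 ↔ q' = 0) (hw' : q' = 0 → w' = 0)
    (he : tail c q w = tail c' q' w') : c = c' ∧ q = q' := by
  have key : ∀ {c c' : ℂ} {q q' : ℕ} {w w' : PowerSeries ℂ}, (c = 0 ↔ q = 0) → (q = 0 → w = 0) →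
      (c' = 0 ↔ q' = 0) → tail c q w = tail c' q' w' → ¬ q < q' := by
    intro c c' q q' w w' hc hw hc' he hlt
    rcases Nat.eq_zero_or_pos q with h0 | h0
    · have := congrArg (PowerSeries.coeff q') he
      rw [hw h0, hc.2 h0, coeff_tail_self] at this
      simp only [tail, map_zero, zero_mul, mul_zero, add_zero] at this
      have := hc'.1 this.symm
      omega
    · have := congrArg (PowerSeries.coeff q) he
      rw [coeff_tail_self, coeff_tail_of_lt _ hlt] at this
      have := hc.1 this
      omega
  obtain rfl : q = q' := le_antisymm (not_lt.1 (key hc' hw' hc he.symm)) (not_lt.1 (key hc hw hc' he))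
  refine ⟨?_, rfl⟩
  have := congrArg (PowerSeries.coeff q) he
  rwa [coeff_tail_self, coeff_tail_self] at this

/-! ### From roots of a transform to roots of the curve -/

theorem evalS_X_pow_one (q : PowerSeries ℂ) (f : ℂ[X][X]) :
    evalS (PowerSeries.X ^ 1) q f = evalS PowerSeries.X q f := by
  rw [pow_one]

/-- A simple root `c x^q` for a transform gives a root of the curve in the variable `x`. -/
theorem IsTransform.smooth {f : ℂ[X][X]} {D : ℂ[X]} {K : ℕ} {G : ℂ[X][X]} (h : IsTransform f D K G)
    (hD : D.coeff 0 = 0) {c : ℂ} {q : ℕ} {w : PowerSeries ℂ} (hw : IsSmoothRoot G c q w) :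
    PowerSeries.constantCoeff
      (Polynomial.aeval (PowerSeries.X ^ 1 : PowerSeries ℂ) D + tail c (K + q) w) = 0 ∧
    evalS PowerSeries.X
      (Polynomial.aeval (PowerSeries.X ^ 1 : PowerSeries ℂ) D + tail c (K + q) w) f = 0 := by
  obtain ⟨-, hc, -, hr⟩ := hw
  constructor
  · rw [map_add, constantCoeff_aeval (by simp), hD, zero_add, tail_add, map_mul, mul_eq_zero]
    right
    rw [← PowerSeries.coeff_zero_eq_constantCoeff_apply]
    rcases Nat.eq_zero_or_pos q with rfl | h0
    · rw [coeff_tail_self, hc.2 rfl]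
    · exact coeff_tail_of_lt c h0 w
  · rw [tail_add, ← evalS_X_pow_one]
    rw [← evalS_X_pow_one] at hr
    have := h.evalS_eq_zero hr
    rwa [pow_one] at this ⊢

/-- A simple root `c x^(i/N)` for a transform, with `N` not dividing `i`, gives a root of the curve
in the variable `x^(1/N)`. -/
theorem IsTransform.ramified {f : ℂ[X][X]} {D : ℂ[X]} {K : ℕ} {G : ℂ[X][X]}
    (h : IsTransform f D K G) (hD : D.coeff 0 = 0) {N : ℕ} (hN : 0 < N) {c : ℂ} {i : ℕ}
    {w : PowerSeries ℂ} (hw : IsRamifiedRoot N G c i w) :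
    PowerSeries.constantCoeff
      (Polynomial.aeval (PowerSeries.X ^ N : PowerSeries ℂ) D + tail c (N * K + i) w) = 0 ∧
    evalS (PowerSeries.X ^ N)
      (Polynomial.aeval (PowerSeries.X ^ N : PowerSeries ℂ) D + tail c (N * K + i) w) f = 0 ∧
    ¬ N ∣ N * K + i ∧ PowerSeries.coeff (N * K + i)
      (Polynomial.aeval (PowerSeries.X ^ N : PowerSeries ℂ) D + tail c (N * K + i) w) ≠ 0 := by
  obtain ⟨-, hc, hi, hNi, hr⟩ := hw
  have hdvd : ¬ N ∣ N * K + i := by rwa [Nat.dvd_add_right (dvd_mul_right N K)]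
  refine ⟨?_, ?_, hdvd, ?_⟩
  · rw [map_add, constantCoeff_aeval (by simp [hN.ne']), hD, zero_add,
      ← PowerSeries.coeff_zero_eq_constantCoeff_apply]
    exact coeff_tail_of_lt c (by omega) w
  · rw [tail_add, pow_mul]
    exact h.evalS_eq_zero hr
  · rwa [map_add, coeff_aeval_X_pow_of_not_dvd hdvd, zero_add, coeff_tail_self]

/-- The terms of the second chain of steps and the last simple root do not change the leading term
of the double root. -/
theorem exists_stepSum_add_tail_eq {H m : ℕ} {d : ℕ → ℂ} {l : ℕ → ℕ} (hl : ∀ i < m, 0 < l i)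
    {h : ℂ[X][X]} {c : ℂ} {q : ℕ} {w : PowerSeries ℂ} (hw : IsSmoothRoot h c q w) :
    ∃ v, stepSum 1 H m d l + tail c (H + expSum l m + q) w = PowerSeries.X ^ (H + 1) * v := by
  refine (dvd_add (Finset.dvd_sum fun i hi => Dvd.dvd.mul_left (pow_dvd_pow _ ?_) _) ?_ :
    PowerSeries.X ^ (H + 1) ∣ stepSum 1 H m d l + tail c (H + expSum l m + q) w)
  · have := hl i (Finset.mem_range.1 hi)
    have h1 : expSum l (i + 1) = expSum l i + l i := Finset.sum_range_succ _ _
    omega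
  -- for `q = 0` the last root is zero; only then could its exponent fail to exceed `H`
  · obtain ⟨-, hc, hw0, -⟩ := hw
    rcases Nat.eq_zero_or_pos q with rfl | h0
    · rw [hw0 rfl, hc.2 rfl]
      simp [tail]
    · exact dvd_add (Dvd.dvd.mul_left (pow_dvd_pow _ (by omega)) _)
        (Dvd.dvd.mul_right (pow_dvd_pow _ (by omega)) _)

/-! ### The branches -/

theorem IsOnlyStep.spec {d : ℕ} {h g : ℂ[X][X]} {b : ℂ} {k : ℕ} (hs : IsOnlyStep d h b k g) :
    b ≠ 0 ∧ 0 < k ∧ ∀ c r g', StarStep (toPY 1 h) c r g' ↔ (c = b ∧ r = k ∧ g' = toPY 1 g) :=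
  ⟨hs.1, hs.2.1, hs.2.2.1⟩

/-- Distinct simple roots of one polynomial are the beginnings of distinct series. -/
theorem injective_of_tail {S : PowerSeries ℂ} {K : ℕ} {h : ℂ[X][X]} {c : Fin 3 → ℂ} {q : Fin 3 → ℕ}
    {w : Fin 3 → PowerSeries ℂ} (hw : ∀ j, IsSmoothRoot h (c j) (q j) (w j))
    (hne : ∀ i j, c i = c j → q i = q j → i = j) :
    Function.Injective fun j => S + tail (c j) (K + q j) (w j) := by
  intro i j hij
  simp only [tail_add] at hij
  have h1 := mul_left_cancel₀ (pow_ne_zero _ PowerSeries.X_ne_zero) (add_left_cancel hij)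
  obtain ⟨h2, h3⟩ := eq_of_tail_eq (hw i).2.1 (hw i).2.2.1 (hw j).2.1 (hw j).2.2.1 h1
  exact hne i j h2 h3

/-- The series of the simple root `c₁ x^p₁` differs from every series that begins with the double
root `c₂ x^p₂`. -/
theorem ne_of_double_root {S : PowerSeries ℂ} {K : ℕ} {F G : ℂ[X][X]} {c₁ c₂ : ℂ} {p₁ p₂ : ℕ}
    {w₁ : PowerSeries ℂ} (h₁ : IsSmoothRoot F c₁ p₁ w₁) (hc₂ : c₂ ≠ 0) (hp₂ : 0 < p₂)
    (hne : ¬ (c₁ = c₂ ∧ p₁ = p₂)) {m : ℕ} {d : ℕ → ℂ} {l : ℕ → ℕ} (hl : ∀ i < m, 0 < l i)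
    {c : ℂ} {q : ℕ} {w : PowerSeries ℂ} (hw : IsSmoothRoot G c q w) :
    S + tail c₁ (K + p₁) w₁ ≠ S + PowerSeries.C c₂ * PowerSeries.X ^ (K + p₂) +
      stepSum 1 (K + p₂) m d l + tail c (K + p₂ + expSum l m + q) w := by
  obtain ⟨v, hv⟩ := exists_stepSum_add_tail_eq (H := K + p₂) (d := d) hl hw
  intro he
  have h2 : tail c₁ (K + p₁) w₁ = tail c₂ (K + p₂) v := by
    rw [add_assoc _ (stepSum _ _ _ _ _), hv, add_assoc] at he
    exact add_left_cancel he
  rw [tail_add, tail_add] at h2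
  exact hne (eq_of_tail_eq h₁.2.1 h₁.2.2.1 (iff_of_false hc₂ hp₂.ne') (fun h => absurd h hp₂.ne')
    (mul_left_cancel₀ (pow_ne_zero _ PowerSeries.X_ne_zero) h2))

end NewtonPuiseux

end

open NewtonPuiseux

theorem theorem4p3 (f : MvPolynomial (Fin 2) ℂ) (hred : Squarefree f)
    (hlow : ∀ i < 3, MvPolynomial.homogeneousComponent i f = 0)
    (hcone : MvPolynomial.homogeneousComponent 3 f = MvPolynomial.X 1 ^ 3) :
    -- the `n` triple root steps: roots `b i * x ^ k i`, polynomials `F 0 = f, …, F n`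
    ∃ (n : ℕ) (b : ℕ → ℂ) (k : ℕ → ℕ) (F : ℕ → NewtonPuiseux.PYPoly),
      F 0 = NewtonPuiseux.toPuiseux f ∧
      (∀ i ≤ n, ¬ NewtonPuiseux.StopCriterion (F i)) ∧
      (∀ i < n, NewtonPuiseux.Case423 (F i) ∧ b i ≠ 0 ∧ 0 < k i ∧
        ∀ c r g, NewtonPuiseux.StarStep (F i) c r g ↔ (c = b i ∧ r = k i ∧ g = F (i + 1))) ∧
      -- one 3-branch
      ((NewtonPuiseux.Case41 (F n) ∧ NewtonPuiseux.CanStop (F n) ∧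
        ∃ (c : ℂ) (i₁ s : ℕ) (w : PowerSeries ℂ),
          NewtonPuiseux.IsRootOf (F n) c (i₁ / 3) 1 ∧ c ≠ 0 ∧
          s = 3 * NewtonPuiseux.expSum k n + i₁ ∧ 0 < i₁ ∧ ¬ s ≡ 0 [MOD 3] ∧
          NewtonPuiseux.BranchesAt f
            ![(PowerSeries.X ^ 3,
                NewtonPuiseux.stepSum 3 0 n b k + NewtonPuiseux.tail c s w)] ![3]) ∨
      -- three 1-branches
      ((NewtonPuiseux.Case421 (F n) ∨ NewtonPuiseux.Case521 (F n) ∨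
          NewtonPuiseux.Case621 (F n) ∨ NewtonPuiseux.Case7 (F n)) ∧
        NewtonPuiseux.CanStop (F n) ∧
        ∃ (c : Fin 3 → ℂ) (q : Fin 3 → ℕ) (w : Fin 3 → PowerSeries ℂ),
          (∀ j, NewtonPuiseux.IsRootOf (F n) (c j) (q j) 1) ∧
          (∀ i j, c i = c j → q i = q j → i = j) ∧
          (∀ j, (c j = 0 ↔ q j = 0) ∧ (q j = 0 → w j = 0)) ∧
          (NewtonPuiseux.Case421 (F n) → q 0 = q 1 ∧ q 1 = q 2) ∧
          (NewtonPuiseux.Case521 (F n) ∨ NewtonPuiseux.Case621 (F n) → q 0 = q 1) ∧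
          NewtonPuiseux.BranchesAt f
            (fun j => (PowerSeries.X, NewtonPuiseux.stepSum 1 0 n b k +
              NewtonPuiseux.tail (c j) (NewtonPuiseux.expSum k n + q j) (w j)))
            ![1, 1, 1]) ∨
      -- one 1-branch and one 2-branch
      ((NewtonPuiseux.Case51 (F n) ∨ NewtonPuiseux.Case61 (F n)) ∧
        NewtonPuiseux.CanStop (F n) ∧
        ∃ (c d : ℂ) (q i₁ h : ℕ) (w v : PowerSeries ℂ),
          NewtonPuiseux.IsRootOf (F n) c q 1 ∧ (c = 0 ↔ q = 0) ∧ (q = 0 → w = 0) ∧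
          NewtonPuiseux.IsRootOf (F n) d (i₁ / 2) 1 ∧ d ≠ 0 ∧ 0 < i₁ ∧
          2 * NewtonPuiseux.expSum k n + i₁ = 2 * h + 1 ∧
          NewtonPuiseux.BranchesAt f
            ![(PowerSeries.X, NewtonPuiseux.stepSum 1 0 n b k +
                NewtonPuiseux.tail c (NewtonPuiseux.expSum k n + q) w),
              (PowerSeries.X ^ 2, NewtonPuiseux.stepSum 2 0 n b k +
                NewtonPuiseux.tail d (2 * h + 1) v)] ![1, 2]) ∨
      -- a double root
      ((NewtonPuiseux.Case422 (F n) ∨ NewtonPuiseux.Case522 (F n) ∨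
          NewtonPuiseux.Case622 (F n)) ∧
        -- the simple root `c₁ x ^ p₁`, the double root `c₂ x ^ p₂`, and then `m` double root
        -- steps: roots `d i * x ^ l i`, polynomials `G 0, …, G m`
        ∃ (c₁ c₂ : ℂ) (p₁ p₂ m : ℕ) (d : ℕ → ℂ) (l : ℕ → ℕ) (G : ℕ → NewtonPuiseux.PYPoly)
          (w : PowerSeries ℂ),
          NewtonPuiseux.IsRootOf (F n) c₁ p₁ 1 ∧ (c₁ = 0 ↔ p₁ = 0) ∧ (p₁ = 0 → w = 0) ∧
          NewtonPuiseux.IsRootOf (F n) c₂ p₂ 2 ∧ c₂ ≠ 0 ∧ 0 < p₂ ∧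
          (NewtonPuiseux.Case422 (F n) → p₁ = p₂ ∧ c₁ ≠ c₂) ∧
          (NewtonPuiseux.Case522 (F n) → p₁ = 0 ∨ p₂ < p₁) ∧
          (NewtonPuiseux.Case622 (F n) → p₁ < p₂) ∧
          (∀ c r g, NewtonPuiseux.StarStep (F n) c r g →
            NewtonPuiseux.StopCriterion g ∨ (c = c₂ ∧ r = p₂ ∧ g = G 0)) ∧
          NewtonPuiseux.StarStep (F n) c₂ p₂ (G 0) ∧
          (∀ i ≤ m, ¬ NewtonPuiseux.StopCriterion (G i)) ∧
          (∀ i < m, NewtonPuiseux.Case222 (G i) ∧ d i ≠ 0 ∧ 0 < l i ∧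
            ∀ c r g, NewtonPuiseux.StarStep (G i) c r g ↔
              (c = d i ∧ r = l i ∧ g = G (i + 1))) ∧
          NewtonPuiseux.CanStop (G m) ∧
          ((NewtonPuiseux.Case21 (G m) ∧
            ∃ (a : ℂ) (i₁ h : ℕ) (v : PowerSeries ℂ),
              NewtonPuiseux.IsRootOf (G m) a (i₁ / 2) 1 ∧ a ≠ 0 ∧ 0 < i₁ ∧
              2 * (NewtonPuiseux.expSum k n + p₂ + NewtonPuiseux.expSum l m) + i₁ = 2 * h + 1 ∧
              NewtonPuiseux.BranchesAt f
                ![(PowerSeries.X, NewtonPuiseux.stepSum 1 0 n b k +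
                    NewtonPuiseux.tail c₁ (NewtonPuiseux.expSum k n + p₁) w),
                  (PowerSeries.X ^ 2, NewtonPuiseux.stepSum 2 0 n b k +
                    PowerSeries.C c₂ * PowerSeries.X ^ (2 * (NewtonPuiseux.expSum k n + p₂)) +
                    NewtonPuiseux.stepSum 2 (NewtonPuiseux.expSum k n + p₂) m d l +
                    NewtonPuiseux.tail a (2 * h + 1) v)] ![1, 2]) ∨
           ((NewtonPuiseux.Case221 (G m) ∨ NewtonPuiseux.Case3 (G m)) ∧
            ∃ (e₁ g₁ : ℂ) (q₁ q₂ : ℕ) (v₁ v₂ : PowerSeries ℂ),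
              NewtonPuiseux.IsRootOf (G m) e₁ q₁ 1 ∧ NewtonPuiseux.IsRootOf (G m) g₁ q₂ 1 ∧
              ¬ (e₁ = g₁ ∧ q₁ = q₂) ∧
              (e₁ = 0 ↔ q₁ = 0) ∧ (q₁ = 0 → v₁ = 0) ∧
              (g₁ = 0 ↔ q₂ = 0) ∧ (q₂ = 0 → v₂ = 0) ∧
              (NewtonPuiseux.Case221 (G m) → q₁ = q₂) ∧
              NewtonPuiseux.BranchesAt f
                ![(PowerSeries.X, NewtonPuiseux.stepSum 1 0 n b k +
                    NewtonPuiseux.tail c₁ (NewtonPuiseux.expSum k n + p₁) w),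
                  (PowerSeries.X, NewtonPuiseux.stepSum 1 0 n b k +
                    PowerSeries.C c₂ * PowerSeries.X ^ (NewtonPuiseux.expSum k n + p₂) +
                    NewtonPuiseux.stepSum 1 (NewtonPuiseux.expSum k n + p₂) m d l +
                    NewtonPuiseux.tail e₁
                      (NewtonPuiseux.expSum k n + p₂ + NewtonPuiseux.expSum l m + q₁) v₁),
                  (PowerSeries.X, NewtonPuiseux.stepSum 1 0 n b k +
                    PowerSeries.C c₂ * PowerSeries.X ^ (NewtonPuiseux.expSum k n + p₂) +
                    NewtonPuiseux.stepSum 1 (NewtonPuiseux.expSum k n + p₂) m d l +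
                    NewtonPuiseux.tail g₁
                      (NewtonPuiseux.expSum k n + p₂ + NewtonPuiseux.expSum l m + q₂) v₂)]
                ![1, 1, 1])))) := by
  have hf := hasTripleTangent_of_homogeneousComponent hlow hcone
  have h3 := toBi_coeff_three hf
  obtain ⟨A, B, δ, hδ0, hδ⟩ := exists_discriminant (squarefree_toBi hred)
  obtain ⟨n, b, k, F, hF0, hF, hFV, hFT, hFn⟩ := exists_chain hδ0 hδ 3 Case423
    (isTransform_refl (toBi f)) (isFirstVertex_toPY_iff.2 ⟨fun i hi => toBi_coeff_of_lt hf hi, h3⟩)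
  rw [zero_add, zero_add] at hFT
  have hD0 : (stepPoly 0 n b k).coeff 0 = 0 := stepPoly_coeff_zero fun i hi => (hF i hi).2.spec.2.1
  refine ⟨n, b, k, fun i => toPY 1 (F i), (congrArg (toPY 1) hF0).trans (toPuiseux_eq f).symm,
    fun i hi => not_stopCriterion (by norm_num) (hFV i hi),
    fun i hi => ⟨(hF i hi).1, (hF i hi).2.spec⟩, ?_⟩
  rcases cases_height_three (hFV n le_rfl) (hFT.exists_ne_zero hδ0 hδ) with
    h1 | ⟨h1, h2, c, i, w, hw⟩ | ⟨h1, h2, c, q, w, hw, hne, h421, h521⟩ |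
    ⟨h1, h2, c, q, w, d, i, v, hw, hv⟩ |
    ⟨h1, c₁, c₂, p₁, p₂, w, g, hw, hg, hne, h422, h522, h622⟩
  · exact absurd h1 hFn
  · -- one ramified branch of order three
    left
    obtain ⟨hY0, hYr, hdvd, hYe⟩ := hFT.ramified hD0 three_pos hw
    rw [aeval_stepPoly] at hY0 hYr hYe
    refine ⟨h1, h2, c, i, _, w, by simpa using hw.1, hw.2.1, rfl, hw.2.2.1, fun h0 => hdvd ?_,
      branchesAt_triple hf h3 hY0 hYr hdvd hYe⟩
    exact (Nat.modEq_zero_iff_dvd).1 h0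
  · -- three smooth branches
    right; left
    have hY := fun j => hFT.smooth hD0 (hw j)
    simp only [aeval_stepPoly] at hY
    exact ⟨h1, h2, c, q, w, fun j => (hw j).1, hne, fun j => ⟨(hw j).2.1, (hw j).2.2.1⟩, h421, h521,
      branchesAt_three_smooth hf h3 (injective_of_tail hw hne) (fun j => (hY j).1)
        fun j => (hY j).2⟩
  · -- a smooth and a ramified branch
    right; right; left
    obtain ⟨hS0, hSr⟩ := hFT.smooth hD0 hw
    obtain ⟨hY0, hYr, hdvd, hYe⟩ := hFT.ramified hD0 two_pos hv
    rw [aeval_stepPoly] at hS0 hSr hY0 hYr hYe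
    obtain ⟨s, hs⟩ : ∃ s, 2 * expSum k n + i = 2 * s + 1 :=
      ⟨(2 * expSum k n + i) / 2, by omega⟩
    rw [hs] at hdvd hY0 hYr hYe
    exact ⟨h1, h2, c, d, q, i, s, w, v, hw.1, hw.2.1, hw.2.2.1, by simpa using hv.1, hv.2.1, hv.2.2.1,
      hs, branchesAt_smooth_and_cusp hf h3 hS0 hY0 hSr hYr hdvd hYe⟩
  · -- a double root
    right; right; right
    obtain ⟨V, hV⟩ := hg.comp_eq
    obtain ⟨m, d, l, G, hG0, hG, hGV, hGT, hGm⟩ := exists_chain hδ0 hδ 2 Case222 (hFT.trans hV)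
      hg.isFirstVertex
    subst hG0
    have hl : ∀ i < m, 0 < l i := fun i hi => (hG i hi).2.spec.2.1
    have hD20 : (stepPoly 0 n b k + C c₂ * X ^ (expSum k n + p₂) +
        stepPoly (expSum k n + p₂) m d l).coeff 0 = 0 := by
      have := hg.pos
      rw [coeff_add, coeff_add, hD0, stepPoly_coeff_zero hl, coeff_C_mul, coeff_X_pow,
        if_neg (by omega)]
      simp
    have hae : ∀ N, Polynomial.aeval (PowerSeries.X ^ N : PowerSeries ℂ) (stepPoly 0 n b k +
        C c₂ * X ^ (expSum k n + p₂) + stepPoly (expSum k n + p₂) m d l) =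
        stepSum N 0 n b k + PowerSeries.C c₂ * PowerSeries.X ^ (N * (expSum k n + p₂)) +
          stepSum N (expSum k n + p₂) m d l := fun N => by
      rw [map_add, map_add, aeval_stepPoly, aeval_stepPoly, map_mul, aeval_C, map_pow, aeval_X,
        ← pow_mul, PowerSeries.algebraMap_apply, Algebra.algebraMap_self, RingHom.id_apply]
    obtain ⟨hS0, hSr⟩ := hFT.smooth hD0 hw
    rw [aeval_stepPoly] at hS0 hSr
    refine ⟨h1, c₁, c₂, p₁, p₂, m, d, l, fun i => toPY 1 (G i), w, hw.1, hw.2.1, hw.2.2.1,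
      hg.isRootOf, hg.ne_zero, hg.pos, h422, h522, h622, hg.other,
      hg.step, fun i hi => not_stopCriterion le_rfl (hGV i hi),
      fun i hi => ⟨(hG i hi).1, (hG i hi).2.spec⟩, ?_⟩
    rcases cases_height_two (hGV m le_rfl) (hGT.exists_ne_zero hδ0 hδ) with
      h4 | ⟨h4, h5, a, i, v, hv⟩ | ⟨h4, h5, e₁, g₁, q₁, q₂, v₁, v₂, hv₁, hv₂, hne', h221⟩
    · exact absurd h4 hGm
    · obtain ⟨hY0, hYr, hdvd, hYe⟩ := hGT.ramified hD20 two_pos hv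
      rw [hae] at hY0 hYr hYe
      obtain ⟨s, hs⟩ : ∃ s, 2 * (expSum k n + p₂ + expSum l m) + i = 2 * s + 1 :=
        ⟨(2 * (expSum k n + p₂ + expSum l m) + i) / 2, by omega⟩
      rw [hs] at hdvd hY0 hYr hYe
      exact ⟨h5, Or.inl ⟨h4, a, i, s, v, by simpa using hv.1, hv.2.1, hv.2.2.1, hs,
        branchesAt_smooth_and_cusp hf h3 hS0 hY0 hSr hYr hdvd hYe⟩⟩
    · obtain ⟨hY0, hYr⟩ := hGT.smooth hD20 hv₁
      obtain ⟨hZ0, hZr⟩ := hGT.smooth hD20 hv₂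
      rw [hae, one_mul] at hY0 hYr hZ0 hZr
      refine ⟨h5, Or.inr ⟨h4, e₁, g₁, q₁, q₂, v₁, v₂, hv₁.1, hv₂.1, hne', hv₁.2.1, hv₁.2.2.1,
        hv₂.2.1, hv₂.2.2.1, h221, ?_⟩⟩
      have hinj := injective_vec_three (ne_of_double_root (S := stepSum 1 0 n b k)
        (K := expSum k n) (d := d) hw hg.ne_zero hg.pos hne hl hv₁)
        (ne_of_double_root (d := d) hw hg.ne_zero hg.pos hne hl hv₂) (fun he => by
          rw [tail_add _ _ q₁, tail_add _ _ q₂] at he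
          exact hne' (eq_of_tail_eq hv₁.2.1 hv₁.2.2.1 hv₂.2.1 hv₂.2.2.1
            (mul_left_cancel₀ (pow_ne_zero _ PowerSeries.X_ne_zero) (add_left_cancel he))))
      have := branchesAt_three_smooth hf h3 hinj (fun j => by fin_cases j <;> assumption)
        (fun j => by fin_cases j <;> assumption)
      convert this using 1
      funext j
      fin_cases j <;> rfl
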